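/- Let $d\ge 1$ and let $1\le\theta<p<\infty$, $1/p<s\le 1/\theta$. *Spaces.* Write $\mathcal F f(\xi)=\int f(y)e^{-2\pi i\langle\xi,y\rangle}\,dy$. Let $L\in\mathbb N_0$ with $L+1>s$ and let $\Psi_0,\Psi_1\in C_0^\infty(\mathbb R)$ be any two functions such that, for some $\varepsilon>0$, $\mathcal F\Psi_0(\xi)\ne0$ for $|\xi|<\varepsilon$, $\mathcal F\Psi_1(\xi)\neq0$ for $\varepsilon/2<|\xi|<2\varepsilon$, and $D^\alpha\mathcal F\Psi_1(0)=0$ for $0\le\alpha\le L$. Put $\Psi_j(t)=2^{j-1}\Psi_1(2^{j-1}t)$ for $j\ge1$ and $\Psi_m(x)=\prod_{i=1}^d\Psi_{m_i}(x_i)$ for $m\in\mathbb N_0^d$. For a tempered distribution $f$ on $\mathbb R^d$ let $$\|f\|_{\mathbf F^s_{p,\theta}}=\Big\|\Big(\sum_{m\in\mathbb N_0^d}2^{s|m|_1\theta}|\Psi_m*f(\cdot)|^\theta\Big)^{1/\theta}\Big\|_{L_p(\mathbb R^d)},$$ and let $\mathring{\mathbf F}^s_{p,\theta}$ be the space of all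 tempered distributions $f$ with $\|f\|_{\mathbf F^s_{p,\theta}}<\infty$ and $\operatorname{supp} f\subset[0,1]^d$. Every such $f$ is (represented by) a continuous function, and point values $f(x)$ are those of this function. *Errors.* For a rule $Q$ that uses finitely many function values let $$e(Q,\mathring{\mathbf F}^s_{p,\theta})=\sup_{f\in\mathring{\mathbf F}^s_{p,\theta},\ \|f\|_{\mathbf F^s_{p,\theta}}\le1}\Big|\int_{[0,1]^d}f(x)\,dx-Q(f)\Big|,$$ and let $\mathrm{Int}_n(\mathring{\mathbf F}^s_{p,\theta})$ be the infimum of $e(Q,\mathring{\mathbf F}^s_{p,\theta})$ over all $Q(f)=\sum_{i=1}^n\lambda^if(x^i)$ with $x^1,\dots,x^n\in[0,1]^d$ and $\lambda^1,\dots,\lambda^n\in\mathbb R$. *Frolov's rule.* The polynomial $P_d(t)=\prod_{j=1}^d(t-2j+1)-1$ has $d$ real roots (counted with multiplicity); list them in any order as $\xi_1,\dots,\xi_d$. Let $\widetilde T=(\xi_i^{j-1})_{i,j=1}^d$, $T_n=(n|\det\widetilde T|)^{-1/d}\,\widetilde T$, $\mathbb X_n=T_n(\mathbb Z^d)$ and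 $$Q_n(f)=\frac1n\sum_{x\in\mathbb X_n\cap[0,1)^d}f(x).$$ There is a constant $C$ with $|\mathbb X_n\cap[0,1)^d|\le C\,n$ for all $n\ge 2$. *Theorem.* There is a constant $c>0$, independent of $n$, such that the following hold. (i) If $1/p<s<1/\theta$, then for all $n\ge2$ $$\mathrm{Int}_n(\mathring{\mathbf F}^s_{p,\theta})\le c\,n^{-s}(\log n)^{(d-1)(1-s)}\quad\text{and}\quad e(Q_n,\mathring{\mathbf F}^s_{p,\theta})\le c\,n^{-s}(\log n)^{(d-1)(1-s)}.$$ (ii) If $s=1/\theta$, then for all $n\ge3$ $$\mathrm{Int}_n(\mathring{\mathbf F}^s_{p,\theta})\le c\,n^{-s}(\log n)^{(d-1)(1-s)}(\log\log n)^{1-s}\quad\text{and}\quad e(Q_n,\mathring{\mathbf F}^s_{p,\theta})\le c\,n^{-s}(\log n)^{(d-1)(1-s)}(\log\log n)^{1-s}.$$ -/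

import Mathlib

open MeasureTheory
open scoped SchwartzMap ENNReal ContDiff FourierTransform

noncomputable section

/-! ### Local means kernels -/

/-- A pair of compactly supported smooth functions `ψ₀, ψ₁` on the line such that, for some `ε > 0`,
`𝓕 ψ₀ ≠ 0` on `|ξ| < ε` and `𝓕 ψ₁ ≠ 0` on `ε / 2 < |ξ| < 2 ε`, and such that the derivatives of
`𝓕 ψ₁` up to the order `L` vanish at `0`. -/
structure LocalMeansKernel (L : ℕ) where
  ψ₀ : ℝ → ℂ
  ψ₁ : ℝ → ℂ
  contDiff₀ : ContDiff ℝ ∞ ψ₀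
  contDiff₁ : ContDiff ℝ ∞ ψ₁
  hasCompactSupport₀ : HasCompactSupport ψ₀
  hasCompactSupport₁ : HasCompactSupport ψ₁
  tauberian : ∃ ε : ℝ, 0 < ε ∧ (∀ ξ : ℝ, |ξ| < ε → 𝓕 ψ₀ ξ ≠ 0) ∧
    (∀ ξ : ℝ, ε / 2 < |ξ| → |ξ| < 2 * ε → 𝓕 ψ₁ ξ ≠ 0)
  moment : ∀ α : ℕ, α ≤ L → iteratedDeriv α (𝓕 ψ₁) 0 = 0

namespace LocalMeansKernel

variable {L : ℕ} (Ψ : LocalMeansKernel L) {d : ℕ}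

/-- `Ψ_0 = ψ₀` and `Ψ_j = 2^(j-1) ψ₁(2^(j-1) ·)` for `j ≥ 1`. -/
def level : ℕ → ℝ → ℂ
  | 0 => Ψ.ψ₀
  | j + 1 => fun t => (2 : ℂ) ^ j * Ψ.ψ₁ ((2 : ℝ) ^ j * t)

/-- `Ψ_m(x) = ∏ i, Ψ_{m_i}(x_i)`. -/
def tensor (m : Fin d → ℕ) (x : EuclideanSpace ℝ (Fin d)) : ℂ :=
  ∏ i, Ψ.level (m i) (x i)

theorem level_contDiff (j : ℕ) : ContDiff ℝ ∞ (Ψ.level j) := by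
  cases j with
  | zero => exact Ψ.contDiff₀
  | succ j =>
    exact contDiff_const.mul (Ψ.contDiff₁.comp (contDiff_const.mul contDiff_id))

theorem level_hasCompactSupport (j : ℕ) : HasCompactSupport (Ψ.level j) := by
  cases j with
  | zero => exact Ψ.hasCompactSupport₀
  | succ j =>
    have h : HasCompactSupport fun t : ℝ => Ψ.ψ₁ ((2 : ℝ) ^ j * t) :=
      Ψ.hasCompactSupport₁.comp_homeomorph (Homeomorph.mulLeft₀ ((2 : ℝ) ^ j) (by positivity))
    exact h.mul_left

theorem tensor_contDiff (m : Fin d → ℕ) : ContDiff ℝ ∞ (Ψ.tensor m) := by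
  unfold tensor
  refine contDiff_prod fun i _ => (Ψ.level_contDiff (m i)).comp ?_
  fun_prop

theorem tensor_hasCompactSupport (m : Fin d → ℕ) :
    HasCompactSupport (Ψ.tensor m) := by
  have hK : IsCompact (Set.univ.pi fun i => tsupport (Ψ.level (m i))) :=
    isCompact_univ_pi fun i => Ψ.level_hasCompactSupport (m i)
  have hK' := (PiLp.homeomorph 2 (fun _ : Fin d => ℝ)).isCompact_preimage.mpr hK
  refine HasCompactSupport.of_support_subset_isCompact hK' ?_
  intro x hx i _
  refine subset_tsupport _ ?_
  rw [Function.mem_support] at hx ⊢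
  exact fun h => hx (Finset.prod_eq_zero (Finset.mem_univ i) h)

/-- The test function `y ↦ Ψ_m(x - y)`. -/
def shifted (m : Fin d → ℕ) (x : EuclideanSpace ℝ (Fin d)) :
    𝓢(EuclideanSpace ℝ (Fin d), ℂ) :=
  HasCompactSupport.toSchwartzMap (f := fun y => Ψ.tensor m (x - y))
    ((Ψ.tensor_hasCompactSupport m).comp_homeomorph (Homeomorph.subLeft x))
    ((Ψ.tensor_contDiff m).comp (contDiff_const.sub contDiff_id))

/-- The convolution of the kernel with a tempered distribution, `(Ψ_m ∗ f)(x) = f(Ψ_m(x - ·))`. -/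
def conv (m : Fin d → ℕ) (f : 𝓢'(EuclideanSpace ℝ (Fin d), ℂ))
    (x : EuclideanSpace ℝ (Fin d)) : ℂ :=
  f (Ψ.shifted m x)

/-- The Triebel-Lizorkin norm of dominating mixed smoothness
`‖ (∑_m 2^(s |m|₁ θ) |Ψ_m ∗ f|^θ)^(1/θ) ‖_p` (for `0 < p, θ < ∞`), with values in `[0, ∞]`. -/
def tlNorm (s p θ : ℝ) (f : 𝓢'(EuclideanSpace ℝ (Fin d), ℂ)) : ℝ≥0∞ :=
  (∫⁻ x, ((∑' m : Fin d → ℕ,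
      ENNReal.ofReal ((2 : ℝ) ^ (s * (∑ i, (m i : ℝ)) * θ)) * ‖Ψ.conv m f x‖ₑ ^ θ)
        ^ (1 / θ)) ^ p) ^ (1 / p)

end LocalMeansKernel

/-! ### Functions supported in the unit cube -/

/-- The closed unit cube `[0,1]^d`. -/
def unitCube (d : ℕ) : Set (EuclideanSpace ℝ (Fin d)) := {x | ∀ i, x i ∈ Set.Icc (0 : ℝ) 1}

/-- The space of all distributions in `F^s_{p,θ}(ℝ^d)` with support in the unit cube. -/
def tlCubeSpace {L : ℕ} (Ψ : LocalMeansKernel L) (d : ℕ) (s p θ : ℝ) :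
    Set 𝓢'(EuclideanSpace ℝ (Fin d), ℂ) :=
  {f | Ψ.tlNorm s p θ f < ⊤ ∧ Distribution.dsupport f ⊆ unitCube d}

/-- The tempered distribution `f` is given by the continuous function `g`. -/
def IsContinuousRepresentative {d : ℕ} (f : 𝓢'(EuclideanSpace ℝ (Fin d), ℂ))
    (g : EuclideanSpace ℝ (Fin d) → ℂ) : Prop :=
  Continuous g ∧ ∀ φ : 𝓢(EuclideanSpace ℝ (Fin d), ℂ), Integrable (fun x => g x * φ x) ∧
    f φ = ∫ x, g x * φ x

/-- The unit ball of `tlCubeSpace`, its elements being regarded as continuous functions. -/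
def tlCubeBall {L : ℕ} (Ψ : LocalMeansKernel L) (d : ℕ) (s p θ : ℝ) :
    Set (EuclideanSpace ℝ (Fin d) → ℂ) :=
  {g | ∃ f ∈ tlCubeSpace Ψ d s p θ, Ψ.tlNorm s p θ f ≤ 1 ∧ IsContinuousRepresentative f g}

/-! ### Cubature -/

/-- The worst-case error over the class `K` of the rule `Q` for the integral over the unit cube. -/
def worstCaseError {d : ℕ} (K : Set (EuclideanSpace ℝ (Fin d) → ℂ))
    (Q : (EuclideanSpace ℝ (Fin d) → ℂ) → ℂ) : ℝ≥0∞ :=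
  ⨆ g ∈ K, ‖(∫ x in unitCube d, g x) - Q g‖ₑ

/-- The smallest worst-case error over `K` of a cubature formula with `n` nodes in the unit cube
and real weights. -/
def minimalError {d : ℕ} (K : Set (EuclideanSpace ℝ (Fin d) → ℂ)) (n : ℕ) : ℝ≥0∞ :=
  ⨅ (x : Fin n → unitCube d) (w : Fin n → ℝ),
    worstCaseError K fun g => ∑ i, (w i : ℂ) * g (x i)

/-- `ξ` lists the roots, with multiplicity, of `P_d(t) = ∏_{j=1}^d (t - (2 j - 1)) - 1`. -/
def IsFrolovRoots {d : ℕ} (ξ : Fin d → ℝ) : Prop :=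
  ∀ t : ℝ, (∏ j ∈ Finset.Icc 1 d, (t - (2 * (j : ℝ) - 1))) - 1 = ∏ j, (t - ξ j)

/-- The generator `(n |det V|)^(-1/d) V` of the lattice, where `V = (ξ_i^(j-1))_{i,j}`. -/
def frolovMatrix {d : ℕ} (ξ : Fin d → ℝ) (n : ℕ) : Matrix (Fin d) (Fin d) ℝ :=
  ((n : ℝ) * |(Matrix.vandermonde ξ).det|) ^ (-(1 / (d : ℝ))) • Matrix.vandermonde ξ

/-- The points of the lattice generated by `frolovMatrix ξ n` in the half-open cube `[0,1)^d`. -/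
def frolovNodes {d : ℕ} (ξ : Fin d → ℝ) (n : ℕ) : Set (EuclideanSpace ℝ (Fin d)) :=
  {x | (∃ k : Fin d → ℤ, ∀ i, x i = ((frolovMatrix ξ n).mulVec fun j => (k j : ℝ)) i) ∧
    ∀ i, x i ∈ Set.Ico (0 : ℝ) 1}

/-- Frolov's cubature rule. -/
def frolovRule {d : ℕ} (ξ : Fin d → ℝ) (n : ℕ) (g : EuclideanSpace ℝ (Fin d) → ℂ) : ℂ :=
  (n : ℂ)⁻¹ * ∑ᶠ x ∈ frolovNodes ξ n, g x

end

/-! Let T generate the Frolov lattice and let b run over its dual lattice. A continuous f supported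
in the unit cube vanishes on the faces, so the rule is |det T| times the sum of f over the whole
lattice, and Poisson summation makes the error the sum of 𝓕 f(b) over b ≠ 0. A frequency resolution
adapted to the local means (`BandResolution`) writes 𝓕 f as Σ_m σ_m 𝓕(Ψ_m ∗ f) with compactly
supported σ_m. The error becomes Σ_m ∫ K_m (Ψ_m ∗ f), where K_m(y) = Σ_{b ≠ 0} σ_m(b) e^{-2πi⟨b,y⟩}
(`aliasKernel`, `enorm_lattice_error_le`). As f has only limited smoothness, this is obtained as a
limit of smoothed identities.

The lattice enters through three facts about K_m (`exists_frolov_aliasKernel_bounds`): K_m = 0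
unless 2^|m| ≳ n; |K_m| ≲ 2^|m| / n; and the L_1 norm of K_m over a fixed cube is bounded. The first
two hold because nonzero dual points have coordinate products ≳ n, so the box supporting σ_m
contains none of them or at most a multiple of 2^|m| / n. The third is Poisson summation back to the
primal lattice. The underlying arithmetic is that P_d is irreducible with d real roots: coordinate
products of lattice points are norms of nonzero algebraic integers, and dual points are, up to a
scalar, lattice points again.

Hölder's inequality interpolates the two size bounds (`lintegral_mul_le_of_bounds`): for q ≥ 1, ∫
|K_m| |Ψ_m ∗ f| ≲ (2^|m| / n · ∫ |Ψ_m ∗ f|^q)^(1/q). A level |m| = t contains at most (t + 1)^(d-1)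
indices, about V = (log n)^(d-1) at the relevant levels. The choice q = θ serves the levels up to
2^|m| ≈ n V (`splitLevel`) and q = p those above; both blocks contribute n^(-s) V^(1-s)
(`sum_block_le`, `rpow_block_le`). The upper block decays geometrically because s > 1/p. The lower
one grows geometrically if s < 1/θ; if s = 1/θ, its roughly log log n levels all weigh the same,
which costs the factor (log log n)^(1-s). Arbitrary n-point rules are handled by running Frolov's
rule with a fixed fraction of n as parameter. -/

/-! ### The Frolov polynomial -/

section FrolovPolynomial

open Polynomial

/-- The integer polynomial `∏_{j=1}^d (X - (2 j - 1)) - 1`. -/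
noncomputable def frolovPoly (d : ℕ) : ℤ[X] :=
  (∏ j ∈ Finset.Icc 1 d, (X - C (2 * (j : ℤ) - 1))) - 1

theorem natDegree_prod_frolov (d : ℕ) :
    (∏ j ∈ Finset.Icc 1 d, (X - C (2 * (j : ℤ) - 1))).natDegree = d := by
  rw [natDegree_prod_of_monic _ _ fun j _ => monic_X_sub_C _]
  simp only [natDegree_X_sub_C, Finset.sum_const, Nat.card_Icc, smul_eq_mul]
  omega

theorem monic_frolovPoly {d : ℕ} (hd : 1 ≤ d) : (frolovPoly d).Monic := by
  unfold frolovPoly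
  refine (monic_prod_of_monic _ _ fun j _ => monic_X_sub_C _).sub_of_left ?_
  refine degree_lt_degree ?_
  rw [natDegree_prod_frolov, natDegree_one]
  omega

theorem natDegree_frolovPoly {d : ℕ} (hd : 1 ≤ d) : (frolovPoly d).natDegree = d := by
  unfold frolovPoly
  rw [natDegree_sub_eq_left_of_natDegree_lt, natDegree_prod_frolov]
  rw [natDegree_prod_frolov, natDegree_one]
  omega

theorem eval_frolovPoly_of_mem {d j : ℕ} (hj : j ∈ Finset.Icc 1 d) :
    (frolovPoly d).eval (2 * (j : ℤ) - 1) = -1 := by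
  unfold frolovPoly
  rw [eval_sub, eval_prod, Finset.prod_eq_zero hj]
  · simp
  · simp

/-- The polynomial equals -1 at the d odd integers 1, 3, ..., 2d - 1. In a factorisation f g the
values of f and g there are opposite units, so f + g has d zeros but degree below d. Hence f = -g,
which is impossible for two monic polynomials. -/
theorem irreducible_frolovPoly {d : ℕ} (hd : 1 ≤ d) : Irreducible (frolovPoly d) := by
  have hm := monic_frolovPoly hd
  rw [hm.irreducible_iff_natDegree']
  refine ⟨fun h => ?_, fun f g hf hg hfg hdeg => ?_⟩
  · have := natDegree_frolovPoly hd
    rw [h, natDegree_one] at this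
    omega
  rw [natDegree_frolovPoly hd, Finset.mem_Ioc] at hdeg
  have hsum : f.natDegree + g.natDegree = d := by
    rw [← hf.natDegree_mul hg, hfg, natDegree_frolovPoly hd]
  have hzero : f + g = 0 := by
    refine eq_zero_of_natDegree_lt_card_of_eval_eq_zero' (f + g)
      ((Finset.Icc 1 d).image fun j : ℕ => 2 * (j : ℤ) - 1) ?_ ?_
    · intro x hx
      obtain ⟨j, hj, rfl⟩ := Finset.mem_image.mp hx
      have h := eval_frolovPoly_of_mem hj
      rw [← hfg, eval_mul] at h
      rw [eval_add]
      rcases Int.eq_one_or_neg_one_of_mul_eq_neg_one h with h1 | h1 <;> rw [h1] at h ⊢ <;> omega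
    · rw [Finset.card_image_of_injective _ (fun a b h => by simpa using h), Nat.card_Icc]
      refine (natDegree_add_le _ _).trans_lt ?_
      rw [max_lt_iff]
      omega
  have hfneg : f = -g := eq_neg_of_add_eq_zero_left hzero
  have h1 : f.leadingCoeff = 1 := hf
  rw [hfneg, leadingCoeff_neg, hg.leadingCoeff] at h1
  norm_num at h1

theorem irreducible_map_frolovPoly {d : ℕ} (hd : 1 ≤ d) :
    Irreducible ((frolovPoly d).map (Int.castRingHom ℚ)) :=
  ((monic_frolovPoly hd).irreducible_iff_irreducible_map_fraction_map (K := ℚ)).mp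
    (irreducible_frolovPoly hd)

theorem eval_map_frolovPoly (d : ℕ) (t : ℝ) :
    ((frolovPoly d).map (Int.castRingHom ℝ)).eval t =
      (∏ j ∈ Finset.Icc 1 d, (t - (2 * (j : ℝ) - 1))) - 1 := by
  have h : ∀ j : ℕ, (C (2 * (j : ℤ) - 1) : ℤ[X]).map (Int.castRingHom ℝ) =
      C (2 * (j : ℝ) - 1) := fun j => by
    rw [map_C]
    simp
  rw [frolovPoly, Polynomial.map_sub, Polynomial.map_prod, Polynomial.map_one, eval_sub, eval_prod,
    eval_one]
  simp_rw [Polynomial.map_sub, map_X, h, eval_sub, eval_X, eval_C]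

theorem map_frolovPoly_eq {d : ℕ} {ξ : Fin d → ℝ} (hξ : IsFrolovRoots ξ) :
    (frolovPoly d).map (Int.castRingHom ℝ) = ∏ j, (X - C (ξ j)) := by
  refine Polynomial.funext fun t => ?_
  rw [eval_map_frolovPoly, hξ t, eval_prod]
  simp

theorem IsFrolovRoots.aeval_eq_zero {d : ℕ} {ξ : Fin d → ℝ} (hξ : IsFrolovRoots ξ) (i : Fin d) :
    aeval (ξ i) (frolovPoly d) = 0 := by
  have h := congrArg (eval (ξ i)) (map_frolovPoly_eq hξ)
  rw [eval_prod, Finset.prod_eq_zero (Finset.mem_univ i) (by simp), eval_map] at h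
  exact h

theorem IsFrolovRoots.injective {d : ℕ} (hd : 1 ≤ d) {ξ : Fin d → ℝ} (hξ : IsFrolovRoots ξ) :
    Function.Injective ξ := by
  rw [← separable_prod_X_sub_C_iff, ← map_frolovPoly_eq hξ]
  have h := (irreducible_map_frolovPoly hd).separable.map (f := algebraMap ℚ ℝ)
  rw [Polynomial.map_map] at h
  have e : (algebraMap ℚ ℝ).comp (Int.castRingHom ℚ) = Int.castRingHom ℝ := RingHom.ext_int _ _
  rw [e] at h
  exact h

/-- By irreducibility the Frolov polynomial is the minimal polynomial of every one of its roots. -/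
theorem IsFrolovRoots.aeval_ne_zero {d : ℕ} (hd : 1 ≤ d) {ξ : Fin d → ℝ} (hξ : IsFrolovRoots ξ)
    {R : ℤ[X]} (hR : R ≠ 0) (hdeg : R.degree < d) (i : Fin d) : aeval (ξ i) R ≠ 0 := by
  intro h
  have hm := monic_frolovPoly hd
  have hmin : (frolovPoly d).map (Int.castRingHom ℚ) = minpoly ℚ (ξ i) := by
    refine minpoly.eq_of_irreducible_of_monic (irreducible_map_frolovPoly hd) ?_ (hm.map _)
    have := hξ.aeval_eq_zero i
    rwa [← aeval_map_algebraMap ℚ] at this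
  have hdvd : minpoly ℚ (ξ i) ∣ R.map (Int.castRingHom ℚ) := by
    refine minpoly.dvd _ _ ?_
    rwa [← aeval_map_algebraMap ℚ] at h
  rw [← hmin] at hdvd
  have hR' : R.map (Int.castRingHom ℚ) ≠ 0 :=
    (Polynomial.map_ne_zero_iff (Int.cast_injective)).mpr hR
  have := degree_le_of_dvd hdvd hR'
  rw [degree_map_eq_of_injective (by exact Int.cast_injective),
    degree_map_eq_of_injective (by exact Int.cast_injective),
    degree_eq_natDegree hm.ne_zero, natDegree_frolovPoly hd] at this
  exact absurd hdeg (not_lt.mpr this)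

/-! ### Integrality of norms and traces, and coordinate products of lattice points -/

/-- The polynomial with coefficient vector `k`. -/
noncomputable def vecPoly {d : ℕ} (k : Fin d → ℤ) : ℤ[X] := ∑ j, C (k j) * X ^ (j : ℕ)

theorem degree_vecPoly_lt {d : ℕ} (k : Fin d → ℤ) : (vecPoly k).degree < d := by
  unfold vecPoly
  refine (degree_sum_le _ _).trans_lt ((Finset.sup_lt_iff (by simp [bot_lt_iff_ne_bot])).mpr fun j _ => ?_)
  refine (degree_C_mul_X_pow_le _ _).trans_lt ?_
  exact_mod_cast j.2

theorem coeff_vecPoly {d : ℕ} (k : Fin d → ℤ) (j : Fin d) : (vecPoly k).coeff j = k j := by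
  unfold vecPoly
  simp [coeff_X_pow, Fin.val_inj]

theorem aeval_vecPoly {d : ℕ} (k : Fin d → ℤ) (x : ℝ) :
    aeval x (vecPoly k) = ∑ j : Fin d, x ^ (j : ℕ) * k j := by
  unfold vecPoly
  simp [mul_comm]

theorem vandermonde_mulVec_apply {d : ℕ} (ξ : Fin d → ℝ) (k : Fin d → ℤ) (i : Fin d) :
    ((Matrix.vandermonde ξ).mulVec fun j => (k j : ℝ)) i = aeval (ξ i) (vecPoly k) := by
  rw [aeval_vecPoly]
  simp [Matrix.mulVec, dotProduct, Matrix.vandermonde_apply]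

/-- Division by the monic Frolov polynomial stays over ℤ, and the same remainder serves all the
roots. -/
theorem exists_int_vec_aeval {d : ℕ} (hd : 1 ≤ d) {ξ : Fin d → ℝ} (hξ : IsFrolovRoots ξ)
    (R : ℤ[X]) : ∃ c : Fin d → ℤ, ∀ i, aeval (ξ i) R = ∑ j : Fin d, ξ i ^ (j : ℕ) * c j := by
  have hm := monic_frolovPoly hd
  refine ⟨fun j => (R %ₘ frolovPoly d).coeff j, fun i => ?_⟩
  have h1 : aeval (ξ i) R = aeval (ξ i) (R %ₘ frolovPoly d) := by
    conv_lhs => rw [← modByMonic_add_div R (frolovPoly d)]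
    rw [map_add, map_mul, hξ.aeval_eq_zero i]
    simp
  have hdeg : (R %ₘ frolovPoly d).natDegree < d := by
    have h := natDegree_modByMonic_lt R hm (fun h => by
      have := natDegree_frolovPoly hd
      rw [h, natDegree_one] at this
      omega)
    rwa [natDegree_frolovPoly hd] at h
  rw [h1, aeval_eq_sum_range' hdeg, Finset.sum_range]
  simp [mul_comm]

/-- `M` is the matrix of multiplication by `R` on ℤ[X]/(P_d) in the power basis, and the Vandermonde
matrix diagonalises it. Its determinant and trace are the norm and trace of `R`, which are therefore
integers. -/
theorem exists_int_matrix {d : ℕ} (hd : 1 ≤ d) {ξ : Fin d → ℝ} (hξ : IsFrolovRoots ξ)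
    (R : ℤ[X]) : ∃ M : Matrix (Fin d) (Fin d) ℤ,
      Matrix.vandermonde ξ * M.map (Int.cast : ℤ → ℝ) =
        Matrix.diagonal (fun i => aeval (ξ i) R) * Matrix.vandermonde ξ := by
  choose c hc using fun j : Fin d => exists_int_vec_aeval hd hξ (R * X ^ (j : ℕ))
  refine ⟨Matrix.of fun l j => c j l, ?_⟩
  ext i j
  rw [Matrix.diagonal_mul, Matrix.vandermonde_apply, Matrix.mul_apply]
  simp only [Matrix.vandermonde_apply, Matrix.map_apply, Matrix.of_apply]
  rw [← hc j i]
  simp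

theorem IsFrolovRoots.det_ne_zero {d : ℕ} (hd : 1 ≤ d) {ξ : Fin d → ℝ} (hξ : IsFrolovRoots ξ) :
    (Matrix.vandermonde ξ).det ≠ 0 :=
  Matrix.det_vandermonde_ne_zero_iff.mpr (hξ.injective hd)

theorem exists_int_prod_aeval {d : ℕ} (hd : 1 ≤ d) {ξ : Fin d → ℝ} (hξ : IsFrolovRoots ξ)
    (R : ℤ[X]) : ∃ N : ℤ, ∏ i, aeval (ξ i) R = (N : ℝ) := by
  obtain ⟨M, hM⟩ := exists_int_matrix hd hξ R
  refine ⟨M.det, ?_⟩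
  have h := congrArg Matrix.det hM
  rw [Matrix.det_mul, Matrix.det_mul, Matrix.det_diagonal, mul_comm] at h
  rw [← mul_right_cancel₀ (hξ.det_ne_zero hd) h]
  exact (Int.cast_det M).symm

theorem exists_int_sum_aeval {d : ℕ} (hd : 1 ≤ d) {ξ : Fin d → ℝ} (hξ : IsFrolovRoots ξ)
    (R : ℤ[X]) : ∃ N : ℤ, ∑ i, aeval (ξ i) R = (N : ℝ) := by
  obtain ⟨M, hM⟩ := exists_int_matrix hd hξ R
  refine ⟨M.trace, ?_⟩
  have hu : IsUnit (Matrix.vandermonde ξ).det := (hξ.det_ne_zero hd).isUnit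
  have h : M.map (Int.cast : ℤ → ℝ) = (Matrix.vandermonde ξ)⁻¹ *
      (Matrix.diagonal (fun i => aeval (ξ i) R) * Matrix.vandermonde ξ) := by
    rw [← hM, ← mul_assoc, Matrix.nonsing_inv_mul _ hu, one_mul]
  have h2 := congrArg Matrix.trace h
  rw [Matrix.trace_mul_comm, mul_assoc, Matrix.mul_nonsing_inv _ hu, mul_one,
    Matrix.trace_diagonal] at h2
  rw [← h2]
  simp [Matrix.trace]

/-- The points of the Vandermonde lattice have coordinate products at least `1` in modulus. -/
theorem IsFrolovRoots.one_le_prod {d : ℕ} (hd : 1 ≤ d) {ξ : Fin d → ℝ} (hξ : IsFrolovRoots ξ)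
    {k : Fin d → ℤ} (hk : k ≠ 0) :
    1 ≤ ∏ i, |((Matrix.vandermonde ξ).mulVec fun j => (k j : ℝ)) i| := by
  simp_rw [vandermonde_mulVec_apply]
  have hne : vecPoly k ≠ 0 := fun h => hk <| by
    ext j
    rw [← coeff_vecPoly k j, h]
    simp
  -- The coordinate product is the norm of a polynomial of degree below d: an integer, and nonzero
  -- because no root annihilates that polynomial.
  obtain ⟨N, hN⟩ := exists_int_prod_aeval hd hξ (vecPoly k)
  rw [← Finset.abs_prod, hN, ← Int.cast_abs]
  have hN0 : N ≠ 0 := by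
    rintro rfl
    rw [Int.cast_zero, Finset.prod_eq_zero_iff] at hN
    obtain ⟨i, _, hi⟩ := hN
    exact hξ.aeval_ne_zero hd hne (degree_vecPoly_lt k) i hi
  exact_mod_cast Int.one_le_abs hN0

/-- The points of the dual of the Vandermonde lattice have coordinate products bounded below. -/
theorem IsFrolovRoots.exists_le_prod_dual {d : ℕ} (hd : 1 ≤ d) {ξ : Fin d → ℝ}
    (hξ : IsFrolovRoots ξ) : ∃ c : ℝ, 0 < c ∧ ∀ k : Fin d → ℤ, k ≠ 0 →
    c ≤ ∏ i, |((Matrix.vandermonde ξ)⁻¹.transpose.mulVec fun j => (k j : ℝ)) i| := by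
  set V := Matrix.vandermonde ξ with hV
  have hdet : V.det ≠ 0 := hξ.det_ne_zero hd
  -- The Gram matrix VᵀV has the power sums of the roots as entries, so it is integral.
  choose N hN using fun m : ℕ => exists_int_sum_aeval hd hξ (X ^ m)
  set G : Matrix (Fin d) (Fin d) ℤ := Matrix.of fun j l => N (j + l) with hG
  have hGV : G.map (Int.cast : ℤ → ℝ) = V.transpose * V := by
    ext j l
    rw [Matrix.map_apply, hG, Matrix.of_apply, ← hN, Matrix.mul_apply]
    simp [hV, Matrix.vandermonde_apply, pow_add]
  have hGdet : ((G.det : ℤ) : ℝ) = V.det ^ 2 := by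
    rw [Int.cast_det, show (G.map Int.cast) = V.transpose * V from hGV, Matrix.det_mul,
      Matrix.det_transpose, sq]
  have hG0 : G.det ≠ 0 := by
    intro h
    rw [h, Int.cast_zero] at hGdet
    exact hdet (by simpa using hGdet.symm)
  have hadj : G.adjugate.map (Int.cast : ℤ → ℝ) = (V.transpose * V).adjugate := by
    rw [← hGV]
    exact (RingHom.map_adjugate (Int.castRingHom ℝ) G)
  -- Since V⁻ᵀ = V (VᵀV)⁻¹ and the adjugate of the Gram matrix is integral, the dual lattice scaled
  -- by (det V)² lies in the Vandermonde lattice, where the coordinate products are already bounded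
  -- below.
  have hinv : (V.det ^ 2) • V⁻¹.transpose = V * G.adjugate.map (Int.cast : ℤ → ℝ) := by
    have h1 : V * (V.transpose * V).adjugate * (V.transpose * V) = (V.det ^ 2) • V := by
      rw [mul_assoc, Matrix.adjugate_mul, Matrix.det_mul, Matrix.det_transpose, sq]
      simp
    have h2 : V.transpose * (V⁻¹).transpose = 1 := by
      rw [← Matrix.transpose_mul, Matrix.nonsing_inv_mul _ hdet.isUnit, Matrix.transpose_one]
    have h3 : V * V⁻¹ = 1 := Matrix.mul_nonsing_inv _ hdet.isUnit
    rw [hadj]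
    calc (V.det ^ 2) • V⁻¹.transpose = ((V.det ^ 2) • V) * V⁻¹ * V⁻¹.transpose := by
          rw [Matrix.smul_mul, h3, Matrix.smul_mul, one_mul]
      _ = V * (V.transpose * V).adjugate * (V.transpose * (V * V⁻¹) * V⁻¹.transpose) := by
          rw [← h1]; simp only [mul_assoc]
      _ = _ := by rw [h3, mul_one, h2, mul_one]
  have hc : 0 < (V.det ^ 2)⁻¹ := inv_pos.mpr (by positivity)
  refine ⟨((V.det ^ 2)⁻¹) ^ d, by positivity, fun k hk => ?_⟩
  have hk' : G.adjugate.mulVec k ≠ 0 := by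
    intro h
    have h2 := congrArg G.mulVec h
    rw [Matrix.mulVec_mulVec, Matrix.mul_adjugate, Matrix.mulVec_zero, Matrix.smul_mulVec,
      Matrix.one_mulVec] at h2
    exact hk ((smul_eq_zero.mp h2).resolve_left hG0)
  have hrew : ∀ i, (V⁻¹.transpose.mulVec fun j => (k j : ℝ)) i =
      (V.det ^ 2)⁻¹ * (V.mulVec fun j => ((G.adjugate.mulVec k) j : ℝ)) i := by
    intro i
    have h1 : V⁻¹.transpose = (V.det ^ 2)⁻¹ • (V * G.adjugate.map (Int.cast : ℤ → ℝ)) := by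
      rw [← hinv, smul_smul, inv_mul_cancel₀ (by positivity), one_smul]
    have h2 : (fun j => ((G.adjugate.mulVec k) j : ℝ)) =
        (G.adjugate.map (Int.cast : ℤ → ℝ)).mulVec fun j => (k j : ℝ) := by
      ext j
      simp [Matrix.mulVec, dotProduct]
    rw [h1, h2, Matrix.smul_mulVec, Matrix.mulVec_mulVec]
    rfl
  simp_rw [hrew, abs_mul, Finset.prod_mul_distrib, Finset.prod_const, Finset.card_univ,
    Fintype.card_fin, abs_of_pos hc]
  exact le_mul_of_one_le_right (by positivity) (hξ.one_le_prod hd hk')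

/-! ### Existence of d real roots -/

/-- The product `∏_{j=1}^d (2 k - (2 j - 1))` has the sign `(-1)^(d-k)`. -/
theorem neg_one_pow_mul_prod_pos {d k : ℕ} (hk : k ≤ d) :
    0 < (-1 : ℤ) ^ (d - k) * ∏ j ∈ Finset.Icc 1 d, (2 * (k : ℤ) - (2 * (j : ℤ) - 1)) := by
  have h : (-1 : ℤ) ^ (d - k) = ∏ j ∈ Finset.Icc 1 d, if k < j then (-1 : ℤ) else 1 := by
    rw [Finset.prod_ite, Finset.prod_const_one, mul_one, Finset.prod_const]
    congr 1
    have : (Finset.Icc 1 d).filter (fun j => k < j) = Finset.Icc (k + 1) d := by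
      ext j
      simp only [Finset.mem_filter, Finset.mem_Icc]
      omega
    rw [this, Nat.card_Icc]
    omega
  rw [h, ← Finset.prod_mul_distrib]
  refine Finset.prod_pos fun j _ => ?_
  split_ifs <;> omega

theorem eval_frolovPoly_two_mul {d k : ℕ} :
    (frolovPoly d).eval (2 * (k : ℤ)) =
      (∏ j ∈ Finset.Icc 1 d, (2 * (k : ℤ) - (2 * (j : ℤ) - 1))) - 1 := by
  simp only [frolovPoly, eval_sub, eval_prod, eval_X, eval_C, eval_one]

theorem neg_one_pow_mul_eval_pos {d k : ℕ} (hk : k < d) :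
    0 < (-1 : ℤ) ^ (d - k) * (frolovPoly d).eval (2 * (k : ℤ)) := by
  have h := neg_one_pow_mul_prod_pos hk.le
  rw [eval_frolovPoly_two_mul]
  set q := ∏ j ∈ Finset.Icc 1 d, (2 * (k : ℤ) - (2 * (j : ℤ) - 1)) with hq
  rcases Nat.even_or_odd (d - k) with he | ho
  · rw [he.neg_one_pow, one_mul] at h ⊢
    -- For even d - k the product is positive and must stay positive after subtracting 1. Its factor
    -- with j = k + 2 is -3, so it is at least 3.
    have hdvd : (3 : ℤ) ∣ q := by
      have hmem : k + 2 ∈ Finset.Icc 1 d := by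
        obtain ⟨r, hr⟩ := he
        simp only [Finset.mem_Icc]
        omega
      refine Dvd.dvd.trans ⟨-1, ?_⟩ (Finset.dvd_prod_of_mem _ hmem)
      push_cast
      ring
    obtain ⟨r, hr⟩ := hdvd
    omega
  · rw [ho.neg_one_pow] at h ⊢
    omega

theorem eval_frolovPoly_two_mul_self_nonneg (d : ℕ) :
    0 ≤ (frolovPoly d).eval (2 * (d : ℤ)) := by
  have h := neg_one_pow_mul_prod_pos (le_refl d)
  rw [Nat.sub_self, pow_zero, one_mul] at h
  rw [eval_frolovPoly_two_mul]
  omega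

/-- The signs at 0, 2, ..., 2d alternate, which places a root between consecutive even integers. The
intervals are closed on the right because the value at 2d may be zero, as it is for d = 1. -/
theorem exists_isFrolovRoots {d : ℕ} (hd : 1 ≤ d) : ∃ ξ : Fin d → ℝ, IsFrolovRoots ξ := by
  set P : ℝ[X] := (frolovPoly d).map (Int.castRingHom ℝ) with hP
  have hint : ∀ k : ℕ, P.eval (2 * (k : ℝ)) = (((frolovPoly d).eval (2 * (k : ℤ)) : ℤ) : ℝ) := by
    intro k
    have := eval_intCast_map (Int.castRingHom ℝ) (frolovPoly d) (2 * (k : ℤ))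
    rw [hP]
    push_cast at this
    simpa using this
  have hcont : Continuous fun t => P.eval t := P.continuous
  have hroot : ∀ k : Fin d, ∃ x : ℝ, x ∈ Set.Ioc (2 * (k : ℝ)) (2 * (k : ℝ) + 2) ∧ P.eval x = 0 := by
    intro k
    have h1 : 0 < (-1 : ℝ) ^ (d - (k : ℕ)) * P.eval (2 * (k : ℝ)) := by
      rw [hint]
      exact_mod_cast neg_one_pow_mul_eval_pos k.2
    have h2 : (-1 : ℝ) ^ (d - (k : ℕ)) * P.eval (2 * (k : ℝ) + 2) ≤ 0 := by
      have hc : (2 * (k : ℝ) + 2) = 2 * ((k + 1 : ℕ) : ℝ) := by push_cast; ring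
      rw [hc, hint]
      rcases Nat.lt_or_ge (k + 1) d with hlt | hge
      · have h := neg_one_pow_mul_eval_pos hlt
        have hexp : d - (k : ℕ) = (d - (k + 1)) + 1 := by omega
        rw [hexp, pow_succ]
        have h' : (0 : ℝ) < (-1 : ℝ) ^ (d - (k + 1 : ℕ)) *
            (((frolovPoly d).eval (2 * ((k + 1 : ℕ) : ℤ)) : ℤ) : ℝ) := by
          exact_mod_cast h
        linarith
      · have hk : (k : ℕ) + 1 = d := by have := k.2; omega
        have h := eval_frolovPoly_two_mul_self_nonneg d
        have hexp : d - (k : ℕ) = 1 := by omega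
        rw [hexp, hk, pow_one]
        have h' : (0 : ℝ) ≤ (((frolovPoly d).eval (2 * (d : ℤ)) : ℤ) : ℝ) := by exact_mod_cast h
        linarith
    have hle : 2 * (k : ℝ) ≤ 2 * (k : ℝ) + 2 := by linarith
    obtain ⟨x, hx, hx0⟩ := intermediate_value_Ioc' hle
      (f := fun t => (-1 : ℝ) ^ (d - (k : ℕ)) * P.eval t)
      (by fun_prop) (Set.mem_Ico.mpr ⟨h2, h1⟩ : (0 : ℝ) ∈ _)
    exact ⟨x, hx, (mul_eq_zero.mp hx0).resolve_left (pow_ne_zero _ (by norm_num))⟩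
  choose x hx hx0 using hroot
  have hinj : Function.Injective x := by
    intro a b hab
    by_contra hne
    have hne' : (a : ℕ) ≠ b := fun h => hne (Fin.ext h)
    have ha := hx a
    have hb := hx b
    rw [hab] at ha
    rcases lt_or_gt_of_ne hne' with h | h
    · have : (a : ℝ) + 1 ≤ b := by exact_mod_cast h
      linarith [ha.2, hb.1]
    · have : (b : ℝ) + 1 ≤ a := by exact_mod_cast h
      linarith [hb.2, ha.1]
  refine ⟨x, fun t => ?_⟩
  have hm : P.Monic := (monic_frolovPoly hd).map _
  have hdeg : P.natDegree = d := by
    rw [hP, (monic_frolovPoly hd).natDegree_map, natDegree_frolovPoly hd]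
  have hprod : P = ∏ j, (X - C (x j)) := by
    have hdvd : (∏ j, (X - C (x j))) ∣ P := by
      refine Finset.prod_dvd_of_coprime ?_ fun j _ => dvd_iff_isRoot.mpr (hx0 j)
      intro a _ b _ hab
      exact pairwise_coprime_X_sub_C hinj hab
    refine (eq_of_monic_of_dvd_of_natDegree_le (monic_prod_of_monic _ _ fun j _ =>
      monic_X_sub_C _) hm hdvd ?_)
    rw [natDegree_prod_of_monic _ _ fun j _ => monic_X_sub_C _]
    simp [hdeg]
  rw [← eval_map_frolovPoly, ← hP, hprod, eval_prod]
  simp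

end FrolovPolynomial

/-! ### Admissible lattices -/

/-- The point `T k` of the lattice generated by `T`. -/
def latPt {d : ℕ} (T : Matrix (Fin d) (Fin d) ℝ) (k : Fin d → ℤ) : EuclideanSpace ℝ (Fin d) :=
  WithLp.toLp 2 (T.mulVec fun j => (k j : ℝ))

theorem latPt_apply {d : ℕ} (T : Matrix (Fin d) (Fin d) ℝ) (k : Fin d → ℤ) (i : Fin d) :
    latPt T k i = (T.mulVec fun j => (k j : ℝ)) i := rfl

theorem latPt_zero {d : ℕ} (T : Matrix (Fin d) (Fin d) ℝ) : latPt T 0 = 0 := by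
  ext i
  simp [latPt_apply, Matrix.mulVec, dotProduct]

theorem latPt_sub_apply {d : ℕ} (T : Matrix (Fin d) (Fin d) ℝ) (k l : Fin d → ℤ) (i : Fin d) :
    latPt T (k - l) i = latPt T k i - latPt T l i := by
  simp only [latPt_apply, Matrix.mulVec, dotProduct, Pi.sub_apply]
  push_cast
  rw [← Finset.sum_sub_distrib]
  exact Finset.sum_congr rfl fun j _ => by ring

/-- Every nonzero point of the lattice generated by `T` has a coordinate product of modulus at
least `v`. -/
def IsAdmissible {d : ℕ} (T : Matrix (Fin d) (Fin d) ℝ) (v : ℝ) : Prop :=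
  ∀ k : Fin d → ℤ, k ≠ 0 → v ≤ ∏ i, |latPt T k i|

theorem IsAdmissible.injective {d : ℕ} (hd : 1 ≤ d) {T : Matrix (Fin d) (Fin d) ℝ} {v : ℝ}
    (hv : 0 < v) (hT : IsAdmissible T v) : Function.Injective (latPt T) := by
  intro k l hkl
  by_contra hne
  have h := hT (k - l) (sub_ne_zero.mpr hne)
  rw [Finset.prod_eq_zero (Finset.mem_univ (⟨0, hd⟩ : Fin d))] at h
  · linarith
  · rw [latPt_sub_apply, hkl]
    simp

/-- The lattice points of an admissible lattice in a box, as indices. -/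
def boxIndices {d : ℕ} (T : Matrix (Fin d) (Fin d) ℝ) (a ℓ : Fin d → ℝ) : Set (Fin d → ℤ) :=
  {k | ∀ i, latPt T k i ∈ Set.Icc (a i) (a i + ℓ i)}

/-- Pigeonhole: cut the box into `N` > vol / v slabs along one coordinate. Two lattice points in one
slab would differ by a nonzero lattice vector with coordinate product at most vol / N < v. -/
theorem IsAdmissible.exists_finset {d : ℕ} (hd : 1 ≤ d) {T : Matrix (Fin d) (Fin d) ℝ} {v : ℝ}
    (hv : 0 < v) (hT : IsAdmissible T v) (a ℓ : Fin d → ℝ) (hℓ : ∀ i, 0 ≤ ℓ i) :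
    ∃ s : Finset (Fin d → ℤ), (s : Set (Fin d → ℤ)) = boxIndices T a ℓ ∧
      (s.card : ℝ) ≤ (∏ i, ℓ i) / v + 2 := by
  classical
  set W := ∏ i, ℓ i with hW
  have hW0 : 0 ≤ W := Finset.prod_nonneg fun i _ => hℓ i
  set N : ℕ := ⌊W / v⌋₊ + 1 with hN
  have hNpos : (0 : ℝ) < N := by positivity
  have hWN : W < N * v := by
    have := Nat.lt_floor_add_one (W / v)
    rw [div_lt_iff₀ hv] at this
    rw [hN]
    push_cast
    exact this
  let i0 : Fin d := ⟨0, hd⟩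
  -- The slab index. The far face of the box has index `N`, so there are `N + 1` possible values. If
  -- the side is degenerate, division by zero gives every point the index 0.
  let piece : (Fin d → ℤ) → ℕ := fun k => ⌊(latPt T k i0 - a i0) * N / ℓ i0⌋₊
  have hinj : Set.InjOn piece (boxIndices T a ℓ) := by
    intro k hk l hl hkl
    by_contra hne
    have hadm := hT (k - l) (sub_ne_zero.mpr hne)
    have habs : ∀ i, |latPt T (k - l) i| ≤ ℓ i := fun i => by
      rw [latPt_sub_apply, abs_le]
      have h1 := hk i
      have h2 := hl i
      constructor <;> linarith [h1.1, h1.2, h2.1, h2.2]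
    have h0 : |latPt T (k - l) i0| * N ≤ ℓ i0 := by
      rcases (hℓ i0).eq_or_lt with h | h
      · have := habs i0
        rw [← h] at this ⊢
        rw [le_antisymm this (abs_nonneg _), zero_mul]
      · rw [latPt_sub_apply]
        have hk0 : 0 ≤ (latPt T k i0 - a i0) * N / ℓ i0 := by
          have := (hk i0).1
          exact div_nonneg (mul_nonneg (by linarith) hNpos.le) h.le
        have hl0 : 0 ≤ (latPt T l i0 - a i0) * N / ℓ i0 := by
          have := (hl i0).1
          exact div_nonneg (mul_nonneg (by linarith) hNpos.le) h.le
        have h1 := Nat.floor_le hk0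
        have h2 := Nat.lt_floor_add_one ((latPt T k i0 - a i0) * N / ℓ i0)
        have h3 := Nat.floor_le hl0
        have h4 := Nat.lt_floor_add_one ((latPt T l i0 - a i0) * N / ℓ i0)
        have hkl' : ⌊(latPt T k i0 - a i0) * N / ℓ i0⌋₊ = ⌊(latPt T l i0 - a i0) * N / ℓ i0⌋₊ := hkl
        rw [hkl'] at h1 h2
        have h5 : |(latPt T k i0 - a i0) * N / ℓ i0 - (latPt T l i0 - a i0) * N / ℓ i0| ≤ 1 := by
          rw [abs_le]
          constructor <;> linarith
        have h6 : (latPt T k i0 - a i0) * N / ℓ i0 - (latPt T l i0 - a i0) * N / ℓ i0 =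
            (latPt T k i0 - latPt T l i0) * N / ℓ i0 := by ring
        rw [h6, abs_div, abs_mul, abs_of_pos hNpos, abs_of_pos h, div_le_one h] at h5
        exact h5
    have hprod : (∏ i, |latPt T (k - l) i|) * N ≤ W := by
      rw [hW, ← Finset.mul_prod_erase Finset.univ _ (Finset.mem_univ i0),
        ← Finset.mul_prod_erase Finset.univ ℓ (Finset.mem_univ i0), mul_right_comm]
      refine mul_le_mul h0 ?_ (Finset.prod_nonneg fun _ _ => abs_nonneg _) (hℓ i0)
      exact Finset.prod_le_prod (fun _ _ => abs_nonneg _) fun i _ => habs i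
    have : v * N ≤ W := (mul_le_mul_of_nonneg_right hadm hNpos.le).trans hprod
    linarith
  have hmaps : Set.MapsTo piece (boxIndices T a ℓ) (Finset.range (N + 1) : Finset ℕ) := by
    intro k hk
    rw [Finset.mem_coe, Finset.mem_range, Nat.lt_succ_iff]
    refine Nat.floor_le_of_le ?_
    have h := hk i0
    rcases (hℓ i0).eq_or_lt with h0 | h0
    · rw [← h0, div_zero]
      exact hNpos.le
    · rw [div_le_iff₀ h0, mul_comm (N : ℝ)]
      exact mul_le_mul_of_nonneg_right (by linarith [h.2]) hNpos.le
  have hfin : (boxIndices T a ℓ).Finite :=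
    Set.Finite.of_injOn hmaps hinj (Finset.finite_toSet _)
  refine ⟨hfin.toFinset, hfin.coe_toFinset, ?_⟩
  have hcard : hfin.toFinset.card ≤ (Finset.range (N + 1)).card := by
    refine Finset.card_le_card_of_injOn piece ?_ ?_
    · intro k hk
      exact hmaps ((Set.Finite.mem_toFinset hfin).mp hk)
    · rwa [hfin.coe_toFinset]
  rw [Finset.card_range] at hcard
  have hf := Nat.floor_le (div_nonneg hW0 hv.le)
  have hcard' : (hfin.toFinset.card : ℝ) ≤ (N : ℝ) + 1 := by exact_mod_cast hcard
  rw [hN] at hcard'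
  push_cast at hcard'
  linarith

/-! ### The Frolov lattice -/

section FrolovLattice

variable {d : ℕ} {ξ : Fin d → ℝ}

theorem frolovScale_pow (hd : 1 ≤ d) {x : ℝ} (hx : 0 < x) : (x ^ (-(1 / (d : ℝ)))) ^ d = x⁻¹ := by
  have hd0 : (d : ℝ) ≠ 0 := by positivity
  rw [← Real.rpow_natCast, ← Real.rpow_mul hx.le]
  rw [show -(1 / (d : ℝ)) * d = -1 by field_simp, Real.rpow_neg_one]

theorem abs_det_frolovMatrix (hd : 1 ≤ d) (hξ : IsFrolovRoots ξ) {n : ℕ} (hn : 1 ≤ n) :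
    |(frolovMatrix ξ n).det| = (n : ℝ)⁻¹ := by
  have hD : 0 < |(Matrix.vandermonde ξ).det| := abs_pos.mpr (hξ.det_ne_zero hd)
  have hn' : (0 : ℝ) < n := by positivity
  rw [frolovMatrix, Matrix.det_smul, Fintype.card_fin, frolovScale_pow hd (by positivity), abs_mul,
    abs_of_pos (by positivity)]
  field_simp

theorem isAdmissible_frolovMatrix (hd : 1 ≤ d) (hξ : IsFrolovRoots ξ) {n : ℕ} (hn : 1 ≤ n) :
    IsAdmissible (frolovMatrix ξ n) ((n : ℝ) * |(Matrix.vandermonde ξ).det|)⁻¹ := by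
  have hD : 0 < |(Matrix.vandermonde ξ).det| := abs_pos.mpr (hξ.det_ne_zero hd)
  have hn' : (0 : ℝ) < n := by positivity
  intro k hk
  have h := hξ.one_le_prod hd hk
  simp_rw [latPt_apply, frolovMatrix, Matrix.smul_mulVec, Pi.smul_apply, smul_eq_mul, abs_mul,
    Finset.prod_mul_distrib, Finset.prod_const, Finset.card_univ, Fintype.card_fin]
  rw [abs_of_pos (Real.rpow_pos_of_pos (mul_pos hn' hD) _), frolovScale_pow hd (mul_pos hn' hD)]
  exact le_mul_of_one_le_right (by positivity) h

/-- Scaling the generator by τ scales dual coordinate products by τ^(-d), which is of order n. -/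
theorem exists_isAdmissible_dual (hd : 1 ≤ d) (hξ : IsFrolovRoots ξ) :
    ∃ c : ℝ, 0 < c ∧ ∀ n : ℕ, 1 ≤ n →
      IsAdmissible (frolovMatrix ξ n)⁻¹.transpose (c * n) := by
  have hD : 0 < |(Matrix.vandermonde ξ).det| := abs_pos.mpr (hξ.det_ne_zero hd)
  obtain ⟨c, hc, h⟩ := hξ.exists_le_prod_dual hd
  refine ⟨c * |(Matrix.vandermonde ξ).det|, by positivity, fun n hn k hk => ?_⟩
  have hn' : (0 : ℝ) < n := by positivity
  set τ := ((n : ℝ) * |(Matrix.vandermonde ξ).det|) ^ (-(1 / (d : ℝ))) with hτ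
  have hτ0 : 0 < τ := by positivity
  have hinv : (frolovMatrix ξ n)⁻¹ = τ⁻¹ • (Matrix.vandermonde ξ)⁻¹ := by
    refine Matrix.inv_eq_right_inv ?_
    rw [frolovMatrix, ← hτ, Matrix.smul_mul, Matrix.mul_smul, smul_smul,
      mul_inv_cancel₀ hτ0.ne', one_smul, Matrix.mul_nonsing_inv _ (hξ.det_ne_zero hd).isUnit]
  simp_rw [latPt_apply, hinv, Matrix.transpose_smul, Matrix.smul_mulVec, Pi.smul_apply,
    smul_eq_mul, abs_mul, Finset.prod_mul_distrib, Finset.prod_const, Finset.card_univ,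
    Fintype.card_fin]
  rw [abs_of_pos (inv_pos.mpr hτ0), inv_pow, hτ, frolovScale_pow hd (by positivity), inv_inv]
  calc c * |(Matrix.vandermonde ξ).det| * n = n * |(Matrix.vandermonde ξ).det| * c := by ring
    _ ≤ _ := mul_le_mul_of_nonneg_left (h k hk) (by positivity)

theorem frolovNodes_eq (ξ : Fin d → ℝ) (n : ℕ) :
    frolovNodes ξ n = latPt (frolovMatrix ξ n) ''
      {k | ∀ i, latPt (frolovMatrix ξ n) k i ∈ Set.Ico (0 : ℝ) 1} := by
  ext x
  constructor
  · rintro ⟨⟨k, hk⟩, hx⟩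
    have hxk : latPt (frolovMatrix ξ n) k = x := by
      ext i
      rw [hk i, latPt_apply]
    exact ⟨k, fun i => by rw [hxk]; exact hx i, hxk⟩
  · rintro ⟨k, hk, rfl⟩
    exact ⟨⟨k, fun i => rfl⟩, hk⟩

theorem exists_ncard_frolovNodes_le (hd : 1 ≤ d) (hξ : IsFrolovRoots ξ) :
    ∃ c : ℝ, 0 < c ∧ ∀ n : ℕ, 1 ≤ n →
      (frolovNodes ξ n).Finite ∧ ((frolovNodes ξ n).ncard : ℝ) ≤ c * n := by
  have hD : 0 < |(Matrix.vandermonde ξ).det| := abs_pos.mpr (hξ.det_ne_zero hd)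
  refine ⟨|(Matrix.vandermonde ξ).det| + 2, by positivity, fun n hn => ?_⟩
  have hn' : (1 : ℝ) ≤ n := by exact_mod_cast hn
  obtain ⟨s, hs, hcard⟩ := (isAdmissible_frolovMatrix hd hξ hn).exists_finset hd (by positivity)
    (fun _ => 0) (fun _ => 1) (fun _ => zero_le_one)
  have hsub : {k | ∀ i, latPt (frolovMatrix ξ n) k i ∈ Set.Ico (0 : ℝ) 1} ⊆
      (s : Set (Fin d → ℤ)) := by
    rw [hs]
    intro k hk i
    rw [zero_add]
    exact Set.Ico_subset_Icc_self (hk i)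
  have hfin := (Finset.finite_toSet s).subset hsub
  rw [frolovNodes_eq]
  refine ⟨hfin.image _, ?_⟩
  have h1 := (Set.ncard_image_le hfin (f := latPt (frolovMatrix ξ n))).trans
    (Set.ncard_le_ncard hsub (Finset.finite_toSet s))
  rw [Set.ncard_coe_finset] at h1
  have h2 : ((latPt (frolovMatrix ξ n) ''
      {k | ∀ i, latPt (frolovMatrix ξ n) k i ∈ Set.Ico (0 : ℝ) 1}).ncard : ℝ) ≤ s.card := by
    exact_mod_cast h1
  refine h2.trans (hcard.trans ?_)
  simp only [Finset.prod_const_one, one_div, inv_inv]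
  nlinarith

end FrolovLattice

noncomputable section

/-! ### Fourier transforms of tensor products and dilations -/

/-- The `d`-dimensional Euclidean space. -/
abbrev Eu (d : ℕ) : Type := EuclideanSpace ℝ (Fin d)

theorem integral_euclidean_prod {d : ℕ} {𝕜 : Type*} [RCLike 𝕜] (u : Fin d → ℝ → 𝕜) :
    ∫ x : Eu d, ∏ i, u i (x i) = ∏ i, ∫ t, u i t := by
  rw [← integral_fintype_prod_volume_eq_prod (f := u)]
  exact ((PiLp.volume_preserving_ofLp (Fin d)).integral_comp
    (MeasurableEquiv.toLp 2 (Fin d → ℝ)).symm.measurableEmbedding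
    (fun y : Fin d → ℝ => ∏ i, u i (y i)))

theorem fourier_euclidean_prod {d : ℕ} (u : Fin d → ℝ → ℂ) (ξ : Eu d) :
    𝓕 (fun x : Eu d => ∏ i, u i (x i)) ξ = ∏ i, 𝓕 (u i) (ξ i) := by
  simp_rw [Real.fourier_eq, Circle.smul_def, smul_eq_mul]
  rw [← integral_euclidean_prod]
  refine integral_congr_ae (Filter.Eventually.of_forall fun x => ?_)
  simp only [Real.fourierChar_apply]
  rw [Finset.prod_mul_distrib, ← Complex.exp_sum, PiLp.inner_apply]
  congr 2
  push_cast
  rw [← Finset.sum_mul, ← Finset.mul_sum, Finset.sum_neg_distrib]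

theorem fourierInv_euclidean_prod {d : ℕ} (u : Fin d → ℝ → ℂ) (ξ : Eu d) :
    𝓕⁻ (fun x : Eu d => ∏ i, u i (x i)) ξ = ∏ i, 𝓕⁻ (u i) (ξ i) := by
  simp_rw [Real.fourierInv_eq_fourier_neg]
  exact fourier_euclidean_prod u (-ξ)

theorem fourier_dilation (u : ℝ → ℂ) {a : ℝ} (ha : 0 < a) (t : ℝ) :
    𝓕 (fun x => (a : ℂ) * u (a * x)) t = 𝓕 u (t / a) := by
  simp_rw [Real.fourier_eq, Circle.smul_def, smul_eq_mul, Real.fourierChar_apply]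
  have h := Measure.integral_comp_mul_left
    (fun x : ℝ => Complex.exp (↑(2 * Real.pi * -inner ℝ x (t / a)) * Complex.I) * u x) a
  rw [abs_of_pos (inv_pos.mpr ha)] at h
  have h2 : ∫ v, Complex.exp (↑(2 * Real.pi * -inner ℝ v t) * Complex.I) * (↑a * u (a * v)) =
      (a : ℂ) * ∫ x : ℝ, Complex.exp (↑(2 * Real.pi * -inner ℝ (a * x) (t / a)) * Complex.I) *
        u (a * x) := by
    rw [← integral_const_mul]
    refine integral_congr_ae (Filter.Eventually.of_forall fun x => ?_)
    have : inner ℝ (a * x) (t / a) = inner ℝ x t := by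
      simp only [RCLike.inner_apply, conj_trivial]
      field_simp
    simp only [this]
    ring
  rw [h2, h, Complex.real_smul, ← mul_assoc, ← Complex.ofReal_mul, mul_inv_cancel₀ ha.ne',
    Complex.ofReal_one, one_mul]

theorem fourierInv_dilation (u : ℝ → ℂ) {a : ℝ} (ha : 0 < a) (t : ℝ) :
    𝓕⁻ (fun x => u (x / a)) t = (a : ℂ) * 𝓕⁻ u (a * t) := by
  simp_rw [Real.fourierInv_eq, Circle.smul_def, smul_eq_mul, Real.fourierChar_apply]
  have h := Measure.integral_comp_div
    (fun x : ℝ => Complex.exp (↑(2 * Real.pi * inner ℝ x (a * t)) * Complex.I) * u x) a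
  rw [abs_of_pos ha, Complex.real_smul] at h
  rw [← h]
  refine integral_congr_ae (Filter.Eventually.of_forall fun x => ?_)
  have : inner ℝ (x / a) (a * t) = inner ℝ x t := by
    simp only [RCLike.inner_apply, conj_trivial]
    field_simp
  simp only [this]

/-! ### A band-limited resolution of the identity -/

/-- A smooth compactly supported `χ` equal to `1` near `0`, together with smooth compactly supported
solutions of `sym₀ 𝓕ψ₀ = χ` and `sym₁ 𝓕ψ₁ = χ(·/2) - χ`. -/
structure BandResolution {L : ℕ} (Ψ : LocalMeansKernel L) where
  χ : ℝ → ℂ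
  sym₀ : ℝ → ℂ
  sym₁ : ℝ → ℂ
  contDiff_χ : ContDiff ℝ ∞ χ
  contDiff₀ : ContDiff ℝ ∞ sym₀
  contDiff₁ : ContDiff ℝ ∞ sym₁
  hasCompactSupport_χ : HasCompactSupport χ
  hasCompactSupport₀ : HasCompactSupport sym₀
  hasCompactSupport₁ : HasCompactSupport sym₁
  χ_eq_one : ∃ ρ : ℝ, 0 < ρ ∧ ∀ t : ℝ, |t| ≤ ρ → χ t = 1
  sym₀_mul : ∀ t, sym₀ t * 𝓕 Ψ.ψ₀ t = χ t
  sym₁_mul : ∀ t, sym₁ t * 𝓕 Ψ.ψ₁ t = χ (t / 2) - χ t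

theorem contDiff_fourier_of_hasCompactSupport {u : ℝ → ℂ} (hu : ContDiff ℝ ∞ u)
    (hc : HasCompactSupport u) : ContDiff ℝ ∞ (𝓕 u) := by
  have h : 𝓕 u = 𝓕 (hc.toSchwartzMap hu) := by
    rw [SchwartzMap.fourier_coe]
    rfl
  rw [h]
  exact SchwartzMap.smooth' _

theorem contDiff_div_of_tsupport {u v : ℝ → ℂ} (hu : ContDiff ℝ ∞ u) (hv : ContDiff ℝ ∞ v)
    (h : ∀ t ∈ tsupport u, v t ≠ 0) : ContDiff ℝ ∞ fun t => u t / v t := by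
  rw [contDiff_iff_contDiffAt]
  intro t
  by_cases ht : t ∈ tsupport u
  · simp_rw [div_eq_mul_inv]
    exact hu.contDiffAt.mul (hv.contDiffAt.inv (h t ht))
  · have h0 : (fun t => u t / v t) =ᶠ[nhds t] fun _ => 0 := by
      filter_upwards [notMem_tsupport_iff_eventuallyEq.mp ht] with s hs
      rw [hs, Pi.zero_apply, zero_div]
    exact contDiffAt_const.congr_of_eventuallyEq h0

theorem nonempty_bandResolution {L : ℕ} (Ψ : LocalMeansKernel L) : Nonempty (BandResolution Ψ) := by
  obtain ⟨ε, hε, h0, h1⟩ := Ψ.tauberian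
  -- With these radii χ lives on |t| ≤ 4ε/5 and χ(·/2) - χ on 3ε/5 ≤ |t| ≤ 8ε/5. These sets lie
  -- strictly inside the regions where 𝓕ψ₀ and 𝓕ψ₁ do not vanish, so both quotients are smooth.
  let b : ContDiffBump (0 : ℝ) := ⟨3 / 5 * ε, 4 / 5 * ε, by positivity, by linarith⟩
  let χ : ℝ → ℂ := fun t => ((b t : ℝ) : ℂ)
  have hχ : ContDiff ℝ ∞ χ := Complex.ofRealCLM.contDiff.comp b.contDiff
  have hχone : ∀ t : ℝ, |t| ≤ 3 / 5 * ε → χ t = 1 := fun t ht => by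
    have : b t = 1 := b.one_of_mem_closedBall (by simpa using ht)
    simp [χ, this]
  have hχzero : ∀ t : ℝ, 4 / 5 * ε ≤ |t| → χ t = 0 := fun t ht => by
    have : b t = 0 := b.zero_of_le_dist (by simpa using ht)
    simp [χ, this]
  have hts : tsupport χ ⊆ {t | |t| ≤ 4 / 5 * ε} := by
    refine closure_minimal (fun t ht => ?_) (isClosed_le continuous_abs continuous_const)
    by_contra h
    exact ht (hχzero t (not_le.mp h).le)
  have hχc : HasCompactSupport χ := by
    refine HasCompactSupport.intro (isCompact_Icc (a := -(4 / 5 * ε)) (b := 4 / 5 * ε))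
      fun t ht => hχzero t ?_
    by_contra h
    exact ht (abs_le.mp (not_le.mp h).le)
  let η : ℝ → ℂ := fun t => χ (t / 2) - χ t
  have hη : ContDiff ℝ ∞ η := (hχ.comp (contDiff_id.div_const 2)).sub hχ
  have hηzero : ∀ t : ℝ, |t| < 3 / 5 * ε ∨ 8 / 5 * ε < |t| → η t = 0 := by
    rintro t (ht | ht)
    · have : |t / 2| ≤ 3 / 5 * ε := by
        rw [abs_div, abs_two]
        linarith [abs_nonneg t]
      simp only [η]
      rw [hχone _ this, hχone t ht.le, sub_self]
    · have : 4 / 5 * ε ≤ |t / 2| := by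
        rw [abs_div, abs_two]
        linarith [abs_nonneg t]
      simp only [η]
      rw [hχzero _ this, hχzero t (by linarith), sub_self]
  have hηs : tsupport η ⊆ {t | 3 / 5 * ε ≤ |t| ∧ |t| ≤ 8 / 5 * ε} := by
    refine closure_minimal (fun t ht => ?_) ((isClosed_le continuous_const continuous_abs).inter
      (isClosed_le continuous_abs continuous_const))
    by_contra h
    refine ht (hηzero t ?_)
    simp only [Set.mem_ofPred_eq, not_and_or, not_le] at h
    exact h
  have hηc : HasCompactSupport η := by
    refine HasCompactSupport.intro (isCompact_Icc (a := -(8 / 5 * ε)) (b := 8 / 5 * ε))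
      fun t ht => hηzero t (Or.inr ?_)
    by_contra h
    exact ht (abs_le.mp (not_lt.mp h))
  have hn0 : ∀ t ∈ tsupport χ, 𝓕 Ψ.ψ₀ t ≠ 0 := fun t ht => h0 t (by
    have := hts ht
    simp only [Set.mem_ofPred_eq] at this
    linarith)
  have hn1 : ∀ t ∈ tsupport η, 𝓕 Ψ.ψ₁ t ≠ 0 := fun t ht => by
    have := hηs ht
    simp only [Set.mem_ofPred_eq] at this
    exact h1 t (by linarith [this.1]) (by linarith [this.2])
  have hmul : ∀ (u v : ℝ → ℂ), (∀ t ∈ tsupport u, v t ≠ 0) → ∀ t, u t / v t * v t = u t := by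
    intro u v h t
    by_cases ht : t ∈ tsupport u
    · exact div_mul_cancel₀ _ (h t ht)
    · rw [image_eq_zero_of_notMem_tsupport ht, zero_div, zero_mul]
  refine ⟨⟨χ, fun t => χ t / 𝓕 Ψ.ψ₀ t, fun t => η t / 𝓕 Ψ.ψ₁ t, hχ, ?_, ?_, hχc, ?_, ?_,
    ⟨3 / 5 * ε, by positivity, hχone⟩, hmul _ _ hn0, hmul _ _ hn1⟩⟩
  · exact contDiff_div_of_tsupport hχ
      (contDiff_fourier_of_hasCompactSupport Ψ.contDiff₀ Ψ.hasCompactSupport₀) hn0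
  · exact contDiff_div_of_tsupport hη
      (contDiff_fourier_of_hasCompactSupport Ψ.contDiff₁ Ψ.hasCompactSupport₁) hn1
  · simp_rw [div_eq_mul_inv]
    exact hχc.mul_right
  · simp_rw [div_eq_mul_inv]
    exact hηc.mul_right

theorem hasCompactSupport_comp_div {u : ℝ → ℂ} (hu : HasCompactSupport u) {a : ℝ} (ha : a ≠ 0) :
    HasCompactSupport fun t => u (t / a) := by
  simp_rw [div_eq_mul_inv]
  exact hu.comp_homeomorph (Homeomorph.mulRight₀ a⁻¹ (inv_ne_zero ha))

theorem contDiff_tensor {d : ℕ} {u : Fin d → ℝ → ℂ} (hu : ∀ i, ContDiff ℝ ∞ (u i)) :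
    ContDiff ℝ ∞ fun x : Eu d => ∏ i, u i (x i) := by
  refine contDiff_prod fun i _ => (hu i).comp ?_
  fun_prop

theorem hasCompactSupport_tensor {d : ℕ} {u : Fin d → ℝ → ℂ}
    (hu : ∀ i, HasCompactSupport (u i)) :
    HasCompactSupport fun x : Eu d => ∏ i, u i (x i) := by
  have hK : IsCompact (Set.univ.pi fun i => tsupport (u i)) := isCompact_univ_pi hu
  have hK' := (PiLp.homeomorph 2 (fun _ : Fin d => ℝ)).isCompact_preimage.mpr hK
  refine HasCompactSupport.of_support_subset_isCompact hK' ?_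
  intro x hx i _
  refine subset_tsupport _ ?_
  rw [Function.mem_support] at hx ⊢
  exact fun h => hx (Finset.prod_eq_zero (Finset.mem_univ i) h)

namespace BandResolution

variable {L : ℕ} {Ψ : LocalMeansKernel L} (R : BandResolution Ψ) {d : ℕ}

/-- The one-dimensional symbols `sym₀` and `sym₁(·/2^j)`. -/
def symb : ℕ → ℝ → ℂ
  | 0 => R.sym₀
  | j + 1 => fun t => R.sym₁ (t / 2 ^ j)

theorem contDiff_symb (j : ℕ) : ContDiff ℝ ∞ (R.symb j) := by
  cases j with
  | zero => exact R.contDiff₀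
  | succ j => exact R.contDiff₁.comp (contDiff_id.div_const _)

theorem hasCompactSupport_symb (j : ℕ) : HasCompactSupport (R.symb j) := by
  cases j with
  | zero => exact R.hasCompactSupport₀
  | succ j =>
    exact hasCompactSupport_comp_div R.hasCompactSupport₁ (by positivity)

theorem fourier_level_succ (Ψ : LocalMeansKernel L) (j : ℕ) (t : ℝ) :
    𝓕 (Ψ.level (j + 1)) t = 𝓕 Ψ.ψ₁ (t / 2 ^ j) := by
  have h := fourier_dilation Ψ.ψ₁ (a := 2 ^ j) (by positivity) t
  push_cast at h
  exact h

/-- The sum telescopes: level j + 1 contributes χ(t/2^(j+1)) - χ(t/2^j). -/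
theorem sum_symb_mul (N : ℕ) (t : ℝ) :
    ∑ j ∈ Finset.range (N + 1), R.symb j t * 𝓕 (Ψ.level j) t = R.χ (t / 2 ^ N) := by
  induction N with
  | zero =>
    rw [Finset.sum_range_one, pow_zero, div_one]
    exact R.sym₀_mul t
  | succ N ih =>
    rw [Finset.sum_range_succ, ih, fourier_level_succ]
    have h : R.symb (N + 1) t * 𝓕 Ψ.ψ₁ (t / 2 ^ N) = _ := R.sym₁_mul (t / 2 ^ N)
    rw [h, div_div, ← pow_succ]
    ring

/-- The symbol `∏ i, symb (m i) (ξ i)` as a Schwartz function. -/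
def symbol (m : Fin d → ℕ) : 𝓢(Eu d, ℂ) :=
  (hasCompactSupport_tensor fun i => R.hasCompactSupport_symb (m i)).toSchwartzMap
    (contDiff_tensor fun i => R.contDiff_symb (m i))

theorem symbol_apply (m : Fin d → ℕ) (ξ : Eu d) : R.symbol m ξ = ∏ i, R.symb (m i) (ξ i) := rfl

/-- The cut-off `∏ i, χ(ξ i / 2^N)` as a Schwartz function. -/
def cutoff (d N : ℕ) : 𝓢(Eu d, ℂ) :=
  (hasCompactSupport_tensor (d := d) (u := fun _ t => R.χ (t / 2 ^ N)) fun _ =>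
    hasCompactSupport_comp_div R.hasCompactSupport_χ (by positivity)).toSchwartzMap
    (contDiff_tensor fun _ => R.contDiff_χ.comp (contDiff_id.div_const _))

theorem cutoff_apply (N : ℕ) (ξ : Eu d) : R.cutoff d N ξ = ∏ i, R.χ (ξ i / 2 ^ N) := rfl

theorem fourier_tensor (Ψ : LocalMeansKernel L) (m : Fin d → ℕ) (ξ : Eu d) :
    𝓕 (Ψ.tensor m) ξ = ∏ i, 𝓕 (Ψ.level (m i)) (ξ i) :=
  fourier_euclidean_prod _ ξ

theorem sum_symbol_mul (N : ℕ) (ξ : Eu d) :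
    ∑ m ∈ Fintype.piFinset fun _ : Fin d => Finset.range (N + 1),
      R.symbol m ξ * 𝓕 (Ψ.tensor m) ξ = R.cutoff d N ξ := by
  simp_rw [symbol_apply, fourier_tensor, cutoff_apply, ← Finset.prod_mul_distrib]
  rw [← Finset.prod_univ_sum (fun _ : Fin d => Finset.range (N + 1))
    (fun i j => R.symb j (ξ i) * 𝓕 (Ψ.level j) (ξ i))]
  exact Finset.prod_congr rfl fun i _ => R.sum_symb_mul N (ξ i)

/-- The kernel `𝓕⁻ (symbol m)`. -/
def kernel (m : Fin d → ℕ) : 𝓢(Eu d, ℂ) := 𝓕⁻ (R.symbol m)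

theorem fourier_kernel (m : Fin d → ℕ) : 𝓕 (R.kernel m) = R.symbol m := by
  rw [kernel, FourierTransform.fourier_fourierInv_eq]

theorem kernel_apply (m : Fin d → ℕ) (x : Eu d) :
    R.kernel m x = ∏ i, 𝓕⁻ (R.symb (m i)) (x i) := by
  rw [kernel, SchwartzMap.fourierInv_coe]
  exact fourierInv_euclidean_prod _ x

theorem fourierInv_symb_succ (j : ℕ) (t : ℝ) :
    𝓕⁻ (R.symb (j + 1)) t = (2 : ℂ) ^ j * 𝓕⁻ R.sym₁ (2 ^ j * t) := by
  have h := fourierInv_dilation R.sym₁ (a := 2 ^ j) (by positivity) t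
  push_cast at h
  exact h

theorem exists_symb_bound : ∃ C : ℝ, 1 ≤ C ∧ ∀ j t, ‖R.symb j t‖ ≤ C := by
  obtain ⟨C₀, h₀⟩ := R.hasCompactSupport₀.exists_bound_of_continuous R.contDiff₀.continuous
  obtain ⟨C₁, h₁⟩ := R.hasCompactSupport₁.exists_bound_of_continuous R.contDiff₁.continuous
  refine ⟨max 1 (max C₀ C₁), le_max_left _ _, fun j t => ?_⟩
  cases j with
  | zero => exact (h₀ t).trans ((le_max_left _ _).trans (le_max_right _ _))
  | succ j => exact (h₁ _).trans ((le_max_right _ _).trans (le_max_right _ _))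

theorem exists_abs_le_of_compactSupport {u : ℝ → ℂ} (hu : HasCompactSupport u) :
    ∃ ρ : ℝ, 1 ≤ ρ ∧ ∀ t, u t ≠ 0 → |t| ≤ ρ := by
  obtain ⟨ρ, hρ⟩ := hu.isCompact.isBounded.exists_norm_le
  exact ⟨max 1 ρ, le_max_left _ _, fun t ht =>
    (hρ t (subset_tsupport _ ht)).trans (le_max_right _ _)⟩

theorem exists_symb_support : ∃ ρ : ℝ, 1 ≤ ρ ∧ ∀ j t, R.symb j t ≠ 0 → |t| ≤ ρ * 2 ^ j := by
  obtain ⟨ρ₀, h₀1, h₀⟩ := exists_abs_le_of_compactSupport R.hasCompactSupport₀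
  obtain ⟨ρ₁, h₁1, h₁⟩ := exists_abs_le_of_compactSupport R.hasCompactSupport₁
  refine ⟨max ρ₀ ρ₁, h₀1.trans (le_max_left _ _), fun j t ht => ?_⟩
  cases j with
  | zero => simpa using (h₀ t ht).trans (le_max_left _ _)
  | succ j =>
    have h := h₁ _ ht
    rw [abs_div, abs_of_pos (by positivity : (0 : ℝ) < 2 ^ j), div_le_iff₀ (by positivity)] at h
    refine h.trans (mul_le_mul (le_max_right _ _) ?_ (by positivity) (by positivity))
    exact pow_le_pow_right₀ (by norm_num) (by omega)

theorem exists_symbol_bound (d : ℕ) : ∃ C : ℝ, 1 ≤ C ∧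
    ∀ (m : Fin d → ℕ) (ξ : Eu d), ‖R.symbol m ξ‖ ≤ C := by
  obtain ⟨C, hC, h⟩ := R.exists_symb_bound
  refine ⟨C ^ d, one_le_pow₀ hC, fun m ξ => ?_⟩
  rw [symbol_apply, norm_prod]
  refine (Finset.prod_le_prod (fun _ _ => norm_nonneg _) fun i _ => h (m i) (ξ i)).trans ?_
  simp

theorem exists_symbol_support : ∃ ρ : ℝ, 1 ≤ ρ ∧
    ∀ (m : Fin d → ℕ) (ξ : Eu d), R.symbol m ξ ≠ 0 → ∀ i, |ξ i| ≤ ρ * 2 ^ m i := by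
  obtain ⟨ρ, hρ, h⟩ := R.exists_symb_support
  refine ⟨ρ, hρ, fun m ξ hm i => h (m i) (ξ i) fun h0 => hm ?_⟩
  rw [symbol_apply, Finset.prod_eq_zero (Finset.mem_univ i) h0]

theorem exists_schwartz_bounds (u : 𝓢(ℝ, ℂ)) : ∃ C : ℝ, 1 ≤ C ∧ (∀ t, ‖u t‖ ≤ C) ∧
    ∫ t, ‖u t‖ ≤ C := by
  refine ⟨max 1 (max (SchwartzMap.seminorm ℝ 0 0 u) (∫ t, ‖u t‖)), le_max_left _ _, fun t => ?_, ?_⟩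
  · exact (u.norm_le_seminorm ℝ t).trans ((le_max_left _ _).trans (le_max_right _ _))
  · exact (le_max_right _ _).trans (le_max_right _ _)

theorem exists_fourierInv_bounds {u : ℝ → ℂ} (hu : ContDiff ℝ ∞ u) (hc : HasCompactSupport u) :
    ∃ C : ℝ, 1 ≤ C ∧ (∀ t, ‖𝓕⁻ u t‖ ≤ C) ∧ ∫ t, ‖𝓕⁻ u t‖ ≤ C := by
  have h := exists_schwartz_bounds (𝓕⁻ (hc.toSchwartzMap hu))
  rwa [SchwartzMap.fourierInv_coe] at h

theorem exists_fourierInv_symb_bounds : ∃ C : ℝ, 1 ≤ C ∧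
    (∀ j t, ‖𝓕⁻ (R.symb j) t‖ ≤ C * 2 ^ j) ∧ ∀ j, ∫ t, ‖𝓕⁻ (R.symb j) t‖ ≤ C := by
  obtain ⟨C₀, h₀1, h₀, h₀'⟩ := exists_fourierInv_bounds R.contDiff₀ R.hasCompactSupport₀
  obtain ⟨C₁, h₁1, h₁, h₁'⟩ := exists_fourierInv_bounds R.contDiff₁ R.hasCompactSupport₁
  refine ⟨max C₀ C₁, h₀1.trans (le_max_left _ _), fun j t => ?_, fun j => ?_⟩
  · cases j with
    | zero =>
      rw [pow_zero, mul_one]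
      exact (h₀ t).trans (le_max_left _ _)
    | succ j =>
      rw [fourierInv_symb_succ, norm_mul, norm_pow, Complex.norm_two, mul_comm]
      refine mul_le_mul ((h₁ _).trans (le_max_right _ _)) ?_ (by positivity) (by positivity)
      exact pow_le_pow_right₀ (by norm_num) (by omega)
  · cases j with
    | zero => exact h₀'.trans (le_max_left _ _)
    | succ j =>
      simp_rw [fourierInv_symb_succ, norm_mul, norm_pow, Complex.norm_two]
      have h := Measure.integral_comp_mul_left (fun x : ℝ => ‖𝓕⁻ R.sym₁ x‖) (2 ^ j)
      rw [integral_const_mul, h, abs_of_pos (by positivity), smul_eq_mul, ← mul_assoc,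
        mul_inv_cancel₀ (by positivity), one_mul]
      exact h₁'.trans (le_max_right _ _)

theorem exists_kernel_bounds (d : ℕ) : ∃ C : ℝ, 1 ≤ C ∧
    (∀ (m : Fin d → ℕ) (x : Eu d), ‖R.kernel m x‖ ≤ C * 2 ^ (∑ i, m i)) ∧
    ∀ m : Fin d → ℕ, ∫ x, ‖R.kernel m x‖ ≤ C := by
  obtain ⟨C, hC, h1, h2⟩ := R.exists_fourierInv_symb_bounds
  refine ⟨C ^ d, one_le_pow₀ hC, fun m x => ?_, fun m => ?_⟩
  · rw [kernel_apply, norm_prod]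
    refine (Finset.prod_le_prod (fun _ _ => norm_nonneg _) fun i _ => h1 (m i) (x i)).trans ?_
    rw [Finset.prod_mul_distrib, Finset.prod_pow_eq_pow_sum]
    simp
  · simp_rw [kernel_apply, norm_prod]
    rw [integral_euclidean_prod (fun i t => ‖𝓕⁻ (R.symb (m i)) t‖)]
    refine (Finset.prod_le_prod (fun _ _ => integral_nonneg fun _ => norm_nonneg _)
      fun i _ => h2 (m i)).trans ?_
    simp

end BandResolution

/-! ### Tempered distributions and integrals of Schwartz functions -/

namespace SchwartzMap

variable {E : Type*} [NormedAddCommGroup E] [NormedSpace ℝ E]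

/-- Bounded continuous functions with values in a normed group. -/
abbrev NormedBCF (E V : Type*) [TopologicalSpace E] [NormedAddCommGroup V] : Type _ :=
  BoundedContinuousFunction E V

theorem continuous_pow_smul_iteratedFDeriv (k n : ℕ) (φ : 𝓢(E, ℂ)) :
    Continuous fun y => ((‖y‖ ^ k : ℝ) : ℂ) • iteratedFDeriv ℝ n φ y :=
  (Complex.continuous_ofReal.comp (continuous_norm.pow k)).smul
    ((φ.smooth n).continuous_iteratedFDeriv le_rfl)

theorem norm_pow_smul_iteratedFDeriv_le (k n : ℕ) (φ : 𝓢(E, ℂ)) (y : E) :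
    ‖((‖y‖ ^ k : ℝ) : ℂ) • iteratedFDeriv ℝ n φ y‖ ≤ SchwartzMap.seminorm ℂ k n φ := by
  rw [norm_smul, Complex.norm_real, Real.norm_eq_abs, abs_of_nonneg (by positivity)]
  exact φ.le_seminorm ℂ k n y

/-- `y ↦ ‖y‖^k D^n φ(y)` as a bounded continuous function. -/
def weightedDeriv (k n : ℕ) (φ : 𝓢(E, ℂ)) :
    NormedBCF E (ContinuousMultilinearMap ℝ (fun _ : Fin n => E) ℂ) :=
  BoundedContinuousFunction.ofNormedAddCommGroup _ (continuous_pow_smul_iteratedFDeriv k n φ) _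
    (norm_pow_smul_iteratedFDeriv_le k n φ)

theorem weightedDeriv_apply (k n : ℕ) (φ : 𝓢(E, ℂ)) (y : E) :
    weightedDeriv k n φ y = ((‖y‖ ^ k : ℝ) : ℂ) • iteratedFDeriv ℝ n φ y := rfl

theorem norm_weightedDeriv_le (k n : ℕ) (φ : 𝓢(E, ℂ)) :
    ‖weightedDeriv k n φ‖ ≤ SchwartzMap.seminorm ℂ k n φ :=
  BoundedContinuousFunction.norm_ofNormedAddCommGroup_le _ (apply_nonneg _ _) _

theorem seminorm_le_norm_weightedDeriv (k n : ℕ) (φ : 𝓢(E, ℂ)) :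
    SchwartzMap.seminorm ℂ k n φ ≤ ‖weightedDeriv k n φ‖ := by
  refine φ.seminorm_le_bound ℂ k n (norm_nonneg _) fun y => ?_
  have h := (weightedDeriv k n φ).norm_coe_le_norm y
  rwa [weightedDeriv_apply, norm_smul, Complex.norm_real, Real.norm_eq_abs,
    abs_of_nonneg (by positivity)] at h

/-- `weightedDeriv` as a continuous linear map. -/
def weightedDerivCLM (k n : ℕ) : 𝓢(E, ℂ) →L[ℂ]
    NormedBCF E (ContinuousMultilinearMap ℝ (fun _ : Fin n => E) ℂ) :=
  mkCLMtoNormedSpace (weightedDeriv k n)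
    (fun φ ψ => by
      refine BoundedContinuousFunction.ext fun y => ?_
      rw [BoundedContinuousFunction.add_apply]
      simp only [weightedDeriv_apply]
      rw [FunLike.coe_add,
        iteratedFDeriv_add_apply ((φ.smooth n).contDiffAt) ((ψ.smooth n).contDiffAt)]
      exact smul_add _ _ _)
    (fun a φ => by
      refine BoundedContinuousFunction.ext fun y => ?_
      rw [BoundedContinuousFunction.smul_apply]
      simp only [weightedDeriv_apply, RingHom.id_apply]
      rw [FunLike.coe_smul, iteratedFDeriv_const_smul_apply ((φ.smooth n).contDiffAt), smul_comm])
    ⟨{(k, n)}, 1, zero_le_one, fun φ => by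
      rw [Finset.sup_singleton, one_mul]
      exact norm_weightedDeriv_le k n φ⟩

theorem weightedDerivCLM_apply (k n : ℕ) (φ : 𝓢(E, ℂ)) :
    weightedDerivCLM k n φ = weightedDeriv k n φ := rfl

/-- A tempered distribution factors through finitely many of the maps `weightedDerivCLM`. -/
theorem exists_factor_weightedDeriv (f : 𝓢'(E, ℂ)) : ∃ (s : Finset (ℕ × ℕ))
    (ℓ : (∀ a : s, NormedBCF E
      (ContinuousMultilinearMap ℝ (fun _ : Fin (a : ℕ × ℕ).2 => E) ℂ)) →L[ℂ] ℂ),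
    ∀ φ, f φ = ℓ fun a => weightedDerivCLM (a : ℕ × ℕ).1 (a : ℕ × ℕ).2 φ := by
  have hcont : Continuous ((normSeminorm ℂ ℂ).comp (ContinuousLinearMap.toLinearMap f)) :=
    continuous_norm.comp (map_continuous f)
  -- Continuity is a bound by finitely many seminorms, and these are sup norms of weighted
  -- derivatives. So f descends to a bounded functional on the range of `J` in a Banach space, and
  -- Hahn-Banach extends it. Integrals of Schwartz-valued functions can then be treated as
  -- Banach-valued ones.
  obtain ⟨s, C, -, hC⟩ := Seminorm.bound_of_continuous (schwartz_withSeminorms ℂ E ℂ) _ hcont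
  refine ⟨s, ?_⟩
  let J : 𝓢(E, ℂ) →ₗ[ℂ] (∀ a : s, NormedBCF E
      (ContinuousMultilinearMap ℝ (fun _ : Fin (a : ℕ × ℕ).2 => E) ℂ)) :=
    LinearMap.pi fun a => (weightedDerivCLM (a : ℕ × ℕ).1 (a : ℕ × ℕ).2).toLinearMap
  have hbound : ∀ φ, ‖f φ‖ ≤ C * ‖J φ‖ := fun φ => by
    have h1 : ‖f φ‖ ≤ C * (s.sup (schwartzSeminormFamily ℂ E ℂ)) φ := hC φ
    refine h1.trans (mul_le_mul_of_nonneg_left ?_ C.2)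
    refine Seminorm.finset_sup_apply_le (norm_nonneg _) fun a ha => ?_
    exact (seminorm_le_norm_weightedDeriv a.1 a.2 φ).trans (norm_le_pi_norm (J φ) ⟨a, ha⟩)
  have hker : LinearMap.ker J ≤ LinearMap.ker (ContinuousLinearMap.toLinearMap f) := by
    intro φ hφ
    rw [LinearMap.mem_ker] at hφ ⊢
    have h := hbound φ
    rw [hφ, norm_zero, mul_zero] at h
    exact norm_le_zero_iff.mp h
  let g : LinearMap.range J →ₗ[ℂ] ℂ :=
    ((LinearMap.ker J).liftQ (ContinuousLinearMap.toLinearMap f) hker).comp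
      J.quotKerEquivRange.symm.toLinearMap
  have hg : ∀ φ, g ⟨J φ, LinearMap.mem_range_self J φ⟩ = f φ := fun φ => by
    have h : J.quotKerEquivRange.symm ⟨J φ, LinearMap.mem_range_self J φ⟩ =
        Submodule.Quotient.mk φ := by
      rw [LinearEquiv.symm_apply_eq]
      rfl
    simp only [g, LinearMap.comp_apply, LinearEquiv.coe_coe]
    rw [h]
    rfl
  have hgb : ∀ x, ‖g x‖ ≤ C * ‖x‖ := by
    rintro ⟨_, φ, rfl⟩
    rw [hg]
    exact hbound φ
  obtain ⟨ℓ, hℓ, -⟩ := exists_extension_norm_eq (LinearMap.range J) (g.mkContinuous C hgb)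
  refine ⟨ℓ, fun φ => ?_⟩
  have h := hℓ ⟨J φ, LinearMap.mem_range_self J φ⟩
  rw [LinearMap.mkContinuous_apply, hg] at h
  exact h.symm

section Integral

variable {X : Type*} [TopologicalSpace X] [SecondCountableTopology X] [MeasurableSpace X]
  [OpensMeasurableSpace X] {μ : Measure X}

theorem integrable_weightedDeriv {F : X → 𝓢(E, ℂ)} (hF : Continuous F)
    (hint : ∀ k n, ∃ b : X → ℝ, Integrable b μ ∧ ∀ x, SchwartzMap.seminorm ℂ k n (F x) ≤ b x)
    (k n : ℕ) : Integrable (fun x => weightedDerivCLM k n (F x)) μ := by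
  obtain ⟨b, hb, hle⟩ := hint k n
  refine hb.mono' ((weightedDerivCLM k n).continuous.comp hF).aestronglyMeasurable
    (Filter.Eventually.of_forall fun x => ?_)
  exact (norm_weightedDeriv_le k n (F x)).trans (hle x)

theorem integrable_iteratedFDeriv {F : X → 𝓢(E, ℂ)} (hF : Continuous F)
    (hint : ∀ k n, ∃ b : X → ℝ, Integrable b μ ∧ ∀ x, SchwartzMap.seminorm ℂ k n (F x) ≤ b x)
    (n : ℕ) (y : E) : Integrable (fun x => iteratedFDeriv ℝ n (F x) y) μ := by
  have h := (BoundedContinuousFunction.evalCLM ℂ y).integrable_comp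
    (integrable_weightedDeriv hF hint 0 n)
  simpa [weightedDerivCLM_apply, weightedDeriv_apply] using h

/-- Induction by differentiation under the integral sign; the integrable bound for the seminorm (0,
n + 1) dominates the next derivative uniformly in y. -/
theorem iteratedFDeriv_integral {F : X → 𝓢(E, ℂ)} (hF : Continuous F)
    (hint : ∀ k n, ∃ b : X → ℝ, Integrable b μ ∧ ∀ x, SchwartzMap.seminorm ℂ k n (F x) ≤ b x)
    {G : E → ℂ} (hG : ∀ y, G y = ∫ x, F x y ∂μ) (n : ℕ) :
    iteratedFDeriv ℝ n G = fun y => ∫ x, iteratedFDeriv ℝ n (F x) y ∂μ := by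
  induction n with
  | zero =>
    ext1 y
    simp_rw [iteratedFDeriv_zero_eq_comp, Function.comp_apply]
    rw [hG]
    exact ((continuousMultilinearCurryFin0 ℝ E ℂ).symm.toContinuousLinearEquiv.integral_comp_comm
      fun x => F x y).symm
  | succ n ih =>
    obtain ⟨b, hb, hle⟩ := hint 0 (n + 1)
    ext1 y
    have hder : HasFDerivAt (fun y => ∫ x, iteratedFDeriv ℝ n (F x) y ∂μ)
        (∫ x, fderiv ℝ (iteratedFDeriv ℝ n (F x)) y ∂μ) y := by
      refine hasFDerivAt_integral_of_dominated_of_fderiv_le (bound := b) (s := Set.univ)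
        (F := fun z x => iteratedFDeriv ℝ n (F x) z)
        (F' := fun z x => fderiv ℝ (iteratedFDeriv ℝ n (F x)) z)
        Filter.univ_mem ?_ (integrable_iteratedFDeriv hF hint n y) ?_ ?_ hb ?_
      · exact Filter.Eventually.of_forall fun z =>
          (integrable_iteratedFDeriv hF hint n z).aestronglyMeasurable
      · simp_rw [fderiv_iteratedFDeriv, Function.comp_apply]
        exact (LinearIsometryEquiv.continuous _).comp_aestronglyMeasurable
          (integrable_iteratedFDeriv hF hint (n + 1) y).aestronglyMeasurable
      · refine Filter.Eventually.of_forall fun x z _ => ?_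
        rw [norm_fderiv_iteratedFDeriv]
        exact ((F x).norm_iteratedFDeriv_le_seminorm ℂ (n + 1) z).trans (hle x)
      · refine Filter.Eventually.of_forall fun x z _ => ?_
        refine DifferentiableAt.hasFDerivAt ?_
        exact ((F x).smooth ⊤).contDiffAt.differentiableAt_iteratedFDeriv
          (by exact_mod_cast WithTop.coe_lt_coe.mpr (ENat.natCast_lt_top n))
    rw [iteratedFDeriv_succ_eq_comp_left, Function.comp_apply, ih, hder.fderiv]
    simp_rw [iteratedFDeriv_succ_eq_comp_left, Function.comp_apply]
    exact (LinearIsometry.integral_comp_comm (𝕜 := ℝ)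
      (E := E →L[ℝ] ContinuousMultilinearMap ℝ (fun _ : Fin n => E) ℂ)
      (F := ContinuousMultilinearMap ℝ (fun _ : Fin (n + 1) => E) ℂ)
      (continuousMultilinearCurryLeftEquiv ℝ (fun _ : Fin (n + 1) => E) ℂ).symm.toLinearIsometry
      fun x => fderiv ℝ (iteratedFDeriv ℝ n (F x)) y).symm

/-- A tempered distribution commutes with absolutely convergent integrals of Schwartz functions. -/
theorem temperedDistribution_integral (f : 𝓢'(E, ℂ)) {F : X → 𝓢(E, ℂ)} (hF : Continuous F)
    (hint : ∀ k n, ∃ b : X → ℝ, Integrable b μ ∧ ∀ x, SchwartzMap.seminorm ℂ k n (F x) ≤ b x)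
    {G : 𝓢(E, ℂ)} (hG : ∀ y, G y = ∫ x, F x y ∂μ) : f G = ∫ x, f (F x) ∂μ := by
  obtain ⟨s, ℓ, hℓ⟩ := exists_factor_weightedDeriv f
  simp_rw [hℓ]
  have hpi : Integrable (fun x => fun a : s =>
      weightedDerivCLM (a : ℕ × ℕ).1 (a : ℕ × ℕ).2 (F x)) μ :=
    Integrable.of_eval fun a => integrable_weightedDeriv hF hint _ _
  rw [ContinuousLinearMap.integral_comp_comm ℓ hpi]
  congr 1
  funext a
  rw [eval_integral fun a => integrable_weightedDeriv hF hint _ _]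
  ext1 y
  rw [show (∫ x, weightedDerivCLM (a : ℕ × ℕ).1 (a : ℕ × ℕ).2 (F x) ∂μ) y =
      BoundedContinuousFunction.evalCLM ℂ y
        (∫ x, weightedDerivCLM (a : ℕ × ℕ).1 (a : ℕ × ℕ).2 (F x) ∂μ) from rfl,
    ← ContinuousLinearMap.integral_comp_comm _ (integrable_weightedDeriv hF hint _ _)]
  simp only [weightedDerivCLM_apply, BoundedContinuousFunction.evalCLM_apply, weightedDeriv_apply]
  rw [integral_smul, iteratedFDeriv_integral hF hint hG]

end Integral

/-! ### Translations -/

theorem iteratedFDeriv_compSubConstCLM (φ : 𝓢(E, ℂ)) (x : E) (n : ℕ) (y : E) :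
    iteratedFDeriv ℝ n (φ.compSubConstCLM ℂ x) y = iteratedFDeriv ℝ n φ (y - x) :=
  iteratedFDeriv_comp_sub n x y

theorem norm_iteratedFDeriv_sub_le (φ : 𝓢(E, ℂ)) (n : ℕ) (y z : E) :
    ‖iteratedFDeriv ℝ n φ y - iteratedFDeriv ℝ n φ z‖ ≤
      SchwartzMap.seminorm ℂ 0 (n + 1) φ * ‖y - z‖ := by
  refine Convex.norm_image_sub_le_of_norm_fderiv_le (𝕜 := ℝ) (s := Set.univ) (fun x _ => ?_)
    (fun x _ => ?_) convex_univ (Set.mem_univ z) (Set.mem_univ y)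
  · exact (φ.smooth ⊤).contDiffAt.differentiableAt_iteratedFDeriv
      (by exact_mod_cast WithTop.coe_lt_coe.mpr (ENat.natCast_lt_top n))
  · rw [norm_fderiv_iteratedFDeriv]
    exact φ.norm_iteratedFDeriv_le_seminorm ℂ (n + 1) x

/-- On ‖y‖ ≤ M the mean value inequality makes the difference of two translates small; outside, one
spare power of decay makes each translate small by itself. -/
theorem continuous_compSubConstCLM (φ : 𝓢(E, ℂ)) :
    Continuous fun x => φ.compSubConstCLM ℂ x := by
  rw [continuous_iff_continuousAt]
  intro x₀
  rw [ContinuousAt, (schwartz_withSeminorms ℂ E ℂ).tendsto_nhds]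
  rintro ⟨k, n⟩ ε hε
  set S := SchwartzMap.seminorm ℂ (k + 1) n φ with hS
  set D := SchwartzMap.seminorm ℂ 0 (n + 1) φ with hD
  have hS0 : 0 ≤ S := apply_nonneg _ _
  have hD0 : 0 ≤ D := apply_nonneg _ _
  -- The first summand gives ‖y‖ ≤ 2‖y - z‖ for ‖y‖ > M and z within 1 of x₀; the second makes each
  -- tail at most ε/4.
  set M := 2 * (‖x₀‖ + 1) + 2 ^ (k + 3) * S / ε with hM
  have hMx : 2 * (‖x₀‖ + 1) ≤ M := le_add_of_nonneg_right (by positivity)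
  have hMS : 2 ^ (k + 3) * S / ε ≤ M := le_add_of_nonneg_left (by positivity)
  have hM0 : 0 < M := lt_of_lt_of_le (by positivity) hMx
  have hMk : 0 < M ^ k := by positivity
  have hδ : 0 < ε / (2 * M ^ k * (D + 1)) := by positivity
  filter_upwards [Metric.ball_mem_nhds x₀ (lt_min hδ one_pos)] with x hx
  rw [Metric.mem_ball, dist_eq_norm, lt_min_iff] at hx
  refine lt_of_le_of_lt (?_ : _ ≤ ε / 2) (half_lt_self hε)
  refine seminorm_le_bound ℂ k n _ (by positivity) fun y => ?_
  rw [FunLike.coe_sub, iteratedFDeriv_sub_apply ((smooth _ n).contDiffAt)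
    ((smooth _ n).contDiffAt), iteratedFDeriv_compSubConstCLM, iteratedFDeriv_compSubConstCLM]
  by_cases hy : ‖y‖ ≤ M
  · have hd := φ.norm_iteratedFDeriv_sub_le n (y - x) (y - x₀)
    rw [sub_sub_sub_cancel_left, norm_sub_rev x₀ x] at hd
    have hd' : D * ‖x - x₀‖ ≤ ε / (2 * M ^ k) := by
      calc D * ‖x - x₀‖ ≤ (D + 1) * (ε / (2 * M ^ k * (D + 1))) :=
            mul_le_mul (by linarith) hx.1.le (norm_nonneg _) (by positivity)
        _ = ε / (2 * M ^ k) := by field_simp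
    calc ‖y‖ ^ k * _ ≤ M ^ k * (ε / (2 * M ^ k)) :=
          mul_le_mul (pow_le_pow_left₀ (norm_nonneg _) hy k) (hd.trans hd') (norm_nonneg _) hMk.le
      _ = ε / 2 := by field_simp
  · rw [not_le] at hy
    have hkey : ∀ z, ‖z - x₀‖ ≤ 1 → ‖y‖ ^ k * ‖iteratedFDeriv ℝ n φ (y - z)‖ ≤ ε / 4 := by
      intro z hz
      have hz' : ‖z‖ ≤ ‖x₀‖ + 1 := by
        calc ‖z‖ = ‖(z - x₀) + x₀‖ := by congr 1; abel
          _ ≤ ‖z - x₀‖ + ‖x₀‖ := norm_add_le _ _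
          _ ≤ _ := by linarith
      have hyz : ‖y‖ ≤ 2 * ‖y - z‖ := by
        have := norm_sub_norm_le y z
        linarith
      have hdec := φ.le_seminorm ℂ (k + 1) n (y - z)
      have hpow : ‖y‖ ^ (k + 1) ≤ 2 ^ (k + 1) * ‖y - z‖ ^ (k + 1) := by
        rw [← mul_pow]
        exact pow_le_pow_left₀ (norm_nonneg _) hyz _
      have h1 : ‖y‖ ^ (k + 1) * ‖iteratedFDeriv ℝ n φ (y - z)‖ ≤ 2 ^ (k + 1) * S := by
        refine (mul_le_mul_of_nonneg_right hpow (norm_nonneg _)).trans ?_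
        rw [mul_assoc]
        exact mul_le_mul_of_nonneg_left hdec (by positivity)
      have h2 : 2 ^ (k + 1) * S ≤ ‖y‖ * (ε / 4) := by
        rw [div_le_iff₀ hε] at hMS
        have : M * ε ≤ ‖y‖ * ε := mul_le_mul_of_nonneg_right hy.le hε.le
        have h3 : (2 : ℝ) ^ (k + 3) * S = 4 * (2 ^ (k + 1) * S) := by ring
        linarith
      have hy0 : 0 < ‖y‖ := hM0.trans hy
      have h4 : ‖y‖ * (‖y‖ ^ k * ‖iteratedFDeriv ℝ n φ (y - z)‖) ≤ ‖y‖ * (ε / 4) := by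
        calc _ = ‖y‖ ^ (k + 1) * ‖iteratedFDeriv ℝ n φ (y - z)‖ := by ring
          _ ≤ _ := h1.trans h2
      exact le_of_mul_le_mul_left h4 hy0
    calc ‖y‖ ^ k * _ ≤ ‖y‖ ^ k * (‖iteratedFDeriv ℝ n φ (y - x)‖ +
          ‖iteratedFDeriv ℝ n φ (y - x₀)‖) :=
          mul_le_mul_of_nonneg_left (norm_sub_le _ _) (by positivity)
      _ ≤ ε / 4 + ε / 4 := by
          rw [mul_add]
          exact add_le_add (hkey x hx.2.le) (hkey x₀ (by simp))
      _ = ε / 2 := by ring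

/-- Only polynomial growth in x matters: it is integrable against a Schwartz function, as
`temperedDistribution_convolution` requires. -/
theorem exists_seminorm_compSubConstCLM_le (φ : 𝓢(E, ℂ)) (k n : ℕ) :
    ∃ C : ℝ, 0 ≤ C ∧ ∀ x, SchwartzMap.seminorm ℂ k n (φ.compSubConstCLM ℂ x) ≤
      C * (1 + ‖x‖ ^ k) := by
  set S := SchwartzMap.seminorm ℂ k n φ with hS
  set D := SchwartzMap.seminorm ℂ 0 n φ with hD
  have hS0 : 0 ≤ S := apply_nonneg _ _
  have hD0 : 0 ≤ D := apply_nonneg _ _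
  refine ⟨2 ^ (k - 1) * (S + D), by positivity, fun x => ?_⟩
  refine seminorm_le_bound ℂ k n _ (by positivity) fun y => ?_
  rw [iteratedFDeriv_compSubConstCLM]
  have h2 : ‖y‖ ≤ ‖y - x‖ + ‖x‖ := by
    calc ‖y‖ = ‖(y - x) + x‖ := by congr 1; abel
      _ ≤ _ := norm_add_le _ _
  have h3 : ‖y‖ ^ k ≤ 2 ^ (k - 1) * (‖y - x‖ ^ k + ‖x‖ ^ k) :=
    (pow_le_pow_left₀ (norm_nonneg _) h2 k).trans (add_pow_le (norm_nonneg _) (norm_nonneg x) k)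
  have h4 := φ.le_seminorm ℂ k n (y - x)
  have h5 := φ.norm_iteratedFDeriv_le_seminorm ℂ n (y - x)
  have hxk : 0 ≤ ‖x‖ ^ k := by positivity
  calc ‖y‖ ^ k * ‖iteratedFDeriv ℝ n φ (y - x)‖
      ≤ 2 ^ (k - 1) * (‖y - x‖ ^ k + ‖x‖ ^ k) * ‖iteratedFDeriv ℝ n φ (y - x)‖ :=
        mul_le_mul_of_nonneg_right h3 (norm_nonneg _)
    _ = 2 ^ (k - 1) * (‖y - x‖ ^ k * ‖iteratedFDeriv ℝ n φ (y - x)‖ +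
          ‖x‖ ^ k * ‖iteratedFDeriv ℝ n φ (y - x)‖) := by ring
    _ ≤ 2 ^ (k - 1) * (S + ‖x‖ ^ k * D) := by gcongr
    _ ≤ 2 ^ (k - 1) * ((S + D) * (1 + ‖x‖ ^ k)) := by
        refine mul_le_mul_of_nonneg_left ?_ (by positivity)
        nlinarith [mul_nonneg hS0 hxk]
    _ = _ := by ring

end SchwartzMap

theorem continuous_temperedDistribution_translate {d : ℕ} (f : 𝓢'(Eu d, ℂ))
    (φ : 𝓢(Eu d, ℂ)) : Continuous fun x => f (φ.compSubConstCLM ℂ x) :=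
  (map_continuous f).comp (SchwartzMap.continuous_compSubConstCLM φ)

/-- `f(h ∗ φ) = ∫ h(x) f(φ(· - x)) dx` for a tempered distribution `f`. -/
theorem temperedDistribution_convolution {d : ℕ} (f : 𝓢'(Eu d, ℂ))
    (φ h : 𝓢(Eu d, ℂ)) :
    f (SchwartzMap.convolution (ContinuousLinearMap.mul ℂ ℂ) h φ) =
      ∫ x, h x * f (φ.compSubConstCLM ℂ x) := by
  have hcont : Continuous fun x => h x • φ.compSubConstCLM ℂ x :=
    h.continuous.smul (SchwartzMap.continuous_compSubConstCLM φ)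
  rw [SchwartzMap.temperedDistribution_integral (μ := volume) f hcont]
  · simp only [map_smul, smul_eq_mul]
  · intro k n
    obtain ⟨C, hC, hle⟩ := SchwartzMap.exists_seminorm_compSubConstCLM_le φ k n
    refine ⟨fun x => C * (‖x‖ ^ 0 * ‖h x‖ + ‖x‖ ^ k * ‖h x‖),
      ((h.integrable_pow_mul volume 0).add (h.integrable_pow_mul volume k)).const_mul C,
      fun x => ?_⟩
    rw [map_smul_eq_mul]
    calc ‖h x‖ * _ ≤ ‖h x‖ * (C * (1 + ‖x‖ ^ k)) :=
          mul_le_mul_of_nonneg_left (hle x) (norm_nonneg _)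
      _ = _ := by ring
  · intro y
    rw [SchwartzMap.convolution_apply]
    rfl

/-! ### Convergence of the cut-offs -/

namespace BandResolution

variable {L : ℕ} {Ψ : LocalMeansKernel L} (R : BandResolution Ψ) {d : ℕ}

theorem exists_cutoff_eq_one (d : ℕ) : ∃ ρ : ℝ, 0 < ρ ∧
    ∀ (N : ℕ) (ξ : Eu d), ‖ξ‖ ≤ ρ * 2 ^ N → R.cutoff d N ξ = 1 := by
  obtain ⟨ρ, hρ, h⟩ := R.χ_eq_one
  refine ⟨ρ, hρ, fun N ξ hξ => ?_⟩
  rw [cutoff_apply]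
  refine Finset.prod_eq_one fun i _ => h _ ?_
  rw [abs_div, abs_of_pos (by positivity : (0 : ℝ) < 2 ^ N), div_le_iff₀ (by positivity)]
  exact (PiLp.norm_apply_le ξ i).trans hξ

theorem cutoff_eq_comp (N : ℕ) : ⇑(R.cutoff d N) = fun ξ => R.cutoff d 0 (((2 : ℝ) ^ N)⁻¹ • ξ) := by
  ext ξ
  simp only [cutoff_apply, pow_zero, div_one, PiLp.smul_apply, smul_eq_mul]
  refine Finset.prod_congr rfl fun i _ => ?_
  rw [div_eq_inv_mul]

theorem norm_iteratedFDeriv_cutoff_le (N i : ℕ) (ξ : Eu d) :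
    ‖iteratedFDeriv ℝ i (R.cutoff d N) ξ‖ ≤ SchwartzMap.seminorm ℂ 0 i (R.cutoff d 0) := by
  rw [cutoff_eq_comp, iteratedFDeriv_comp_const_smul _ ((R.cutoff d 0).smooth i)]
  simp only [norm_smul, norm_pow, norm_inv]
  have h1 := (R.cutoff d 0).norm_iteratedFDeriv_le_seminorm ℂ i (((2 : ℝ) ^ N)⁻¹ • ξ)
  refine (mul_le_of_le_one_left (norm_nonneg _) (pow_le_one₀ (by positivity) ?_)).trans h1
  rw [Real.norm_two]
  exact inv_le_one_of_one_le₀ (one_le_pow₀ (by norm_num))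

/-- The difference (cutoff - 1)u vanishes for ‖ξ‖ < ρ 2^N. Elsewhere the derivatives of the cutoffs
are bounded uniformly in N, and trading one extra power of ‖ξ‖ gives the factor 1/(ρ 2^N). -/
theorem tendsto_cutoff_mul (u : 𝓢(Eu d, ℂ)) :
    Filter.Tendsto (fun N => SchwartzMap.pairing (ContinuousLinearMap.mul ℂ ℂ) (R.cutoff d N) u)
      Filter.atTop (nhds u) := by
  obtain ⟨ρ, hρ, hone⟩ := R.exists_cutoff_eq_one d
  rw [(schwartz_withSeminorms ℂ (Eu d) ℂ).tendsto_nhds]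
  rintro ⟨k, n⟩ ε hε
  set C : ℕ → ℝ := fun i => SchwartzMap.seminorm ℂ 0 i (R.cutoff d 0) + 1 with hC
  have hC0 : ∀ i, 0 ≤ C i := fun i => add_nonneg (apply_nonneg _ _) zero_le_one
  set S := ∑ i ∈ Finset.range (n + 1), (n.choose i : ℝ) * C i *
    SchwartzMap.seminorm ℂ (k + 1) (n - i) u with hS
  have hS0 : 0 ≤ S := Finset.sum_nonneg fun i _ =>
    mul_nonneg (mul_nonneg (by positivity) (hC0 i)) (apply_nonneg _ _)
  have hlim : Filter.Tendsto (fun N : ℕ => S / (ρ * 2 ^ N)) Filter.atTop (nhds 0) := by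
    refine Filter.Tendsto.div_atTop tendsto_const_nhds ?_
    exact Filter.Tendsto.const_mul_atTop hρ (tendsto_pow_atTop_atTop_of_one_lt (by norm_num))
  filter_upwards [hlim.eventually_lt_const hε] with N hN
  refine lt_of_le_of_lt ?_ hN
  refine SchwartzMap.seminorm_le_bound ℂ k n _ (by positivity) fun ξ => ?_
  set w : Eu d → ℂ := fun ξ => R.cutoff d N ξ - 1 with hw
  have hfun : ⇑(SchwartzMap.pairing (ContinuousLinearMap.mul ℂ ℂ) (R.cutoff d N) u - u) =
      fun ξ => w ξ * u ξ := by
    ext ξ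
    simp [hw, SchwartzMap.pairing_apply_apply, sub_mul]
  rw [hfun]
  by_cases hξ : ‖ξ‖ < ρ * 2 ^ N
  · have hzero : (fun ξ => w ξ * u ξ) =ᶠ[nhds ξ] fun _ => (0 : ℂ) := by
      filter_upwards [(isOpen_lt continuous_norm continuous_const).mem_nhds hξ] with η hη
      simp [hw, hone N η (le_of_lt hη)]
    have h0 := hzero.iteratedFDeriv (𝕜 := ℝ) n
    rw [h0.eq_of_nhds]
    have : iteratedFDeriv ℝ n (fun _ : Eu d => (0 : ℂ)) ξ = 0 := by simp
    rw [this, norm_zero, mul_zero]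
    positivity
  · rw [not_lt] at hξ
    have hξ0 : 0 < ‖ξ‖ := lt_of_lt_of_le (by positivity) hξ
    have hwC : ContDiff ℝ n w := ((R.cutoff d N).smooth n).sub contDiff_const
    have hbound := norm_iteratedFDeriv_mul_le hwC (u.smooth n) ξ (n := n) le_rfl
    have hwb : ∀ i, ‖iteratedFDeriv ℝ i w ξ‖ ≤ C i := fun i => by
      rw [hw, show (fun ξ => R.cutoff d N ξ - 1) = (⇑(R.cutoff d N) - fun _ => (1 : ℂ)) from rfl,
        iteratedFDeriv_sub_apply ((R.cutoff d N).smooth i).contDiffAt contDiff_const.contDiffAt]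
      refine (norm_sub_le _ _).trans (add_le_add (R.norm_iteratedFDeriv_cutoff_le N i ξ) ?_)
      rcases Nat.eq_zero_or_pos i with rfl | hi
      · rw [norm_iteratedFDeriv_zero]
        simp
      · rw [iteratedFDeriv_const_of_ne hi.ne']
        simp
    rw [le_div_iff₀ (by positivity)]
    calc ‖ξ‖ ^ k * ‖iteratedFDeriv ℝ n (fun ξ => w ξ * u ξ) ξ‖ * (ρ * 2 ^ N)
        ≤ ‖ξ‖ ^ k * ‖iteratedFDeriv ℝ n (fun ξ => w ξ * u ξ) ξ‖ * ‖ξ‖ :=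
          mul_le_mul_of_nonneg_left hξ (by positivity)
      _ = ‖ξ‖ ^ (k + 1) * ‖iteratedFDeriv ℝ n (fun ξ => w ξ * u ξ) ξ‖ := by ring
      _ ≤ ‖ξ‖ ^ (k + 1) * ∑ i ∈ Finset.range (n + 1), (n.choose i : ℝ) *
          ‖iteratedFDeriv ℝ i w ξ‖ * ‖iteratedFDeriv ℝ (n - i) u ξ‖ :=
          mul_le_mul_of_nonneg_left hbound (by positivity)
      _ ≤ S := by
          rw [Finset.mul_sum, hS]
          refine Finset.sum_le_sum fun i _ => ?_
          calc _ = (n.choose i : ℝ) * ‖iteratedFDeriv ℝ i w ξ‖ *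
                (‖ξ‖ ^ (k + 1) * ‖iteratedFDeriv ℝ (n - i) u ξ‖) := by ring
            _ ≤ _ := mul_le_mul (mul_le_mul_of_nonneg_left (hwb i) (by positivity))
                (u.le_seminorm ℂ (k + 1) (n - i) ξ) (by positivity)
                (mul_nonneg (by positivity) (hC0 i))

/-! ### The reproducing formula for test functions -/

/-- The reflected kernel `x ↦ Λ_m(-x)`. -/
def kernelNeg (m : Fin d → ℕ) : 𝓢(Eu d, ℂ) := 𝓕 (R.symbol m)

theorem kernelNeg_apply (m : Fin d → ℕ) (x : Eu d) : R.kernelNeg m x = R.kernel m (-x) := by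
  rw [kernelNeg, kernel, SchwartzMap.fourier_coe, SchwartzMap.fourierInv_coe,
    Real.fourierInv_eq_fourier_neg, neg_neg]

theorem fourier_kernelNeg (m : Fin d → ℕ) (ξ : Eu d) :
    𝓕 (R.kernelNeg m) ξ = R.symbol m (-ξ) := by
  have h : 𝓕⁻ (R.kernelNeg m) = R.symbol m := by
    rw [kernelNeg, FourierTransform.fourierInv_fourier_eq]
  rw [← h, SchwartzMap.fourier_coe, SchwartzMap.fourierInv_coe, Real.fourierInv_eq_fourier_neg,
    neg_neg]

/-- The reflected local mean kernel `y ↦ Ψ_m(-y)`. -/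
def _root_.LocalMeansKernel.reflected (Ψ : LocalMeansKernel L) (m : Fin d → ℕ) : 𝓢(Eu d, ℂ) :=
  Ψ.shifted m 0

theorem reflected_apply (m : Fin d → ℕ) (y : Eu d) : Ψ.reflected m y = Ψ.tensor m (-y) := by
  change Ψ.tensor m (0 - y) = _
  rw [zero_sub]

theorem shifted_eq (m : Fin d → ℕ) (x : Eu d) :
    Ψ.shifted m x = (Ψ.reflected m).compSubConstCLM ℂ x := by
  ext y
  rw [SchwartzMap.compSubConstCLM_apply, reflected_apply]
  change Ψ.tensor m (x - y) = _
  rw [neg_sub]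

theorem fourier_reflected (m : Fin d → ℕ) (ξ : Eu d) :
    𝓕 (Ψ.reflected m) ξ = 𝓕 (Ψ.tensor m) (-ξ) := by
  rw [SchwartzMap.fourier_coe, ← Real.fourierInv_eq_fourier_neg, Real.fourierInv_eq_fourier_comp_neg]
  have h : ⇑(Ψ.reflected m) = fun y => Ψ.tensor m (-y) := funext (reflected_apply m)
  rw [h]

/-- On the Fourier side convolutions are products and `sum_symbol_mul` collapses the sum to a
cutoff. Reflecting both kernels evaluates every symbol at -ξ, which matches the reflection produced
by a double Fourier transform. -/
theorem sum_convolution_eq (φ : 𝓢(Eu d, ℂ)) (N : ℕ) :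
    ∑ m ∈ Fintype.piFinset fun _ : Fin d => Finset.range (N + 1),
      SchwartzMap.convolution (ContinuousLinearMap.mul ℂ ℂ)
        (SchwartzMap.convolution (ContinuousLinearMap.mul ℂ ℂ) φ (R.kernelNeg m))
        (Ψ.reflected m) =
      𝓕 (SchwartzMap.pairing (ContinuousLinearMap.mul ℂ ℂ) (R.cutoff d N) (𝓕⁻ φ)) := by
  refine (FourierTransform.fourierCLE ℂ 𝓢(Eu d, ℂ)).injective ?_
  rw [map_sum]
  ext ξ
  simp only [FourierTransform.fourierCLE_apply, SchwartzMap.fourier_convolution, sum_apply,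
    SchwartzMap.pairing_apply_apply, fourier_kernelNeg, fourier_reflected,
    ContinuousLinearMap.mul_apply']
  have h : 𝓕 (𝓕 (SchwartzMap.pairing (ContinuousLinearMap.mul ℂ ℂ) (R.cutoff d N) (𝓕⁻ φ))) ξ =
      SchwartzMap.pairing (ContinuousLinearMap.mul ℂ ℂ) (R.cutoff d N) (𝓕⁻ φ) (-ξ) := by
    generalize SchwartzMap.pairing (ContinuousLinearMap.mul ℂ ℂ) (R.cutoff d N) (𝓕⁻ φ) = G
    have e : 𝓕⁻ (𝓕 G) = G := FourierTransform.fourierInv_fourier_eq G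
    conv_rhs => rw [← e]
    rw [SchwartzMap.fourierInv_coe, Real.fourierInv_eq_fourier_neg, neg_neg,
      SchwartzMap.fourier_coe]
  rw [h, SchwartzMap.pairing_apply_apply, ContinuousLinearMap.mul_apply', ← R.sum_symbol_mul N (-ξ),
    SchwartzMap.fourierInv_coe, Real.fourierInv_eq_fourier_neg, neg_neg, ← SchwartzMap.fourier_coe,
    Finset.sum_mul]
  exact Finset.sum_congr rfl fun m _ => by ring

theorem tendsto_sum_convolution (φ : 𝓢(Eu d, ℂ)) :
    Filter.Tendsto (fun N => ∑ m ∈ Fintype.piFinset fun _ : Fin d => Finset.range (N + 1),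
      SchwartzMap.convolution (ContinuousLinearMap.mul ℂ ℂ)
        (SchwartzMap.convolution (ContinuousLinearMap.mul ℂ ℂ) φ (R.kernelNeg m))
        (Ψ.reflected m)) Filter.atTop (nhds φ) := by
  simp_rw [R.sum_convolution_eq φ]
  have h := ((FourierTransform.fourierCLE ℂ 𝓢(Eu d, ℂ)).continuous.tendsto (𝓕⁻ φ)).comp
    (R.tendsto_cutoff_mul (𝓕⁻ φ))
  simpa [Function.comp_def] using h

end BandResolution

/-! ### A weighted Hölder inequality -/

/-- Hölder for a g = a^(1-1/q) (a g^q)^(1/q): the L_1 bound of the kernel controls the first factor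
and its sup bound the second. It is applied to the reproducing kernels with M = 2^|m| and to the
aliasing kernels with M = 2^|m| / n. -/
theorem lintegral_mul_le_of_bounds {X : Type*} [MeasurableSpace X] {μ : Measure X} {a g : X → ℝ≥0∞}
    (ha : AEMeasurable a μ) (hg : AEMeasurable g μ) {C M : ℝ≥0∞} {q : ℝ} (hq : 1 ≤ q)
    (h1 : ∫⁻ x, a x ∂μ ≤ C) (h2 : ∀ x, a x ≤ C * M) :
    ∫⁻ x, a x * g x ∂μ ≤ C * (M * ∫⁻ x, g x ^ q ∂μ) ^ q⁻¹ := by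
  have hq0 : 0 < q := by linarith
  have hqi : 0 ≤ q⁻¹ := by positivity
  have hq1 : 0 ≤ 1 - q⁻¹ := sub_nonneg.mpr (inv_le_one_of_one_le₀ hq)
  have hpt : ∀ x, a x * g x = a x ^ (1 - q⁻¹) * (a x * g x ^ q) ^ q⁻¹ := fun x => by
    rw [ENNReal.mul_rpow_of_nonneg _ _ hqi, ← mul_assoc, ← ENNReal.rpow_add_of_nonneg _ _ hq1 hqi,
      ← ENNReal.rpow_mul, mul_inv_cancel₀ hq0.ne', sub_add_cancel, ENNReal.rpow_one,
      ENNReal.rpow_one]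
  simp_rw [hpt]
  refine (ENNReal.lintegral_mul_norm_pow_le ha (ha.mul (hg.pow_const q)) hq1 hqi
    (sub_add_cancel _ _)).trans ?_
  have h3 : ∫⁻ x, a x * g x ^ q ∂μ ≤ C * (M * ∫⁻ x, g x ^ q ∂μ) := by
    rw [← mul_assoc, ← lintegral_const_mul'' _ (hg.pow_const q)]
    exact lintegral_mono fun x => mul_le_mul_left (h2 x) _
  calc _ ≤ C ^ (1 - q⁻¹) * (C * (M * ∫⁻ x, g x ^ q ∂μ)) ^ q⁻¹ :=
        mul_le_mul' (ENNReal.rpow_le_rpow h1 hq1) (ENNReal.rpow_le_rpow h3 hqi)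
    _ = _ := by
        rw [ENNReal.mul_rpow_of_nonneg _ _ hqi, ← mul_assoc,
          ← ENNReal.rpow_add_of_nonneg _ _ hq1 hqi, sub_add_cancel, ENNReal.rpow_one]

/-! ### Consequences of a finite Triebel-Lizorkin norm -/

namespace LocalMeansKernel

variable {L : ℕ} (Ψ : LocalMeansKernel L) {d : ℕ}

theorem conv_eq (m : Fin d → ℕ) (f : 𝓢'(Eu d, ℂ)) (x : Eu d) :
    Ψ.conv m f x = f ((Ψ.reflected m).compSubConstCLM ℂ x) := by
  rw [conv, BandResolution.shifted_eq]

theorem continuous_conv (m : Fin d → ℕ) (f : 𝓢'(Eu d, ℂ)) : Continuous (Ψ.conv m f) := by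
  simp_rw [funext (Ψ.conv_eq m f)]
  exact continuous_temperedDistribution_translate f _

theorem measurable_tl_term (m : Fin d → ℕ) (f : 𝓢'(Eu d, ℂ)) (c q : ℝ) :
    Measurable fun x => ENNReal.ofReal c * ‖Ψ.conv m f x‖ₑ ^ q :=
  ((Ψ.continuous_conv m f).measurable.enorm.pow_const q).const_mul _

theorem tlNorm_rpow {s p θ : ℝ} (hp : 0 < p) (f : 𝓢'(Eu d, ℂ)) :
    Ψ.tlNorm s p θ f ^ p = ∫⁻ x, (∑' m : Fin d → ℕ,
      ENNReal.ofReal ((2 : ℝ) ^ (s * (∑ i, (m i : ℝ)) * θ)) * ‖Ψ.conv m f x‖ₑ ^ θ) ^ (p / θ) := by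
  rw [tlNorm, ← ENNReal.rpow_mul, one_div_mul_cancel hp.ne', ENNReal.rpow_one]
  refine lintegral_congr fun x => ?_
  rw [← ENNReal.rpow_mul, one_div_mul_eq_div]

theorem tsum_rpow_le_rpow_tsum {ι : Type*} (u : ι → ℝ≥0∞) {r : ℝ} (hr : 1 ≤ r) :
    ∑' i, u i ^ r ≤ (∑' i, u i) ^ r := by
  have hr0 : 0 ≤ r - 1 := by linarith
  have h : ∀ v : ℝ≥0∞, v ^ r = v * v ^ (r - 1) := fun v => by
    nth_rewrite 2 [← ENNReal.rpow_one v]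
    rw [← ENNReal.rpow_add_of_nonneg _ _ zero_le_one hr0, add_sub_cancel]
  simp_rw [h]
  rw [← ENNReal.tsum_mul_right]
  exact ENNReal.tsum_le_tsum fun i =>
    mul_le_mul_right (ENNReal.rpow_le_rpow (ENNReal.le_tsum i) hr0) _

/-- The embedding ℓ_θ ⊂ ℓ_p under the integral, followed by exchanging sum and integral. This is the
form of the norm used at high levels. -/
theorem tsum_lintegral_rpow_le {s p θ : ℝ} (hθ : 0 < θ) (hθp : θ ≤ p) (f : 𝓢'(Eu d, ℂ)) :
    ∑' m : Fin d → ℕ, ENNReal.ofReal ((2 : ℝ) ^ (s * (∑ i, (m i : ℝ)) * p)) *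
      ∫⁻ x, ‖Ψ.conv m f x‖ₑ ^ p ≤ Ψ.tlNorm s p θ f ^ p := by
  have hp : 0 < p := hθ.trans_le hθp
  rw [Ψ.tlNorm_rpow hp]
  have h1 : ∀ m : Fin d → ℕ, ENNReal.ofReal ((2 : ℝ) ^ (s * (∑ i, (m i : ℝ)) * p)) *
      ∫⁻ x, ‖Ψ.conv m f x‖ₑ ^ p = ∫⁻ x, (ENNReal.ofReal ((2 : ℝ) ^ (s * (∑ i, (m i : ℝ)) * θ)) *
        ‖Ψ.conv m f x‖ₑ ^ θ) ^ (p / θ) := fun m => by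
    rw [← lintegral_const_mul' _ _ ENNReal.ofReal_ne_top]
    refine lintegral_congr fun x => ?_
    rw [ENNReal.mul_rpow_of_nonneg _ _ (by positivity), ← ENNReal.rpow_mul,
      mul_div_cancel₀ _ hθ.ne', ENNReal.ofReal_rpow_of_pos (by positivity),
      ← Real.rpow_mul (by norm_num)]
    rw [mul_assoc _ θ, mul_div_cancel₀ _ hθ.ne']
  simp_rw [h1]
  rw [← lintegral_tsum fun m => ((Ψ.measurable_tl_term m f _ _).pow_const _).aemeasurable]
  exact lintegral_mono fun x => tsum_rpow_le_rpow_tsum _ ((one_le_div hθ).mpr hθp)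

/-- Hölder with exponent p/θ lowers the integrability from p to θ at the price of a power of the
volume of Q. This is the form of the norm used at low levels, and the reason for working on a fixed
bounded cube. -/
theorem tsum_setLIntegral_rpow_le {s p θ : ℝ} (hθ : 0 < θ) (hθp : θ < p) (f : 𝓢'(Eu d, ℂ))
    (Q : Set (Eu d)) :
    ∑' m : Fin d → ℕ, ENNReal.ofReal ((2 : ℝ) ^ (s * (∑ i, (m i : ℝ)) * θ)) *
      ∫⁻ x in Q, ‖Ψ.conv m f x‖ₑ ^ θ ≤ volume Q ^ (1 - θ / p) * Ψ.tlNorm s p θ f ^ θ := by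
  have hp : 0 < p := hθ.trans hθp
  simp_rw [← lintegral_const_mul' _ _ ENNReal.ofReal_ne_top]
  rw [← lintegral_tsum fun m => (Ψ.measurable_tl_term m f _ _).aemeasurable]
  set F : Eu d → ℝ≥0∞ := fun x => ∑' m : Fin d → ℕ,
      ENNReal.ofReal ((2 : ℝ) ^ (s * (∑ i, (m i : ℝ)) * θ)) * ‖Ψ.conv m f x‖ₑ ^ θ with hF
  have hFm : Measurable F := Measurable.tsum fun m => Ψ.measurable_tl_term m f _ _
  have h1 : Ψ.tlNorm s p θ f ^ θ = (∫⁻ x, F x ^ (p / θ)) ^ (θ / p) := by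
    rw [← Ψ.tlNorm_rpow hp, ← ENNReal.rpow_mul, mul_div_cancel₀ _ hp.ne']
  rw [h1]
  have h2 := ENNReal.lintegral_mul_norm_pow_le (μ := volume.restrict Q) (f := fun _ => (1 : ℝ≥0∞))
    (g := fun x => F x ^ (p / θ)) aemeasurable_const (hFm.pow_const _).aemeasurable
    (p := 1 - θ / p) (q := θ / p) (sub_nonneg.mpr ((div_le_one hp).mpr hθp.le)) (by positivity)
    (sub_add_cancel _ _)
  simp only [ENNReal.one_rpow, one_mul, ← ENNReal.rpow_mul, lintegral_const,
    Measure.restrict_apply MeasurableSet.univ, Set.univ_inter] at h2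
  rw [show p / θ * (θ / p) = 1 by field_simp] at h2
  simp only [ENNReal.rpow_one] at h2
  exact h2.trans (mul_le_mul_right
    (ENNReal.rpow_le_rpow (setLIntegral_le_lintegral _ _) (by positivity)) _)

end LocalMeansKernel

/-! ### The pieces of a distribution -/

theorem sum_prod_le_geom {d : ℕ} {r : ℝ} (h0 : 0 ≤ r) (h1 : r < 1) (u : Finset (Fin d → ℕ)) :
    ∑ m ∈ u, r ^ (∑ i, m i) ≤ (1 - r)⁻¹ ^ d := by
  obtain ⟨N, hN⟩ : ∃ N, u ⊆ Fintype.piFinset fun _ : Fin d => Finset.range N := by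
    refine ⟨(u.sup fun m => ∑ i, m i) + 1, fun m hm => ?_⟩
    rw [Fintype.mem_piFinset]
    intro i
    rw [Finset.mem_range, Nat.lt_succ_iff]
    exact (Finset.single_le_sum (fun _ _ => Nat.zero_le _) (Finset.mem_univ i)).trans
      (Finset.le_sup (f := fun m : Fin d → ℕ => ∑ i, m i) hm)
  calc ∑ m ∈ u, r ^ (∑ i, m i) ≤ ∑ m ∈ Fintype.piFinset fun _ : Fin d => Finset.range N,
        r ^ (∑ i, m i) := Finset.sum_le_sum_of_subset_of_nonneg hN fun _ _ _ => by positivity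
    _ = ∏ _i : Fin d, ∑ j ∈ Finset.range N, r ^ j := by
        rw [Finset.prod_univ_sum]
        simp_rw [Finset.prod_pow_eq_pow_sum]
    _ ≤ _ := by
        rw [Finset.prod_const, Finset.card_univ, Fintype.card_fin]
        refine pow_le_pow_left₀ (Finset.sum_nonneg fun _ _ => by positivity) ?_ _
        rw [← tsum_geometric_of_lt_one h0 h1]
        exact (summable_geometric_of_lt_one h0 h1).sum_le_tsum _ fun _ _ => by positivity

theorem summable_pow_sum {d : ℕ} {r : ℝ} (h0 : 0 ≤ r) (h1 : r < 1) :
    Summable fun m : Fin d → ℕ => r ^ (∑ i, m i) :=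
  summable_of_sum_le (fun _ => by positivity) (sum_prod_le_geom h0 h1)

theorem tendsto_piFinset_range (d : ℕ) : Filter.Tendsto
    (fun N => Fintype.piFinset fun _ : Fin d => Finset.range (N + 1)) Filter.atTop Filter.atTop := by
  refine Filter.tendsto_atTop_finset_of_monotone (fun M N h => ?_) fun m => ?_
  · exact Fintype.piFinset_subset _ _ fun _ => Finset.range_mono (by omega)
  · refine ⟨∑ i, m i, Fintype.mem_piFinset.mpr fun i => Finset.mem_range.mpr ?_⟩
    exact Nat.lt_succ_of_le (Finset.single_le_sum (fun _ _ => Nat.zero_le _) (Finset.mem_univ i))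

namespace BandResolution

variable {L : ℕ} {Ψ : LocalMeansKernel L} (R : BandResolution Ψ) {d : ℕ}

/-- The function `Λ_m ∗ Ψ_m ∗ f`. -/
def piece (m : Fin d → ℕ) (f : 𝓢'(Eu d, ℂ)) (x : Eu d) : ℂ :=
  f (SchwartzMap.convolution (ContinuousLinearMap.mul ℂ ℂ)
    ((R.kernelNeg m).compSubConstCLM ℂ x) (Ψ.reflected m))

theorem piece_eq_integral (m : Fin d → ℕ) (f : 𝓢'(Eu d, ℂ)) (x : Eu d) :
    R.piece m f x = ∫ y, R.kernel m (x - y) * Ψ.conv m f y := by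
  rw [piece, temperedDistribution_convolution]
  simp_rw [← Ψ.conv_eq]
  refine integral_congr_ae (Filter.Eventually.of_forall fun y => ?_)
  simp only [SchwartzMap.compSubConstCLM_apply, kernelNeg_apply, neg_sub]

/-- The distribution `φ ↦ f(φ ∗ Ψ_m(-·))`. -/
def convDistribution (Ψ : LocalMeansKernel L) (m : Fin d → ℕ) (f : 𝓢'(Eu d, ℂ)) : 𝓢'(Eu d, ℂ) :=
  PointwiseConvergenceCLM.precomp ℂ
    (SchwartzMap.convolution (ContinuousLinearMap.mul ℂ ℂ).flip (Ψ.reflected m)) f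

theorem convDistribution_apply (m : Fin d → ℕ) (f : 𝓢'(Eu d, ℂ)) (φ : 𝓢(Eu d, ℂ)) :
    convDistribution Ψ m f φ =
      f (SchwartzMap.convolution (ContinuousLinearMap.mul ℂ ℂ) φ (Ψ.reflected m)) := by
  rw [← SchwartzMap.convolution_flip]
  rfl

theorem piece_eq (m : Fin d → ℕ) (f : 𝓢'(Eu d, ℂ)) (x : Eu d) :
    R.piece m f x = convDistribution Ψ m f ((R.kernelNeg m).compSubConstCLM ℂ x) := by
  rw [convDistribution_apply, piece]

theorem continuous_piece (m : Fin d → ℕ) (f : 𝓢'(Eu d, ℂ)) : Continuous (R.piece m f) := by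
  simp_rw [funext (R.piece_eq m f)]
  exact continuous_temperedDistribution_translate _ _

theorem integral_piece_mul (m : Fin d → ℕ) (f : 𝓢'(Eu d, ℂ)) (φ : 𝓢(Eu d, ℂ)) :
    ∫ x, R.piece m f x * φ x = f (SchwartzMap.convolution (ContinuousLinearMap.mul ℂ ℂ)
      (SchwartzMap.convolution (ContinuousLinearMap.mul ℂ ℂ) φ (R.kernelNeg m))
        (Ψ.reflected m)) := by
  rw [← convDistribution_apply, temperedDistribution_convolution]
  simp_rw [R.piece_eq, mul_comm]

theorem exists_enorm_piece_le (d : ℕ) : ∃ C : ℝ, 1 ≤ C ∧ ∀ (m : Fin d → ℕ) (f : 𝓢'(Eu d, ℂ)) (q : ℝ),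
    1 ≤ q → ∀ x, ‖R.piece m f x‖ₑ ≤ ENNReal.ofReal C *
      (ENNReal.ofReal (2 ^ (∑ i, m i)) * ∫⁻ y, ‖Ψ.conv m f y‖ₑ ^ q) ^ q⁻¹ := by
  obtain ⟨C, hC, h⟩ := R.exists_kernel_bounds d
  refine ⟨C, hC, fun m f q hq x => ?_⟩
  rw [R.piece_eq_integral]
  refine (enorm_integral_le_lintegral_enorm _).trans ?_
  simp_rw [enorm_mul]
  have hk : Continuous fun y => R.kernel m (x - y) :=
    (R.kernel m).continuous.comp (continuous_const.sub continuous_id)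
  refine lintegral_mul_le_of_bounds hk.measurable.enorm.aemeasurable
    (Ψ.continuous_conv m f).measurable.enorm.aemeasurable hq ?_ fun y => ?_
  · rw [lintegral_sub_left_eq_self (fun y => ‖R.kernel m y‖ₑ) x,
      ← ofReal_integral_norm_eq_lintegral_enorm (R.kernel m).integrable]
    exact ENNReal.ofReal_le_ofReal (h.2 m)
  · rw [← ENNReal.ofReal_mul (by linarith), ← ofReal_norm]
    exact ENNReal.ofReal_le_ofReal (h.1 m _)

/-- A Nikol'skii-type estimate: Ψ_m ∗ f has L_p norm at most 2^(-s|m|) times the norm of f, and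
passing to the sup norm by the band-limited kernel costs 2^(|m|/p). -/
theorem exists_norm_piece_le {s p θ : ℝ} (hθ : 1 ≤ θ) (hθp : θ < p) : ∃ C : ℝ, 1 ≤ C ∧
    ∀ (m : Fin d → ℕ) (f : 𝓢'(Eu d, ℂ)), Ψ.tlNorm s p θ f < ⊤ → ∀ x, ‖R.piece m f x‖ ≤
      C * (Ψ.tlNorm s p θ f).toReal * ((2 : ℝ) ^ (1 / p - s)) ^ (∑ i, m i) := by
  obtain ⟨C, hC, h⟩ := R.exists_enorm_piece_le d
  have hp : 0 < p := by linarith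
  refine ⟨C, hC, fun m f hf x => ?_⟩
  set τ := Ψ.tlNorm s p θ f
  have h1 := (ENNReal.le_tsum m).trans (Ψ.tsum_lintegral_rpow_le (s := s) (by linarith) hθp.le f)
  have h2 : ∫⁻ y, ‖Ψ.conv m f y‖ₑ ^ p ≤
      ENNReal.ofReal ((2 : ℝ) ^ (-(s * (∑ i, (m i : ℝ)) * p))) * τ ^ p := by
    calc ∫⁻ y, ‖Ψ.conv m f y‖ₑ ^ p = ENNReal.ofReal ((2 : ℝ) ^ (-(s * (∑ i, (m i : ℝ)) * p))) *
          (ENNReal.ofReal ((2 : ℝ) ^ (s * (∑ i, (m i : ℝ)) * p)) *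
            ∫⁻ y, ‖Ψ.conv m f y‖ₑ ^ p) := by
          rw [← mul_assoc, ← ENNReal.ofReal_mul (by positivity), ← Real.rpow_add (by norm_num),
            neg_add_cancel, Real.rpow_zero, ENNReal.ofReal_one, one_mul]
      _ ≤ _ := mul_le_mul_right h1 _
  have h3 := (h m f p (by linarith) x).trans (mul_le_mul_right (ENNReal.rpow_le_rpow
    (mul_le_mul_right h2 _) (by positivity : (0:ℝ) ≤ p⁻¹)) _)
  rw [← mul_assoc, ← ENNReal.ofReal_mul (by positivity),
    ENNReal.mul_rpow_of_nonneg _ _ (by positivity), ← ENNReal.rpow_mul, mul_inv_cancel₀ hp.ne',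
    ENNReal.rpow_one, ENNReal.ofReal_rpow_of_pos (by positivity)] at h3
  have h4 : ((2 : ℝ) ^ (∑ i, m i) * (2 : ℝ) ^ (-(s * (∑ i, (m i : ℝ)) * p))) ^ p⁻¹ =
      ((2 : ℝ) ^ (1 / p - s)) ^ (∑ i, m i) := by
    rw [← Real.rpow_natCast, ← Real.rpow_add (by norm_num), ← Real.rpow_mul (by norm_num),
      ← Real.rpow_natCast, ← Real.rpow_mul (by norm_num)]
    congr 1
    push_cast
    field_simp
    ring
  rw [h4, ← ENNReal.ofReal_toReal hf.ne, ← ENNReal.ofReal_mul (by positivity),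
    ← ENNReal.ofReal_mul (by linarith), ← ofReal_norm,
    ENNReal.ofReal_le_ofReal_iff (by positivity)] at h3
  refine h3.trans (le_of_eq ?_)
  ring

/-- Since s > 1/p the continuous pieces Λ_m ∗ Ψ_m ∗ f have a geometric majorant, so their sum is
continuous and bounded. Tested against φ it agrees with f by `tendsto_sum_convolution`. -/
theorem _root_.LocalMeansKernel.exists_isContinuousRepresentative (Ψ : LocalMeansKernel L)
    {s p θ : ℝ} (hθ : 1 ≤ θ) (hθp : θ < p) (hs : 1 / p < s) (f : 𝓢'(Eu d, ℂ)) (hf : Ψ.tlNorm s p θ f < ⊤) :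
    ∃ g : Eu d → ℂ, IsContinuousRepresentative f g := by
  obtain ⟨R⟩ := nonempty_bandResolution Ψ
  obtain ⟨C, hC, h⟩ := R.exists_norm_piece_le (d := d) (s := s) hθ hθp
  set r : ℝ := (2 : ℝ) ^ (1 / p - s)
  have hr0 : 0 ≤ r := by positivity
  have hr1 : r < 1 := Real.rpow_lt_one_of_one_lt_of_neg (by norm_num) (by linarith)
  set b : (Fin d → ℕ) → ℝ := fun m => C * (Ψ.tlNorm s p θ f).toReal * r ^ (∑ i, m i)
  have hb : Summable b := (summable_pow_sum hr0 hr1).mul_left _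
  have hle : ∀ m x, ‖R.piece m f x‖ ≤ b m := fun m x => h m f hf x
  have hcont : Continuous fun x => ∑' m, R.piece m f x :=
    continuous_tsum (fun m => R.continuous_piece m f) hb hle
  have hbd : ∀ x, ‖∑' m, R.piece m f x‖ ≤ ∑' m, b m := fun x =>
    tsum_of_norm_bounded hb.hasSum fun m => hle m x
  refine ⟨fun x => ∑' m, R.piece m f x, hcont, fun φ => ⟨?_, ?_⟩⟩
  · exact φ.integrable.bdd_mul hcont.aestronglyMeasurable (Filter.Eventually.of_forall hbd)
  · have hint : ∀ m, Integrable fun x => R.piece m f x * φ x := fun m =>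
      φ.integrable.bdd_mul (R.continuous_piece m f).aestronglyMeasurable
        (Filter.Eventually.of_forall (hle m))
    have hsum : Summable fun m => ∫ x, ‖R.piece m f x * φ x‖ := by
      refine Summable.of_nonneg_of_le (fun m => integral_nonneg fun x => norm_nonneg _)
        (fun m => ?_) (hb.mul_right (∫ x, ‖φ x‖))
      rw [← integral_const_mul]
      refine integral_mono (hint m).norm (φ.integrable.norm.const_mul _) fun x => ?_
      simp only [norm_mul]
      exact mul_le_mul_of_nonneg_right (hle m x) (norm_nonneg _)
    have h1 := hasSum_integral_of_summable_integral_norm hint hsum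
    have h2 := h1.comp (tendsto_piFinset_range d)
    have h3 := ((map_continuous f).tendsto φ).comp (R.tendsto_sum_convolution φ)
    refine tendsto_nhds_unique h3 ?_
    simp_rw [tsum_mul_right] at h2
    refine h2.congr fun N => ?_
    simp only [Function.comp_apply, map_sum, R.integral_piece_mul]

end BandResolution

/-! ### Absolutely convergent sums over the integer lattice -/

theorem sum_prod_le_tsum_pow {ι : Type*} {a : ι → ℝ} (h0 : ∀ i, 0 ≤ a i) (ha : Summable a) {d : ℕ}
    (u : Finset (Fin d → ι)) : ∑ m ∈ u, ∏ i, a (m i) ≤ (∑' j, a j) ^ d := by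
  classical
  have hu : u ⊆ Fintype.piFinset fun i : Fin d => u.image fun m => m i := fun m hm =>
    Fintype.mem_piFinset.mpr fun i => Finset.mem_image_of_mem _ hm
  calc ∑ m ∈ u, ∏ i, a (m i) ≤ ∑ m ∈ Fintype.piFinset fun i : Fin d => u.image fun m => m i,
        ∏ i, a (m i) := Finset.sum_le_sum_of_subset_of_nonneg hu fun _ _ _ =>
          Finset.prod_nonneg fun _ _ => h0 _
    _ = ∏ i : Fin d, ∑ j ∈ u.image fun m => m i, a j := (Finset.prod_univ_sum _ _).symm
    _ ≤ ∏ _i : Fin d, ∑' j, a j := Finset.prod_le_prod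
        (fun _ _ => Finset.sum_nonneg fun _ _ => h0 _) fun _ _ => ha.sum_le_tsum _ fun _ _ => h0 _
    _ = _ := by rw [Finset.prod_const, Finset.card_univ, Fintype.card_fin]

theorem summable_prod_pi {ι : Type*} {a : ι → ℝ} (h0 : ∀ i, 0 ≤ a i) (ha : Summable a) {d : ℕ} :
    Summable fun m : Fin d → ι => ∏ i, a (m i) :=
  summable_of_sum_le (fun _ => Finset.prod_nonneg fun _ _ => h0 _) (sum_prod_le_tsum_pow h0 ha)

theorem summable_inv_one_add_sq : Summable fun k : ℤ => (1 + (k : ℝ) ^ 2)⁻¹ := by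
  refine Summable.of_norm_bounded_eventually (Real.summable_one_div_int_pow.mpr one_lt_two) ?_
  filter_upwards [(Set.finite_singleton (0 : ℤ)).compl_mem_cofinite] with k hk
  have hk0 : (0 : ℝ) < (k : ℝ) ^ 2 := by
    have : (k : ℝ) ≠ 0 := Int.cast_ne_zero.mpr hk
    positivity
  rw [Real.norm_of_nonneg (by positivity), one_div]
  exact inv_anti₀ hk0 (by linarith)

theorem summable_prod_inv_one_add_sq (d : ℕ) :
    Summable fun k : Fin d → ℤ => ∏ i, (1 + (k i : ℝ) ^ 2)⁻¹ :=
  summable_prod_pi (a := fun k : ℤ => (1 + (k : ℝ) ^ 2)⁻¹) (fun _ => by positivity)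
    summable_inv_one_add_sq

theorem inv_one_add_sq_add_le {ρ : ℝ} {x k : ℝ} (hx : |x| ≤ ρ) :
    (1 + (x + k) ^ 2)⁻¹ ≤ (2 + 2 * ρ ^ 2) * (1 + k ^ 2)⁻¹ := by
  rw [← div_eq_mul_inv, le_div_iff₀ (by positivity), inv_mul_le_iff₀ (by positivity)]
  have h : x ^ 2 ≤ ρ ^ 2 := sq_le_sq.mpr (hx.trans (le_abs_self ρ))
  nlinarith [sq_nonneg (x + k + x), mul_nonneg (sq_nonneg ρ) (sq_nonneg (x + k)), sq_nonneg (2 * x + k)]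

/-! ### Poisson summation -/

section Poisson

variable {d : ℕ}

/-- The half-open cube `∏ (k_i, k_i + 1]`. -/
def unitCell (k : Fin d → ℤ) : Set (Fin d → ℝ) := {x | ∀ i, x i ∈ Set.Ioc (k i : ℝ) (k i + 1)}

theorem measurableSet_unitCell (k : Fin d → ℤ) : MeasurableSet (unitCell k) := by
  have : unitCell k = Set.univ.pi fun i => Set.Ioc (k i : ℝ) (k i + 1) := by
    ext x
    simp [unitCell]
  rw [this]
  exact MeasurableSet.univ_pi fun _ => measurableSet_Ioc

theorem mem_unitCell_iff (k : Fin d → ℤ) (x : Fin d → ℝ) :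
    x ∈ unitCell k ↔ k = fun i => ⌈x i⌉ - 1 := by
  rw [funext_iff]
  refine forall_congr' fun i => ?_
  rw [Set.mem_Ioc, eq_sub_iff_add_eq, eq_comm, Int.ceil_eq_iff]
  push_cast
  rw [add_sub_cancel_right]

theorem pairwise_disjoint_unitCell : Pairwise (Function.onFun Disjoint (unitCell (d := d))) := by
  intro k l hkl
  refine Set.disjoint_left.mpr fun x hk hl => hkl ?_
  rw [mem_unitCell_iff] at hk hl
  rw [hk, hl]

theorem iUnion_unitCell : ⋃ k, unitCell (d := d) k = Set.univ :=
  Set.eq_univ_of_forall fun x => Set.mem_iUnion.mpr ⟨_, (mem_unitCell_iff _ x).mpr rfl⟩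

theorem setIntegral_unitCell_add (φ : (Fin d → ℝ) → ℂ) (k : Fin d → ℤ) :
    ∫ x in unitCell 0, φ (x + fun i => (k i : ℝ)) = ∫ x in unitCell k, φ x := by
  have h := (measurePreserving_add_right (volume : Measure (Fin d → ℝ))
    fun i => (k i : ℝ)).setIntegral_preimage_emb (measurableEmbedding_addRight _) φ (unitCell k)
  rw [← h]
  congr 2
  ext x
  refine forall_congr' fun i => ?_
  simp only [Pi.zero_apply, Int.cast_zero, Set.mem_Ioc, Pi.add_apply]
  constructor <;> rintro ⟨h1, h2⟩ <;> constructor <;> linarith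

theorem mFourier_coe (n : Fin d → ℤ) (x : Fin d → ℝ) :
    UnitAddTorus.mFourier n (fun i => (x i : UnitAddCircle)) =
      Complex.exp (2 * Real.pi * Complex.I * ∑ i, (n i : ℝ) * x i) := by
  simp only [UnitAddTorus.mFourier, ContinuousMap.coe_mk, fourier_coe_apply]
  rw [← Complex.exp_sum]
  congr 1
  push_cast
  rw [Finset.mul_sum]
  refine Finset.sum_congr rfl fun i _ => ?_
  ring

theorem exp_add_int (n k : Fin d → ℤ) (x : Fin d → ℝ) :
    Complex.exp (2 * Real.pi * Complex.I * ∑ i, (n i : ℝ) * (x + fun i => (k i : ℝ)) i) =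
      Complex.exp (2 * Real.pi * Complex.I * ∑ i, (n i : ℝ) * x i) := by
  have h : (2 * Real.pi * Complex.I * ∑ i, (n i : ℝ) * (x + fun i => (k i : ℝ)) i : ℂ) =
      2 * Real.pi * Complex.I * ∑ i, (n i : ℝ) * x i +
        ((∑ i, n i * k i : ℤ) : ℂ) * (2 * Real.pi * Complex.I) := by
    push_cast
    simp only [Pi.add_apply, Complex.ofReal_add, mul_add, Finset.sum_add_distrib,
      Complex.ofReal_intCast]
    ring
  rw [h, Complex.exp_add, Complex.exp_int_mul_two_pi_mul_I, mul_one]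

/-- The periodisation of h descends to a continuous function on the torus. Unfolding over the unit
cells identifies its Fourier coefficients with values of the Fourier transform of h, and the
summable Fourier series is evaluated at 0. -/
theorem tsum_int_eq_tsum_fourier {h : (Fin d → ℝ) → ℂ} (hc : Continuous h) (hi : Integrable h)
    {C : ℝ} (hdec : ∀ x, ‖h x‖ ≤ C * ∏ i, (1 + x i ^ 2)⁻¹)
    (hsum : Summable fun n : Fin d → ℤ => ∫ x : Fin d → ℝ,
      Complex.exp (2 * Real.pi * Complex.I * ∑ i, ((-n) i : ℝ) * x i) * h x) :
    ∑' k : Fin d → ℤ, h (fun i => (k i : ℝ)) = ∑' n : Fin d → ℤ, ∫ x : Fin d → ℝ,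
      Complex.exp (2 * Real.pi * Complex.I * ∑ i, ((-n) i : ℝ) * x i) * h x := by
  have hC : 0 ≤ C := by
    have h0 := (norm_nonneg _).trans (hdec 0)
    simpa using h0
  -- local uniform bounds
  have hloc : ∀ ρ : ℝ, ∀ x : Fin d → ℝ, (∀ i, |x i| ≤ ρ) → ∀ k : Fin d → ℤ,
      ‖h (x + fun i => (k i : ℝ))‖ ≤ C * (2 + 2 * ρ ^ 2) ^ d * ∏ i, (1 + (k i : ℝ) ^ 2)⁻¹ := by
    intro ρ x hx k
    refine (hdec _).trans ?_
    rw [mul_assoc]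
    refine mul_le_mul_of_nonneg_left ?_ hC
    calc _ ≤ ∏ i, ((2 + 2 * ρ ^ 2) * (1 + (k i : ℝ) ^ 2)⁻¹) :=
          Finset.prod_le_prod (fun _ _ => by positivity) fun i _ => inv_one_add_sq_add_le (hx i)
      _ = _ := by
          rw [Finset.prod_mul_distrib, Finset.prod_const, Finset.card_univ, Fintype.card_fin]
  have hlocs : ∀ ρ : ℝ, Summable fun k : Fin d → ℤ =>
      C * (2 + 2 * ρ ^ 2) ^ d * ∏ i, (1 + (k i : ℝ) ^ 2)⁻¹ := fun ρ =>
    (summable_prod_inv_one_add_sq d).mul_left _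
  set F : (Fin d → ℝ) → ℂ := fun x => ∑' k : Fin d → ℤ, h (x + fun i => (k i : ℝ)) with hF
  have hFc : Continuous F := by
    rw [continuous_iff_continuousAt]
    intro x₀
    have hcb : ContinuousOn F (Metric.ball 0 (‖x₀‖ + 1)) := by
      refine continuousOn_tsum (fun k => (hc.comp (continuous_id.add continuous_const)).continuousOn)
        (hlocs (‖x₀‖ + 1)) fun k x hx => hloc _ x (fun i => ?_) k
      rw [mem_ball_zero_iff] at hx
      exact (norm_le_pi_norm x i).trans hx.le
    exact hcb.continuousAt (Metric.isOpen_ball.mem_nhds (by simp))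
  have hFper : ∀ (x : Fin d → ℝ) (k : Fin d → ℤ), F (x + fun i => (k i : ℝ)) = F x := by
    intro x k
    simp only [hF]
    rw [← (Equiv.addLeft k).tsum_eq fun l : Fin d → ℤ => h (x + fun i => (l i : ℝ))]
    refine tsum_congr fun l => ?_
    congr 1
    ext i
    simp only [Pi.add_apply, Equiv.coe_addLeft, Int.cast_add]
    ring
  let F' : C(Fin d → ℝ, ℂ) := ⟨F, hFc⟩
  let q : C(Fin d → ℝ, UnitAddTorus (Fin d)) :=
    ⟨Pi.map fun _ t => (t : UnitAddCircle),
      Continuous.piMap fun _ => AddCircle.continuous_mk' (1 : ℝ)⟩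
  have hq : Topology.IsQuotientMap q :=
    (IsOpenQuotientMap.piMap fun _ : Fin d => QuotientAddGroup.isOpenQuotientMap_mk
      (N := AddSubgroup.zmultiples (1 : ℝ))).isQuotientMap
  have hfac : Function.FactorsThrough F' q := by
    intro x y hxy
    have : ∀ i, ∃ n : ℤ, x i = y i + n := fun i => by
      have h1 : (x i : UnitAddCircle) = y i := congrFun hxy i
      obtain ⟨n, hn⟩ := AddSubgroup.mem_zmultiples_iff.mp (QuotientAddGroup.eq_iff_sub_mem.mp h1)
      refine ⟨n, ?_⟩
      rw [zsmul_one] at hn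
      rw [hn]
      ring
    choose n hn using this
    change F x = F y
    rw [← hFper y n]
    congr 1
    ext i
    exact hn i
  let G : C(UnitAddTorus (Fin d), ℂ) := hq.lift F' hfac
  have hG : ∀ x : Fin d → ℝ, G (fun i => (x i : UnitAddCircle)) = F x := fun x =>
    DFunLike.congr_fun (hq.lift_comp F' hfac) x
  have hcoeff : ∀ n, UnitAddTorus.mFourierCoeff G n = ∫ x : Fin d → ℝ,
      Complex.exp (2 * Real.pi * Complex.I * ∑ i, ((-n) i : ℝ) * x i) * h x := by
    intro n
    set e : (Fin d → ℝ) → ℂ := fun x =>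
      Complex.exp (2 * Real.pi * Complex.I * ∑ i, (((-n) i : ℤ) : ℝ) * x i) with he
    have hen : ∀ x, ‖e x‖ = 1 := fun x => by
      have : (2 * Real.pi * Complex.I * (∑ i, (((-n) i : ℤ) : ℝ) * x i : ℝ) : ℂ) =
        ((2 * Real.pi * ∑ i, (((-n) i : ℤ) : ℝ) * x i : ℝ) : ℂ) * Complex.I := by
        push_cast
        ring
      simp only [he]
      rw [this, Complex.norm_exp_ofReal_mul_I]
    have hec : Continuous e := by fun_prop
    have hei : Integrable fun x => e x * h x :=
      hi.bdd_mul hec.aestronglyMeasurable (Filter.Eventually.of_forall fun x => (hen x).le)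
    have hset : {x : Fin d → ℝ | ∀ i, x i ∈ Set.Ioc ((0 : Fin d → ℝ) i) ((0 : Fin d → ℝ) i + 1)} =
        unitCell 0 := by
      ext x
      simp [unitCell]
    rw [UnitAddTorus.mFourierCoeff_eq_integral G n 0, hset]
    simp_rw [mFourier_coe, hG, smul_eq_mul]
    have hfin : volume (unitCell (0 : Fin d → ℤ)) < ⊤ := by
      refine lt_of_le_of_lt (measure_mono (t := Metric.closedBall 0 1) fun x hx => ?_)
        measure_closedBall_lt_top
      rw [mem_closedBall_zero_iff, pi_norm_le_iff_of_nonneg zero_le_one]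
      intro i
      have := hx i
      simp only [Pi.zero_apply, Int.cast_zero, zero_add, Set.mem_Ioc] at this
      rw [Real.norm_eq_abs, abs_le]
      constructor <;> linarith
    have hcell : ∀ x ∈ unitCell (0 : Fin d → ℤ), ∀ i, |x i| ≤ 1 := fun x hx i => by
      have := hx i
      simp only [Pi.zero_apply, Int.cast_zero, zero_add, Set.mem_Ioc] at this
      rw [abs_le]
      constructor <;> linarith
    have : IsFiniteMeasure (volume.restrict (unitCell (0 : Fin d → ℤ))) :=
      ⟨by rwa [Measure.restrict_apply_univ]⟩
    have hae : ∀ k : Fin d → ℤ, ∀ᵐ x ∂(volume.restrict (unitCell (0 : Fin d → ℤ))),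
        ‖e x * h (x + fun i => (k i : ℝ))‖ ≤
          C * (2 + 2 * 1 ^ 2) ^ d * ∏ i, (1 + (k i : ℝ) ^ 2)⁻¹ := fun k =>
      (ae_restrict_iff' (measurableSet_unitCell 0)).mpr
        (Filter.Eventually.of_forall fun x hx => by
          rw [norm_mul, hen, one_mul]
          exact hloc 1 x (hcell x hx) k)
    have hik : ∀ k : Fin d → ℤ, Integrable (fun x => e x * h (x + fun i => (k i : ℝ)))
        (volume.restrict (unitCell 0)) := fun k =>
      Integrable.of_bound (hec.mul (hc.comp (continuous_id.add continuous_const))).aestronglyMeasurable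
        _ (hae k)
    have hs : Summable fun k : Fin d → ℤ => ∫ x in unitCell 0, ‖e x * h (x + fun i => (k i : ℝ))‖ := by
      refine Summable.of_nonneg_of_le (fun k => integral_nonneg fun x => norm_nonneg _) (fun k => ?_)
        ((hlocs 1).mul_left (volume.real (unitCell (0 : Fin d → ℤ))))
      refine (integral_mono_ae (hik k).norm (integrable_const _) (hae k)).trans (le_of_eq ?_)
      rw [integral_const, smul_eq_mul, measureReal_restrict_apply_univ]
    have h1 := hasSum_integral_of_summable_integral_norm hik hs
    have h2 := hasSum_integral_iUnion measurableSet_unitCell pairwise_disjoint_unitCell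
      (hei.integrableOn (s := ⋃ k, unitCell (d := d) k))
    rw [iUnion_unitCell, Measure.restrict_univ] at h2
    have h3 : ∀ k : Fin d → ℤ, ∫ x in unitCell 0, e x * h (x + fun i => (k i : ℝ)) =
        ∫ x in unitCell k, e x * h x := fun k => by
      rw [← setIntegral_unitCell_add (fun x => e x * h x) k]
      simp only [he, exp_add_int]
    simp_rw [h3] at h1
    have h4 := h1.unique h2
    simp only [tsum_mul_left] at h4
    exact h4.trans (by simp [he])
  have hsG : Summable (UnitAddTorus.mFourierCoeff G) := by
    rw [funext hcoeff]
    exact hsum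
  have hfinal := UnitAddTorus.hasSum_mFourier_series_apply_of_summable hsG
    (fun i => ((0 : Fin d → ℝ) i : UnitAddCircle))
  rw [hG] at hfinal
  simp only [mFourier_coe, hcoeff] at hfinal
  have h5 := hfinal.tsum_eq
  simp only [hF, zero_add] at h5
  rw [← h5]
  refine tsum_congr fun n => ?_
  simp

end Poisson

/-! ### Poisson summation over lattices -/

section LatticePoisson

variable {d : ℕ}

theorem SchwartzMap.exists_norm_le_prod (u : 𝓢(Eu d, ℂ)) :
    ∃ C : ℝ, ∀ x, ‖u x‖ ≤ C * ∏ i, (1 + x i ^ 2)⁻¹ := by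
  refine ⟨2 ^ (2 * d) * (Finset.Iic ((2 * d, 0) : ℕ × ℕ)).sup
    (fun m => SchwartzMap.seminorm ℂ m.1 m.2) u, fun x => ?_⟩
  have h := SchwartzMap.one_add_le_sup_seminorm_apply (𝕜 := ℂ) (m := (2 * d, 0)) le_rfl le_rfl u x
  rw [norm_iteratedFDeriv_zero] at h
  rw [Finset.prod_inv_distrib, ← div_eq_mul_inv,
    le_div_iff₀ (Finset.prod_pos fun _ _ => by positivity), mul_comm]
  refine le_trans (mul_le_mul_of_nonneg_right ?_ (norm_nonneg _)) h
  rw [pow_mul]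
  calc ∏ i, (1 + x i ^ 2) ≤ ∏ _i : Fin d, (1 + ‖x‖) ^ 2 := by
        refine Finset.prod_le_prod (fun _ _ => by positivity) fun i _ => ?_
        have h1 : |x i| ≤ ‖x‖ := PiLp.norm_apply_le x i
        nlinarith [sq_abs (x i), abs_nonneg (x i)]
    _ = _ := by rw [Finset.prod_const, Finset.card_univ, Fintype.card_fin]

/-- The linear automorphism of `ℝ^d` given by an invertible matrix. -/
def Matrix.euclideanCLE (T : Matrix (Fin d) (Fin d) ℝ) (hT : T.det ≠ 0) : Eu d ≃L[ℝ] Eu d :=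
  ContinuousLinearEquiv.equivOfInverse (Matrix.toEuclideanCLM (𝕜 := ℝ) T)
    (Matrix.toEuclideanCLM (𝕜 := ℝ) T⁻¹)
    (fun x => by
      rw [← mul_apply_eq_comp, ← map_mul,
        Matrix.nonsing_inv_mul _ (isUnit_iff_ne_zero.mpr hT), map_one]
      rfl)
    (fun x => by
      rw [← mul_apply_eq_comp, ← map_mul,
        Matrix.mul_nonsing_inv _ (isUnit_iff_ne_zero.mpr hT), map_one]
      rfl)

/-- The function `x ↦ u(T x + v)`. -/
def SchwartzMap.compAffine (u : 𝓢(Eu d, ℂ)) (T : Matrix (Fin d) (Fin d) ℝ) (hT : T.det ≠ 0)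
    (v : Eu d) : 𝓢(Eu d, ℂ) :=
  SchwartzMap.compCLMOfContinuousLinearEquiv ℂ (T.euclideanCLE hT) (u.compSubConstCLM ℂ (-v))

theorem SchwartzMap.compAffine_toLp (u : 𝓢(Eu d, ℂ)) (T : Matrix (Fin d) (Fin d) ℝ)
    (hT : T.det ≠ 0) (v : Eu d) (x : Fin d → ℝ) :
    u.compAffine T hT v (WithLp.toLp 2 x) = u (WithLp.toLp 2 (T.mulVec x) + v) := by
  rw [← sub_neg_eq_add]
  rfl

theorem summable_norm_lattice (u : 𝓢(Eu d, ℂ)) {T : Matrix (Fin d) (Fin d) ℝ} (hT : T.det ≠ 0)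
    (v : Eu d) : Summable fun k : Fin d → ℤ => ‖u (latPt T k + v)‖ := by
  obtain ⟨C, hC⟩ := (u.compAffine T hT v).exists_norm_le_prod
  refine Summable.of_nonneg_of_le (fun _ => norm_nonneg _) (fun k => ?_)
    ((summable_prod_inv_one_add_sq d).mul_left C)
  have h := hC (WithLp.toLp 2 fun i => (k i : ℝ))
  rwa [SchwartzMap.compAffine_toLp] at h

theorem integral_comp_mulVec {T : Matrix (Fin d) (Fin d) ℝ} (hT : T.det ≠ 0)
    {Φ : (Fin d → ℝ) → ℂ} (hΦ : Continuous Φ) :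
    ∫ x, Φ (T.mulVec x) = (|T.det|⁻¹ : ℝ) * ∫ z, Φ z := by
  have h := Real.map_matrix_volume_pi_eq_smul_volume_pi hT
  have h1 := integral_map (μ := (volume : Measure (Fin d → ℝ))) (φ := Matrix.toLin' T)
    (LinearMap.continuous_of_finiteDimensional _).aemeasurable
    (f := Φ) hΦ.aestronglyMeasurable
  rw [h, integral_smul_measure, ENNReal.toReal_ofReal (abs_nonneg _), abs_inv] at h1
  simp only [Matrix.toLin'_apply] at h1
  rw [← h1, Complex.real_smul]

theorem integral_toLp (Φ : Eu d → ℂ) : ∫ z : Fin d → ℝ, Φ (WithLp.toLp 2 z) = ∫ z, Φ z :=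
  ((PiLp.volume_preserving_ofLp (Fin d)).integral_comp
    (MeasurableEquiv.toLp 2 (Fin d → ℝ)).symm.measurableEmbedding
    fun y : Fin d → ℝ => Φ (WithLp.toLp 2 y)).symm

theorem fourier_comp_add (u : Eu d → ℂ) (v b : Eu d) :
    𝓕 (fun z => u (z + v)) b = Real.fourierChar (inner ℝ b v) * 𝓕 u b := by
  rw [Real.fourier_eq, Real.fourier_eq]
  rw [← integral_sub_right_eq_self _ v, ← integral_const_mul]
  refine integral_congr_ae (Filter.Eventually.of_forall fun z => ?_)
  simp only [sub_add_cancel, Circle.smul_def, smul_eq_mul]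
  rw [← mul_assoc, ← Circle.coe_mul, ← AddChar.map_add_eq_mul]
  congr 3
  rw [inner_sub_left, real_inner_comm v b]
  ring

theorem latPt_inner_dual {T : Matrix (Fin d) (Fin d) ℝ} (hT : T.det ≠ 0) (n : Fin d → ℤ)
    (x : Fin d → ℝ) :
    inner ℝ (WithLp.toLp 2 (T.mulVec x) : Eu d) (latPt T⁻¹.transpose n) = ∑ i, (n i : ℝ) * x i := by
  have h : inner ℝ (WithLp.toLp 2 (T.mulVec x) : Eu d) (latPt T⁻¹.transpose n) =
      dotProduct (T⁻¹.transpose.mulVec fun i => (n i : ℝ)) (T.mulVec x) := by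
    simp [latPt, EuclideanSpace.inner_toLp_toLp]
  rw [h, Matrix.mulVec_transpose, ← Matrix.dotProduct_mulVec, Matrix.mulVec_mulVec,
    Matrix.nonsing_inv_mul _ (isUnit_iff_ne_zero.mpr hT), Matrix.one_mulVec]
  rfl

/-- The substitution z = T x turns the integer frequency n into the dual lattice point, by
`latPt_inner_dual`; the shift v becomes a phase. -/
theorem fourier_coeff_compAffine (u : 𝓢(Eu d, ℂ)) {T : Matrix (Fin d) (Fin d) ℝ} (hT : T.det ≠ 0)
    (v : Eu d) (n : Fin d → ℤ) :
    ∫ x : Fin d → ℝ, Complex.exp (2 * Real.pi * Complex.I * ∑ i, ((-n) i : ℝ) * x i) *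
      u.compAffine T hT v (WithLp.toLp 2 x) = (|T.det|⁻¹ : ℝ) *
        (Real.fourierChar (inner ℝ (latPt T⁻¹.transpose n) v) * 𝓕 u (latPt T⁻¹.transpose n)) := by
  set b := latPt T⁻¹.transpose n with hb
  have h1 := integral_comp_mulVec hT (Φ := fun z =>
    (Real.fourierChar (-inner ℝ (WithLp.toLp 2 z : Eu d) b) : ℂ) * u (WithLp.toLp 2 z + v))
    (by
      have hz : Continuous fun z : Fin d → ℝ => (WithLp.toLp 2 z : Eu d) :=
        PiLp.continuous_toLp 2 _
      exact (continuous_subtype_val.comp (Real.continuous_fourierChar.comp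
        (hz.inner continuous_const).neg)).mul (u.continuous.comp (hz.add continuous_const)))
  rw [integral_toLp fun z => (Real.fourierChar (-inner ℝ z b) : ℂ) * u (z + v)] at h1
  have h2 := fourier_comp_add u v b
  rw [Real.fourier_eq] at h2
  simp only [Circle.smul_def, smul_eq_mul] at h2
  rw [h2] at h1
  rw [SchwartzMap.fourier_coe, ← h1]
  refine integral_congr_ae (Filter.Eventually.of_forall fun x => ?_)
  simp only [SchwartzMap.compAffine_toLp]
  congr 1
  rw [hb, latPt_inner_dual hT, Real.fourierChar_apply]
  congr 1
  push_cast
  simp only [Pi.neg_apply, Int.cast_neg, neg_mul, Finset.sum_neg_distrib]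
  ring

theorem det_inv_transpose_ne_zero {T : Matrix (Fin d) (Fin d) ℝ} (hT : T.det ≠ 0) :
    T⁻¹.transpose.det ≠ 0 := by
  rw [Matrix.det_transpose, Matrix.det_nonsing_inv]
  simpa using hT

/-- Poisson summation over the lattice generated by `T`. -/
theorem tsum_lattice_eq (u : 𝓢(Eu d, ℂ)) {T : Matrix (Fin d) (Fin d) ℝ} (hT : T.det ≠ 0)
    (v : Eu d) : ∑' k : Fin d → ℤ, u (latPt T k + v) = (|T.det|⁻¹ : ℝ) * ∑' n : Fin d → ℤ,
      Real.fourierChar (inner ℝ (latPt T⁻¹.transpose n) v) * 𝓕 u (latPt T⁻¹.transpose n) := by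
  obtain ⟨C, hC⟩ := (u.compAffine T hT v).exists_norm_le_prod
  have hs : Summable fun n : Fin d → ℤ => (Real.fourierChar (inner ℝ (latPt T⁻¹.transpose n) v) : ℂ) *
      𝓕 u (latPt T⁻¹.transpose n) := by
    refine Summable.of_norm ?_
    have := summable_norm_lattice (𝓕 u) (det_inv_transpose_ne_zero hT) 0
    simp_rw [add_zero] at this
    refine this.congr fun n => ?_
    rw [norm_mul, Circle.norm_coe, one_mul]
  have h := tsum_int_eq_tsum_fourier (h := fun x => u.compAffine T hT v (WithLp.toLp 2 x))
    ((u.compAffine T hT v).continuous.comp (PiLp.continuous_toLp 2 _))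
    (((PiLp.volume_preserving_toLp (Fin d)).integrable_comp_emb
      (MeasurableEquiv.toLp 2 (Fin d → ℝ)).measurableEmbedding).mpr
        (u.compAffine T hT v).integrable) (fun x => hC _)
    (by
      simp_rw [fourier_coeff_compAffine]
      exact hs.mul_left _)
  simp_rw [fourier_coeff_compAffine] at h
  rw [tsum_mul_left] at h
  rw [← h]
  exact tsum_congr fun k => (u.compAffine_toLp T hT v _).symm

end LatticePoisson

/-! ### Counting lattice points in cubes -/

section Count

variable {d : ℕ}

/-- The closed cube `[-r, r]^d`. -/
def bigCube (d : ℕ) (r : ℝ) : Set (Eu d) := {x | ∀ i, |x i| ≤ r}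

theorem isClosed_bigCube (r : ℝ) : IsClosed (bigCube d r) := by
  simp only [bigCube, Set.ofPred_forall]
  exact isClosed_iInter fun i => isClosed_le (by fun_prop) continuous_const

theorem volume_bigCube {r : ℝ} (hr : 0 ≤ r) :
    volume (bigCube d r) = ENNReal.ofReal ((2 * r) ^ d) := by
  have h : bigCube d r = (WithLp.ofLp : Eu d → Fin d → ℝ) ⁻¹' (Set.univ.pi fun _ => Set.Icc (-r) r) := by
    ext x
    simp only [bigCube, Set.mem_ofPred_eq, abs_le, Set.mem_preimage, Set.mem_univ_pi, Set.mem_Icc]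
  rw [h, (PiLp.volume_preserving_ofLp (Fin d)).measure_preimage
    (MeasurableSet.univ_pi fun _ => measurableSet_Icc).nullMeasurableSet, volume_pi_pi]
  simp only [Real.volume_Icc, Finset.prod_const, Finset.card_univ, Fintype.card_fin]
  rw [← ENNReal.ofReal_pow (by linarith)]
  congr 2
  ring

theorem IsAdmissible.exists_finset_bigCube (hd : 1 ≤ d) {T : Matrix (Fin d) (Fin d) ℝ} {v : ℝ}
    (hv : 0 < v) (hT : IsAdmissible T v) {r : ℝ} (hr : 0 ≤ r) (u : Eu d) :
    ∃ s : Finset (Fin d → ℤ), (∀ l, latPt T l - u ∈ bigCube d r ↔ l ∈ s) ∧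
      (s.card : ℝ) ≤ (2 * r) ^ d / v + 2 := by
  obtain ⟨s, hs, hcard⟩ := hT.exists_finset hd hv (fun i => u i - r) (fun _ => 2 * r)
    (fun _ => by positivity)
  refine ⟨s, fun l => ?_, by simpa using hcard⟩
  rw [← Finset.mem_coe, hs]
  refine forall_congr' fun i => ?_
  rw [PiLp.sub_apply, abs_le, Set.mem_Icc]
  constructor <;> rintro ⟨h1, h2⟩ <;> constructor <;> linarith

theorem IsAdmissible.tsum_indicator_le (hd : 1 ≤ d) {T : Matrix (Fin d) (Fin d) ℝ} {v : ℝ}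
    (hv : 0 < v) (hT : IsAdmissible T v) {r : ℝ} (hr : 0 ≤ r) (u : Eu d) :
    ∑' l, (bigCube d r).indicator (fun _ => (1 : ℝ≥0∞)) (latPt T l - u) ≤
      ENNReal.ofReal ((2 * r) ^ d / v + 2) := by
  obtain ⟨s, hs, hcard⟩ := hT.exists_finset_bigCube hd hv hr u
  rw [tsum_eq_sum (s := s) fun l hl => Set.indicator_of_notMem (fun h => hl ((hs l).mp h)) _]
  calc _ ≤ ∑ _l ∈ s, (1 : ℝ≥0∞) :=
        Finset.sum_le_sum fun l _ => Set.indicator_le_self (bigCube d r) (fun _ => (1 : ℝ≥0∞)) _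
    _ = ENNReal.ofReal s.card := by simp
    _ ≤ _ := ENNReal.ofReal_le_ofReal hcard

/-- After u = T l - y the left side is the integral of X(u) weighted by the number of l with T l - u
in Q. -/
theorem tsum_lintegral_lattice_le (T : Matrix (Fin d) (Fin d) ℝ) {Q : Set (Eu d)}
    (hQ : MeasurableSet Q) {A : ℝ≥0∞}
    (hA : ∀ u, ∑' l, Q.indicator (fun _ => (1 : ℝ≥0∞)) (latPt T l - u) ≤ A) {X : Eu d → ℝ≥0∞}
    (hX : Measurable X) : ∑' l, ∫⁻ y in Q, X (latPt T l - y) ≤ A * ∫⁻ u, X u := by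
  have h : ∀ l, ∫⁻ y in Q, X (latPt T l - y) =
      ∫⁻ u, Q.indicator (fun _ => (1 : ℝ≥0∞)) (latPt T l - u) * X u := fun l => by
    rw [← lintegral_indicator hQ, ← lintegral_sub_left_eq_self _ (latPt T l)]
    refine lintegral_congr fun u => ?_
    by_cases hu : latPt T l - u ∈ Q
    · simp [hu]
    · simp [hu]
  simp_rw [h]
  have hm : ∀ l, Measurable fun u => Q.indicator (fun _ => (1 : ℝ≥0∞)) (latPt T l - u) * X u :=
    fun l => ((measurable_const.indicator hQ).comp (measurable_const.sub measurable_id)).mul hX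
  rw [← lintegral_tsum fun l => (hm l).aemeasurable, ← lintegral_const_mul _ hX]
  refine lintegral_mono fun u => ?_
  simp only [ENNReal.tsum_mul_right]
  exact mul_le_mul_left (hA u) _

end Count

/-! ### The aliasing kernels -/

namespace BandResolution

variable {L : ℕ} {Ψ : LocalMeansKernel L} (R : BandResolution Ψ) {d : ℕ}

/-- `K_m(y) = ∑_{b ≠ 0} σ_m(b) e^{-2 π i ⟨b, y⟩}`, the sum being taken over the dual lattice. -/
def aliasKernel (T : Matrix (Fin d) (Fin d) ℝ) (m : Fin d → ℕ) (y : Eu d) : ℂ :=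
  ∑' k : Fin d → ℤ, if k = 0 then 0 else
    Real.fourierChar (inner ℝ (latPt T⁻¹.transpose k) (-y)) * R.symbol m (latPt T⁻¹.transpose k)

theorem norm_alias_term_le (T : Matrix (Fin d) (Fin d) ℝ) (φ : 𝓢(Eu d, ℂ)) (k : Fin d → ℤ)
    (y : Eu d) : ‖if k = 0 then (0 : ℂ) else
      Real.fourierChar (inner ℝ (latPt T⁻¹.transpose k) (-y)) * φ (latPt T⁻¹.transpose k)‖ ≤
      ‖φ (latPt T⁻¹.transpose k + 0)‖ := by
  split_ifs
  · simp
  · rw [norm_mul, Circle.norm_coe, one_mul, add_zero]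

theorem continuous_aliasKernel {T : Matrix (Fin d) (Fin d) ℝ} (hT : T.det ≠ 0) (m : Fin d → ℕ) :
    Continuous (R.aliasKernel T m) := by
  refine continuous_tsum (fun k => ?_)
    (summable_norm_lattice (R.symbol m) (det_inv_transpose_ne_zero hT) 0)
    fun k y => norm_alias_term_le T (R.symbol m) k y
  split_ifs
  · exact continuous_const
  · exact (continuous_subtype_val.comp (Real.continuous_fourierChar.comp
      (continuous_const.inner continuous_neg))).mul continuous_const

/-- Poisson summation with the frequency 0 removed. Counting dual points sees the sup norm of the
kernel; this primal form gives its L_1 bound. -/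
theorem aliasKernel_eq {T : Matrix (Fin d) (Fin d) ℝ} (hT : T.det ≠ 0) (m : Fin d → ℕ) (y : Eu d) :
    R.aliasKernel T m y = |T.det| * ∑' l, R.kernel m (latPt T l - y) - R.symbol m 0 := by
  simp_rw [sub_eq_add_neg _ y]
  rw [tsum_lattice_eq _ hT, ← mul_assoc, ← Complex.ofReal_mul,
    mul_inv_cancel₀ (abs_ne_zero.mpr hT), Complex.ofReal_one, one_mul, fourier_kernel,
    Summable.tsum_eq_add_tsum_ite (b := 0)]
  · simp [aliasKernel, latPt_zero]
  · refine Summable.of_norm ((summable_norm_lattice (R.symbol m)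
      (det_inv_transpose_ne_zero hT) 0).congr fun k => ?_)
    rw [norm_mul, Circle.norm_coe, one_mul, add_zero]

/-- The symbol is supported in the box |ξ_i| ≤ ρ 2^(m_i). A nonzero dual point there forces v ≤ ρ^d
2^|m|, whence the vanishing; otherwise the sup norm is at most a multiple of the number of dual
points in the box. -/
theorem exists_aliasKernel_bounds (hd : 1 ≤ d) : ∃ C : ℝ, 1 ≤ C ∧
    ∀ (T : Matrix (Fin d) (Fin d) ℝ) (v : ℝ), 0 < v → IsAdmissible T⁻¹.transpose v →
      ∀ (m : Fin d → ℕ), (∀ y, ‖R.aliasKernel T m y‖ ≤ C * (2 ^ (∑ i, m i) / v)) ∧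
        (C * 2 ^ (∑ i, m i) < v → ∀ y, R.aliasKernel T m y = 0) := by
  obtain ⟨C₁, hC₁, hsym⟩ := R.exists_symbol_bound d
  obtain ⟨ρ, hρ, hsupp⟩ := R.exists_symbol_support (d := d)
  have hρd : 1 ≤ ρ ^ d := one_le_pow₀ hρ
  have hbig : ρ ^ d ≤ C₁ * ((2 * ρ) ^ d + 2 * ρ ^ d) := by
    have h2 : ρ ^ d ≤ (2 * ρ) ^ d + 2 * ρ ^ d := by
      have : 0 ≤ (2 * ρ) ^ d := by positivity
      linarith
    exact h2.trans (le_mul_of_one_le_left (by positivity) hC₁)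
  refine ⟨C₁ * ((2 * ρ) ^ d + 2 * ρ ^ d), hρd.trans hbig, fun T v hv hT m => ?_⟩
  set B := T⁻¹.transpose
  have hprod : ∀ c : ℝ, ∏ i, (c * 2 ^ m i) = c ^ d * 2 ^ (∑ i, m i) := fun c => by
    rw [Finset.prod_mul_distrib, Finset.prod_const, Finset.card_univ, Fintype.card_fin,
      Finset.prod_pow_eq_pow_sum]
  have hlow : ∀ k : Fin d → ℤ, k ≠ 0 → R.symbol m (latPt B k) ≠ 0 → v ≤ ρ ^ d * 2 ^ (∑ i, m i) := by
    intro k hk hne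
    rw [← hprod]
    exact (hT k hk).trans (Finset.prod_le_prod (fun _ _ => abs_nonneg _)
      fun i _ => hsupp m _ hne i)
  have hzero : ρ ^ d * 2 ^ (∑ i, m i) < v → ∀ y, R.aliasKernel T m y = 0 := by
    intro hlt y
    refine (tsum_congr fun k => ?_).trans tsum_zero
    split_ifs with hk
    · rfl
    · by_contra hne
      exact absurd (hlow k hk (right_ne_zero_of_mul hne)) (not_le.mpr hlt)
  refine ⟨fun y => ?_, fun hlt => hzero (lt_of_le_of_lt
    (mul_le_mul_of_nonneg_right hbig (by positivity)) hlt)⟩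
  rcases lt_or_ge (ρ ^ d * 2 ^ (∑ i, m i)) v with hlt | hge
  · rw [hzero hlt, norm_zero]
    positivity
  obtain ⟨s, hs, hcard⟩ := hT.exists_finset hd hv (fun i => -(ρ * 2 ^ m i))
    (fun i => 2 * ρ * 2 ^ m i) (fun i => by positivity)
  have hout : ∀ k ∉ s, (if k = 0 then (0 : ℂ) else Real.fourierChar (inner ℝ (latPt B k) (-y)) *
      R.symbol m (latPt B k)) = 0 := by
    intro k hk
    split_ifs with h0
    · rfl
    · by_contra hne
      refine hk ?_
      rw [← Finset.mem_coe, hs]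
      intro i
      have := abs_le.mp (hsupp m _ (right_ne_zero_of_mul hne) i)
      exact ⟨this.1, by linarith [this.2]⟩
  rw [aliasKernel, tsum_eq_sum hout]
  -- In the remaining case v ≤ ρ^d 2^|m|, so the additive 2 of the point count is absorbed into the
  -- main term.
  have h2 : 2 ≤ 2 * ρ ^ d * (2 ^ (∑ i, m i) / v) := by
    rw [← mul_div_assoc, le_div_iff₀ hv]
    linarith
  calc _ ≤ ∑ _k ∈ s, C₁ := norm_sum_le_of_le _ fun k _ =>
        (norm_alias_term_le T (R.symbol m) k y).trans (hsym m _)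
    _ = C₁ * s.card := by rw [Finset.sum_const, nsmul_eq_mul, mul_comm]
    _ ≤ C₁ * ((∏ i, (2 * ρ * 2 ^ m i)) / v + 2) :=
        mul_le_mul_of_nonneg_left hcard (by linarith)
    _ ≤ C₁ * (((2 * ρ) ^ d + 2 * ρ ^ d) * (2 ^ (∑ i, m i) / v)) := by
        refine mul_le_mul_of_nonneg_left ?_ (by linarith)
        rw [hprod, add_mul, mul_div_assoc]
        linarith
    _ = _ := by ring

theorem exists_lintegral_aliasKernel_le (hd : 1 ≤ d) : ∃ C : ℝ, 1 ≤ C ∧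
    ∀ (T : Matrix (Fin d) (Fin d) ℝ) (v : ℝ), 0 < v → IsAdmissible T v → T.det ≠ 0 →
      ∀ (r : ℝ), 0 ≤ r → ∀ m : Fin d → ℕ, ∫⁻ y in bigCube d r, ‖R.aliasKernel T m y‖ₑ ≤
        ENNReal.ofReal (C * (|T.det| * ((2 * r) ^ d / v + 2) + (2 * r) ^ d)) := by
  obtain ⟨C₁, hC₁, hsym⟩ := R.exists_symbol_bound d
  obtain ⟨C₂, hC₂, -, hker⟩ := R.exists_kernel_bounds d
  refine ⟨max C₁ C₂, hC₁.trans (le_max_left _ _), fun T v hv hT hdet r hr m => ?_⟩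
  have hkm : Measurable fun u => ‖R.kernel m u‖ₑ := (R.kernel m).continuous.measurable.enorm
  have h1 := tsum_lintegral_lattice_le T (isClosed_bigCube (d := d) r).measurableSet
    (hT.tsum_indicator_le hd hv hr) hkm
  have h2 : ∫⁻ u, ‖R.kernel m u‖ₑ ≤ ENNReal.ofReal C₂ := by
    rw [← ofReal_integral_norm_eq_lintegral_enorm (R.kernel m).integrable]
    exact ENNReal.ofReal_le_ofReal (hker m)
  have hpt : ∀ y, ‖R.aliasKernel T m y‖ₑ ≤
      ENNReal.ofReal |T.det| * ∑' l, ‖R.kernel m (latPt T l - y)‖ₑ + ENNReal.ofReal C₁ := fun y => by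
    rw [R.aliasKernel_eq hdet]
    refine (enorm_sub_le).trans (add_le_add ?_ ?_)
    · rw [enorm_mul]
      refine mul_le_mul' (le_of_eq ?_) enorm_tsum_le_tsum_enorm
      rw [← ofReal_norm, Complex.norm_real, Real.norm_eq_abs, abs_abs]
    · rw [← ofReal_norm]
      exact ENNReal.ofReal_le_ofReal (hsym m 0)
  have hmeas : ∀ l, Measurable fun y => ‖R.kernel m (latPt T l - y)‖ₑ := fun l =>
    hkm.comp (measurable_const.sub measurable_id)
  calc ∫⁻ y in bigCube d r, ‖R.aliasKernel T m y‖ₑ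
      ≤ ∫⁻ y in bigCube d r, (ENNReal.ofReal |T.det| * ∑' l, ‖R.kernel m (latPt T l - y)‖ₑ +
          ENNReal.ofReal C₁) := lintegral_mono hpt
    _ = ENNReal.ofReal |T.det| * (∑' l, ∫⁻ y in bigCube d r, ‖R.kernel m (latPt T l - y)‖ₑ) +
          ENNReal.ofReal C₁ * ENNReal.ofReal ((2 * r) ^ d) := by
        rw [lintegral_add_right _ measurable_const,
          lintegral_const_mul _ (Measurable.tsum hmeas),
          lintegral_tsum fun l => (hmeas l).aemeasurable, lintegral_const,
          Measure.restrict_apply MeasurableSet.univ, Set.univ_inter, volume_bigCube hr]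
    _ ≤ ENNReal.ofReal |T.det| * (ENNReal.ofReal ((2 * r) ^ d / v + 2) * ENNReal.ofReal C₂) +
          ENNReal.ofReal C₁ * ENNReal.ofReal ((2 * r) ^ d) :=
        add_le_add (mul_le_mul_right (h1.trans (mul_le_mul_right h2 _)) _) le_rfl
    _ = ENNReal.ofReal (|T.det| * (((2 * r) ^ d / v + 2) * C₂) + C₁ * (2 * r) ^ d) := by
        rw [← ENNReal.ofReal_mul (by positivity), ← ENNReal.ofReal_mul (by positivity),
          ← ENNReal.ofReal_mul (by linarith), ← ENNReal.ofReal_add (by positivity) (by positivity)]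
    _ ≤ _ := by
        refine ENNReal.ofReal_le_ofReal ?_
        have e1 : |T.det| * ((2 * r) ^ d / v + 2) * C₂ ≤
            |T.det| * ((2 * r) ^ d / v + 2) * max C₁ C₂ :=
          mul_le_mul_of_nonneg_left (le_max_right _ _) (by positivity)
        have e2 : (2 * r) ^ d * C₁ ≤ (2 * r) ^ d * max C₁ C₂ :=
          mul_le_mul_of_nonneg_left (le_max_left _ _) (by positivity)
        linarith

end BandResolution

/-! ### The aliasing kernels of the Frolov lattices -/

/-- The determinant and the primal admissibility constant are of order 1/n and the dual one is of
order n, so the constants become uniform in n. -/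
theorem BandResolution.exists_frolov_aliasKernel_bounds {L d : ℕ} {Ψ : LocalMeansKernel L}
    (R : BandResolution Ψ) (hd : 1 ≤ d) {ξ : Fin d → ℝ} (hξ : IsFrolovRoots ξ) {r : ℝ}
    (hr : 0 ≤ r) : ∃ C : ℝ, 1 ≤ C ∧ ∀ n : ℕ, 1 ≤ n → ∀ m : Fin d → ℕ,
      (∀ y, ‖R.aliasKernel (frolovMatrix ξ n) m y‖ ≤ C * (2 ^ (∑ i, m i) / n)) ∧
      (C * 2 ^ (∑ i, m i) < n → ∀ y, R.aliasKernel (frolovMatrix ξ n) m y = 0) ∧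
      ∫⁻ y in bigCube d r, ‖R.aliasKernel (frolovMatrix ξ n) m y‖ₑ ≤ ENNReal.ofReal C := by
  obtain ⟨C₁, hC₁, h1⟩ := R.exists_aliasKernel_bounds hd
  obtain ⟨C₂, hC₂, h2⟩ := R.exists_lintegral_aliasKernel_le hd
  obtain ⟨c, hc, hdual⟩ := exists_isAdmissible_dual hd hξ
  set D := |(Matrix.vandermonde ξ).det|
  have hD : 0 < D := abs_pos.mpr (hξ.det_ne_zero hd)
  set C₃ := C₂ * ((2 * r) ^ d * D + 2 + (2 * r) ^ d)
  have hC₃ : 0 ≤ C₃ := by positivity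
  have hle : C₁ / c ≤ C₁ / c + C₁ + C₃ := by linarith
  have hpos : 0 ≤ C₁ / c := by positivity
  refine ⟨C₁ / c + C₁ + C₃, by linarith, fun n hn m => ?_⟩
  have hn0 : (0 : ℝ) < n := Nat.cast_pos.mpr hn
  have hn1 : (1 : ℝ) ≤ n := Nat.one_le_cast.mpr hn
  obtain ⟨h1a, h1b⟩ := h1 (frolovMatrix ξ n) (c * n) (by positivity) (hdual n hn) m
  have habs := abs_det_frolovMatrix hd hξ hn
  have hdet : (frolovMatrix ξ n).det ≠ 0 := by
    rw [← abs_pos, habs]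
    positivity
  refine ⟨fun y => (h1a y).trans ?_, fun hlt => h1b ?_, (h2 (frolovMatrix ξ n) _ (by positivity)
    (isAdmissible_frolovMatrix hd hξ hn) hdet r hr m).trans (ENNReal.ofReal_le_ofReal ?_)⟩
  · calc C₁ * (2 ^ (∑ i, m i) / (c * n)) = C₁ / c * (2 ^ (∑ i, m i) / n) := by
          field_simp
      _ ≤ _ := mul_le_mul_of_nonneg_right hle (by positivity)
  · have h3 : C₁ / c * 2 ^ (∑ i, m i) < n :=
      lt_of_le_of_lt (mul_le_mul_of_nonneg_right hle (by positivity)) hlt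
    rw [div_mul_eq_mul_div, div_lt_iff₀ hc] at h3
    linarith
  · rw [habs]
    have h4 : (n : ℝ)⁻¹ * ((2 * r) ^ d / (n * D)⁻¹ + 2) ≤ (2 * r) ^ d * D + 2 := by
      rw [div_inv_eq_mul, mul_add, mul_comm (n : ℝ) D, ← mul_assoc ((2 * r) ^ d), mul_comm _ (n : ℝ),
        inv_mul_cancel_left₀ hn0.ne']
      have : (n : ℝ)⁻¹ * 2 ≤ 2 := mul_le_of_le_one_left (by norm_num) (inv_le_one_of_one_le₀ hn1)
      linarith
    calc _ ≤ C₂ * (((2 * r) ^ d * D + 2) + (2 * r) ^ d) :=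
          mul_le_mul_of_nonneg_left (add_le_add h4 le_rfl) (by linarith)
      _ ≤ _ := by
          have : C₂ * (((2 * r) ^ d * D + 2) + (2 * r) ^ d) = C₃ := rfl
          linarith

/-! ### Functions supported in the unit cube -/

section Support

variable {d : ℕ}

/-- The fundamental lemma of the calculus of variations gives g = 0 almost everywhere on an open
neighbourhood of x, and continuity gives it everywhere there. -/
theorem IsContinuousRepresentative.eq_zero {f : 𝓢'(Eu d, ℂ)} {g : Eu d → ℂ}
    (h : IsContinuousRepresentative f g) {x : Eu d} (hx : x ∉ Distribution.dsupport f) :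
    g x = 0 := by
  rw [Distribution.notMem_dsupport_iff] at hx
  obtain ⟨U, hU, hopen, hxU⟩ := hx
  have hae := hopen.ae_eq_zero_of_integral_contDiff_smul_eq_zero (μ := volume) (f := g)
    (h.1.locallyIntegrable.locallyIntegrableOn U) fun φ hφ hc hsub => by
      have hc' : HasCompactSupport fun x => (φ x : ℂ) := hc.comp_left Complex.ofReal_zero
      have hφ' : ContDiff ℝ ∞ fun x => (φ x : ℂ) := Complex.ofRealCLM.contDiff.comp hφ
      have h1 := hU (hc'.toSchwartzMap hφ') <| by
        refine (closure_mono fun y hy => ?_).trans hsub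
        intro h0
        exact hy (by
          change ((φ y : ℝ) : ℂ) = 0
          rw [h0, Complex.ofReal_zero])
      rw [(h.2 _).2] at h1
      rw [← h1]
      refine integral_congr_ae (Filter.Eventually.of_forall fun y => ?_)
      change φ y • g y = g y * (φ y : ℂ)
      rw [Complex.real_smul, mul_comm]
  have heq : g =ᵐ[volume.restrict U] fun _ => 0 :=
    (ae_restrict_iff' hopen.measurableSet).mpr hae
  exact Measure.eqOn_open_of_ae_eq heq hopen h.1.continuousOn continuousOn_const hxU

theorem isCompact_bigCube (r : ℝ) : IsCompact (bigCube d r) := by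
  have h : bigCube d r = (PiLp.homeomorph 2 (fun _ : Fin d => ℝ)) ⁻¹'
      (Set.univ.pi fun _ => Set.Icc (-r) r) := by
    ext x
    simp only [bigCube, Set.mem_ofPred_eq, abs_le, Set.mem_preimage, Set.mem_univ_pi, Set.mem_Icc]
    rfl
  rw [h]
  exact (PiLp.homeomorph 2 (fun _ : Fin d => ℝ)).isCompact_preimage.mpr
    (isCompact_univ_pi fun _ => isCompact_Icc)

theorem unitCube_subset_bigCube : unitCube d ⊆ bigCube d 1 := fun x hx i =>
  abs_le.mpr ⟨by linarith [(hx i).1], (hx i).2⟩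

theorem LocalMeansKernel.exists_tensor_support {L : ℕ} (Ψ : LocalMeansKernel L) (d : ℕ) :
    ∃ ρ : ℝ, 1 ≤ ρ ∧ ∀ (m : Fin d → ℕ) (x : Eu d), Ψ.tensor m x ≠ 0 → x ∈ bigCube d ρ := by
  obtain ⟨ρ₀, h₀1, h₀⟩ := BandResolution.exists_abs_le_of_compactSupport Ψ.hasCompactSupport₀
  obtain ⟨ρ₁, h₁1, h₁⟩ := BandResolution.exists_abs_le_of_compactSupport Ψ.hasCompactSupport₁
  have hlev : ∀ j t, Ψ.level j t ≠ 0 → |t| ≤ max ρ₀ ρ₁ := fun j t ht => by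
    cases j with
    | zero => exact (h₀ t ht).trans (le_max_left _ _)
    | succ j =>
      have h := h₁ _ (right_ne_zero_of_mul ht)
      rw [abs_mul, abs_of_pos (by positivity : (0 : ℝ) < 2 ^ j)] at h
      exact ((le_mul_of_one_le_left (abs_nonneg t) (one_le_pow₀ one_le_two)).trans h).trans
        (le_max_right _ _)
  exact ⟨max ρ₀ ρ₁, h₀1.trans (le_max_left _ _), fun m x hx i =>
    hlev _ _ (Finset.prod_ne_zero_iff.mp hx i (Finset.mem_univ i))⟩

theorem LocalMeansKernel.conv_eq_integral {L : ℕ} (Ψ : LocalMeansKernel L) {f : 𝓢'(Eu d, ℂ)}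
    {g : Eu d → ℂ} (h : IsContinuousRepresentative f g) (m : Fin d → ℕ) (x : Eu d) :
    Ψ.conv m f x = ∫ y, g y * Ψ.tensor m (x - y) := (h.2 _).2

theorem LocalMeansKernel.conv_eq_zero {L : ℕ} (Ψ : LocalMeansKernel L) {f : 𝓢'(Eu d, ℂ)}
    {g : Eu d → ℂ} (h : IsContinuousRepresentative f g) (hg : ∀ x ∉ bigCube d 1, g x = 0)
    {ρ : ℝ} (hρ : ∀ (m : Fin d → ℕ) (x : Eu d), Ψ.tensor m x ≠ 0 → x ∈ bigCube d ρ)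
    (m : Fin d → ℕ) {x : Eu d} (hx : x ∉ bigCube d (1 + ρ)) : Ψ.conv m f x = 0 := by
  rw [Ψ.conv_eq_integral h]
  refine integral_eq_zero_of_ae (Filter.Eventually.of_forall fun y => ?_)
  by_contra hne
  have h1 : y ∈ bigCube d 1 := by
    by_contra hy
    exact left_ne_zero_of_mul hne (hg y hy)
  have h2 := hρ m _ (right_ne_zero_of_mul hne)
  refine hx fun i => ?_
  have h3 := h2 i
  rw [PiLp.sub_apply] at h3
  have h4 := abs_add_le (y i) (x i - y i)
  rw [add_sub_cancel] at h4
  linarith [h1 i]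

theorem LocalMeansKernel.fourier_conv {L : ℕ} (Ψ : LocalMeansKernel L) {f : 𝓢'(Eu d, ℂ)}
    {g : Eu d → ℂ} (h : IsContinuousRepresentative f g) (hg : Integrable g) (m : Fin d → ℕ)
    (b : Eu d) : 𝓕 (Ψ.conv m f) b = 𝓕 (Ψ.tensor m) b * 𝓕 g b := by
  have hconv : Ψ.conv m f = convolution g (Ψ.tensor m) (ContinuousLinearMap.mul ℂ ℂ) volume := by
    ext x
    exact Ψ.conv_eq_integral h m x
  rw [hconv, Real.fourier_mul_convolution_eq hg
    ((Ψ.tensor_contDiff m).continuous.integrable_of_hasCompactSupport (Ψ.tensor_hasCompactSupport m)),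
    mul_comm]

end Support

/-! ### Summation over the lattice and its dual -/

section Duality

variable {d : ℕ}

theorem integral_tsum_fourierChar_mul {ι : Type*} [Countable ι] {a : ι → ℂ}
    (ha : Summable fun k => ‖a k‖) (b : ι → Eu d) {g : Eu d → ℂ} (hg : Integrable g) :
    ∫ v, (∑' k, (Real.fourierChar (inner ℝ (b k) (-v)) : ℂ) * a k) * g v =
      ∑' k, a k * 𝓕 g (b k) := by
  have hcont : ∀ k, Continuous fun v : Eu d => (Real.fourierChar (inner ℝ (b k) (-v)) : ℂ) * a k :=
    fun k => (continuous_subtype_val.comp (Real.continuous_fourierChar.comp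
      (continuous_const.inner continuous_neg))).mul continuous_const
  have hnorm : ∀ k v, ‖(Real.fourierChar (inner ℝ (b k) (-v)) : ℂ) * a k‖ = ‖a k‖ := fun k v => by
    rw [norm_mul, Circle.norm_coe, one_mul]
  have hint : ∀ k, Integrable fun v => (Real.fourierChar (inner ℝ (b k) (-v)) : ℂ) * a k * g v :=
    fun k => hg.bdd_mul (hcont k).aestronglyMeasurable
      (Filter.Eventually.of_forall fun v => (hnorm k v).le)
  have hsum : Summable fun k =>
      ∫ v, ‖(Real.fourierChar (inner ℝ (b k) (-v)) : ℂ) * a k * g v‖ := by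
    refine (ha.mul_right (∫ v, ‖g v‖)).congr fun k => ?_
    rw [← integral_const_mul]
    refine integral_congr_ae (Filter.Eventually.of_forall fun v => ?_)
    simp only [norm_mul, Circle.norm_coe, one_mul]
  have h := (hasSum_integral_of_summable_integral_norm hint hsum).tsum_eq
  simp_rw [tsum_mul_right] at h
  rw [← h]
  refine tsum_congr fun k => ?_
  rw [Real.fourier_eq, ← integral_const_mul]
  refine integral_congr_ae (Filter.Eventually.of_forall fun v => ?_)
  simp only [Circle.smul_def, smul_eq_mul, inner_neg_right, real_inner_comm v (b k)]
  ring

theorem tsum_enorm_lattice_le (hd : 1 ≤ d) {T : Matrix (Fin d) (Fin d) ℝ} {v : ℝ} (hv : 0 < v)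
    (hT : IsAdmissible T v) {g : Eu d → ℂ} (hg0 : ∀ x ∉ bigCube d 1, g x = 0) {M : ℝ}
    (hM : ∀ x, ‖g x‖ ≤ M) (u : Eu d) :
    ∑' l, ‖g (latPt T l - u)‖ₑ ≤ ENNReal.ofReal M * ENNReal.ofReal ((2 * 1) ^ d / v + 2) := by
  refine le_trans ?_ (mul_le_mul_right (hT.tsum_indicator_le hd hv zero_le_one u) _)
  rw [← ENNReal.tsum_mul_left]
  refine ENNReal.tsum_le_tsum fun l => ?_
  by_cases hl : latPt T l - u ∈ bigCube d 1
  · rw [Set.indicator_of_mem hl, mul_one, ← ofReal_norm]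
    exact ENNReal.ofReal_le_ofReal (hM _)
  · rw [hg0 _ hl, enorm_zero]
    exact zero_le

theorem continuous_tsum_lattice (hd : 1 ≤ d) {T : Matrix (Fin d) (Fin d) ℝ} {v : ℝ} (hv : 0 < v)
    (hT : IsAdmissible T v) {g : Eu d → ℂ} (hg : Continuous g) (hg0 : ∀ x ∉ bigCube d 1, g x = 0)
    {M : ℝ} (hM : ∀ x, ‖g x‖ ≤ M) : Continuous fun u => ∑' l, g (latPt T l - u) := by
  have hM0 : 0 ≤ M := (norm_nonneg _).trans (hM 0)
  rw [continuous_iff_continuousAt]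
  intro u₀
  -- Radius 2 is 1 for the support of g plus 1 for the movement of u, so one finite index set serves
  -- the whole unit ball around u₀.
  obtain ⟨s, hs, -⟩ := hT.exists_finset_bigCube hd hv zero_le_two u₀
  have h : ContinuousOn (fun u => ∑' l, g (latPt T l - u)) (Metric.ball u₀ 1) := by
    refine continuousOn_tsum (u := fun l => if l ∈ s then M else 0)
      (fun l => (hg.comp (continuous_const.sub continuous_id)).continuousOn)
      (summable_of_ne_finset_zero (s := s) fun l hl => if_neg hl) fun l u hu => ?_
    split_ifs with hl
    · exact hM _
    · rw [hg0, norm_zero]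
      intro hmem
      refine hl ((hs l).mp fun i => ?_)
      have h1 := hmem i
      have h2 : |u i - u₀ i| ≤ 1 := by
        rw [Metric.mem_ball, dist_eq_norm] at hu
        exact (PiLp.norm_apply_le (u - u₀) i).trans hu.le
      rw [PiLp.sub_apply] at h1 ⊢
      have h3 := abs_add_le (latPt T l i - u i) (u i - u₀ i)
      rw [sub_add_sub_cancel] at h3
      linarith
  exact h.continuousAt (Metric.isOpen_ball.mem_nhds (by simp))

/-- A smoothed Poisson formula for g that is merely continuous: the reflection u ↦ T l - w moves the
lattice sum from g onto the Schwartz function 𝓕⁻φ, to which `tsum_lattice_eq` applies. -/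
theorem integral_mul_tsum_lattice (hd : 1 ≤ d) {T : Matrix (Fin d) (Fin d) ℝ} {v : ℝ} (hv : 0 < v)
    (hT : IsAdmissible T v) (hdet : T.det ≠ 0) {g : Eu d → ℂ} (hg : Continuous g)
    (hg0 : ∀ x ∉ bigCube d 1, g x = 0) {M : ℝ} (hM : ∀ x, ‖g x‖ ≤ M) (φ : 𝓢(Eu d, ℂ)) :
    ∫ u, 𝓕⁻ φ u * (|T.det| * ∑' l, g (latPt T l - u)) =
      ∑' k, φ (latPt T⁻¹.transpose k) * 𝓕 g (latPt T⁻¹.transpose k) := by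
  set X : 𝓢(Eu d, ℂ) := 𝓕⁻ φ with hX
  have hXφ : 𝓕 X = φ := FourierTransform.fourier_fourierInv_eq φ
  have hgi : Integrable g := hg.integrable_of_hasCompactSupport
    (HasCompactSupport.intro (isCompact_bigCube 1) hg0)
  have hint : ∀ l, Integrable fun u => X u * g (latPt T l - u) := fun l => by
    have := X.integrable (μ := volume).mul_bdd
      (hg.comp (continuous_const.sub continuous_id : Continuous fun u => latPt T l - u)).aestronglyMeasurable
      (Filter.Eventually.of_forall fun u => hM (latPt T l - u))
    exact this
  have hmeas : ∀ l, Measurable fun u => ‖X u * g (latPt T l - u)‖ₑ := fun l =>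
    (X.continuous.mul (hg.comp (continuous_const.sub continuous_id))).measurable.enorm
  have htot : ∑' l, ∫⁻ u, ‖X u * g (latPt T l - u)‖ₑ ≠ ⊤ := by
    rw [← lintegral_tsum fun l => (hmeas l).aemeasurable]
    refine ne_top_of_le_ne_top (b := ∫⁻ u, ‖X u‖ₑ * (ENNReal.ofReal M *
      ENNReal.ofReal ((2 * 1) ^ d / v + 2))) ?_ (lintegral_mono fun u => ?_)
    · rw [lintegral_mul_const _ X.continuous.measurable.enorm]
      exact ENNReal.mul_ne_top X.integrable.2.ne
        (ENNReal.mul_ne_top ENNReal.ofReal_ne_top ENNReal.ofReal_ne_top)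
    · simp_rw [enorm_mul, ENNReal.tsum_mul_left]
      exact mul_le_mul_right (tsum_enorm_lattice_le hd hv hT hg0 hM u) _
  have hsum : Summable fun l => ∫ u, ‖X u * g (latPt T l - u)‖ := by
    refine (ENNReal.summable_toReal htot).congr fun l => ?_
    rw [integral_norm_eq_lintegral_enorm (hint l).aestronglyMeasurable]
  have h1 := (hasSum_integral_of_summable_integral_norm hint hsum).tsum_eq
  have hflip : ∀ l, (fun w => X (latPt T l - w) * g w) =
      fun w => (fun u => X u * g (latPt T l - u)) (latPt T l - w) := fun l => by
    ext w
    simp only [sub_sub_cancel]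
  have hint' : ∀ l, Integrable fun w => X (latPt T l - w) * g w := fun l => by
    rw [hflip l]
    exact (hint l).comp_sub_left _
  have hsum' : Summable fun l => ∫ w, ‖X (latPt T l - w) * g w‖ := by
    refine hsum.congr fun l => ?_
    rw [← integral_sub_left_eq_self _ volume (latPt T l)]
    simp only [sub_sub_cancel]
  have h2 := (hasSum_integral_of_summable_integral_norm hint' hsum').tsum_eq
  have h3 : ∀ l, ∫ w, X (latPt T l - w) * g w = ∫ u, X u * g (latPt T l - u) := fun l => by
    rw [← integral_sub_left_eq_self _ volume (latPt T l)]
    simp only [sub_sub_cancel]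
  simp_rw [h3] at h2
  rw [h1] at h2
  simp_rw [tsum_mul_left, tsum_mul_right] at h2
  have h4 : ∀ u, X u * (|T.det| * ∑' l, g (latPt T l - u)) =
      |T.det| * (X u * ∑' l, g (latPt T l - u)) := fun u => by ring
  simp_rw [h4]
  rw [integral_const_mul, h2, ← integral_const_mul]
  have h5 : ∀ w, ((|T.det| : ℝ) : ℂ) * ((∑' l, X (latPt T l - w)) * g w) =
      (∑' k, (Real.fourierChar (inner ℝ (latPt T⁻¹.transpose k) (-w)) : ℂ) *
        φ (latPt T⁻¹.transpose k)) * g w := fun w => by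
    simp_rw [sub_eq_add_neg _ w]
    rw [tsum_lattice_eq X hdet, hXφ, ← mul_assoc, ← mul_assoc, ← Complex.ofReal_mul,
      mul_inv_cancel₀ (abs_ne_zero.mpr hdet), Complex.ofReal_one, one_mul]
  simp_rw [h5]
  refine integral_tsum_fourierChar_mul ?_ _ hgi
  simpa using summable_norm_lattice φ (det_inv_transpose_ne_zero hdet) 0

end Duality

/-! ### Approximation of the identity -/

namespace BandResolution

variable {L : ℕ} {Ψ : LocalMeansKernel L} (R : BandResolution Ψ) {d : ℕ}

theorem cutoff_zero (N : ℕ) : R.cutoff d N 0 = 1 := by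
  obtain ⟨ρ, hρ, h⟩ := R.exists_cutoff_eq_one d
  exact h N 0 (by rw [norm_zero]; positivity)

theorem fourierInv_cutoff (N : ℕ) (u : Eu d) :
    𝓕⁻ (R.cutoff d N) u = ((2 : ℝ) ^ N) ^ d * 𝓕⁻ (R.cutoff d 0) ((2 : ℝ) ^ N • u) := by
  rw [SchwartzMap.fourierInv_coe, SchwartzMap.fourierInv_coe, Real.fourierInv_eq, Real.fourierInv_eq,
    R.cutoff_eq_comp N]
  have h := Measure.integral_comp_smul (volume : Measure (Eu d))
    (fun w => Real.fourierChar (inner ℝ w ((2 : ℝ) ^ N • u)) • R.cutoff d 0 w) ((2 : ℝ) ^ N)⁻¹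
  rw [finrank_euclideanSpace_fin, inv_pow, inv_inv, abs_of_pos (by positivity),
    Complex.real_smul] at h
  push_cast at h ⊢
  rw [← h]
  refine integral_congr_ae (Filter.Eventually.of_forall fun v => ?_)
  simp only [inner_smul_left, inner_smul_right, conj_trivial]
  rw [mul_inv_cancel_left₀ (by positivity)]

/-- The inverse transforms of the cutoffs are the dilates of one Schwartz function whose integral is
cutoff(0) = 1, that is, an approximate identity. -/
theorem tendsto_integral_cutoff_mul {P : Eu d → ℂ} (hP : Continuous P) {M : ℝ}
    (hM : ∀ u, ‖P u‖ ≤ M) :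
    Filter.Tendsto (fun N => ∫ u, 𝓕⁻ (R.cutoff d N) u * P u) Filter.atTop (nhds (P 0)) := by
  have hscale : ∀ N : ℕ, ∫ u, 𝓕⁻ (R.cutoff d N) u * P u =
      ∫ w, 𝓕⁻ (R.cutoff d 0) w * P (((2 : ℝ) ^ N)⁻¹ • w) := fun N => by
    have h := Measure.integral_comp_smul (volume : Measure (Eu d))
      (fun w => 𝓕⁻ (R.cutoff d 0) w * P (((2 : ℝ) ^ N)⁻¹ • w)) ((2 : ℝ) ^ N)
    rw [finrank_euclideanSpace_fin, abs_of_pos (by positivity), Complex.real_smul] at h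
    simp_rw [R.fourierInv_cutoff N, mul_assoc]
    rw [integral_const_mul]
    simp only [inv_smul_smul₀ (by positivity : (2 : ℝ) ^ N ≠ 0)] at h
    rw [h, ← mul_assoc]
    push_cast
    rw [mul_inv_cancel₀ (pow_ne_zero _ (pow_ne_zero _ two_ne_zero)), one_mul]
  simp_rw [hscale]
  have hone : ∫ w, 𝓕⁻ (R.cutoff d 0) w = 1 := by
    have h : 𝓕 (𝓕⁻ (R.cutoff d 0)) 0 = 1 := by
      rw [show 𝓕 (𝓕⁻ (R.cutoff d 0)) = R.cutoff d 0 from FourierTransform.fourier_fourierInv_eq _,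
        cutoff_zero]
    rw [SchwartzMap.fourier_coe, Real.fourier_eq] at h
    simpa using h
  have hlim : ∫ w, 𝓕⁻ (R.cutoff d 0) w * P 0 = P 0 := by
    rw [integral_mul_const, hone, one_mul]
  rw [← hlim]
  refine tendsto_integral_of_dominated_convergence (fun w => ‖𝓕⁻ (R.cutoff d 0) w‖ * M) (fun N => ?_)
    ((𝓕⁻ (R.cutoff d 0)).integrable.norm.mul_const M) (fun N => ?_) ?_
  · exact ((𝓕⁻ (R.cutoff d 0)).continuous.mul
      (hP.comp (continuous_const_smul _))).aestronglyMeasurable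
  · refine Filter.Eventually.of_forall fun w => ?_
    rw [norm_mul]
    exact mul_le_mul_of_nonneg_left (hM _) (norm_nonneg _)
  · refine Filter.Eventually.of_forall fun w => ?_
    refine tendsto_const_nhds.mul ((hP.tendsto 0).comp ?_)
    have h0 : Filter.Tendsto (fun N : ℕ => ((2 : ℝ) ^ N)⁻¹) Filter.atTop (nhds 0) :=
      tendsto_inv_atTop_zero.comp (tendsto_pow_atTop_atTop_of_one_lt one_lt_two)
    simpa using h0.smul_const w

/-! ### The error of a lattice rule -/

theorem integral_conv_mul_aliasKernel {T : Matrix (Fin d) (Fin d) ℝ} (hdet : T.det ≠ 0)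
    (m : Fin d → ℕ) {G : Eu d → ℂ} (hG : Integrable G) :
    ∫ y, R.aliasKernel T m y * G y = ∑' k, if k = 0 then 0 else
      R.symbol m (latPt T⁻¹.transpose k) * 𝓕 G (latPt T⁻¹.transpose k) := by
  have h := integral_tsum_fourierChar_mul (a := fun k : Fin d → ℤ => if k = 0 then (0 : ℂ) else
    R.symbol m (latPt T⁻¹.transpose k)) (Summable.of_nonneg_of_le (fun _ => norm_nonneg _) (fun k => by
      split_ifs
      · rw [norm_zero]
        exact norm_nonneg (R.symbol m (latPt T⁻¹.transpose k + 0))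
      · rw [add_zero]) (summable_norm_lattice (R.symbol m) (det_inv_transpose_ne_zero hdet) 0))
    (fun k => latPt T⁻¹.transpose k) hG
  simp only [mul_ite, mul_zero, ite_mul, zero_mul] at h
  exact h

/-- Nothing guarantees that 𝓕 g is summable over the dual lattice, so `P(u)` = |det T| Σ_l g(T l -
u) is averaged against the approximate identity. The average is a dual sum weighted by the cutoff;
its zero frequency is ∫ g, and `sum_symbol_mul` distributes the rest over the indices m. -/
theorem tendsto_sum_integral_aliasKernel (hd : 1 ≤ d) {T : Matrix (Fin d) (Fin d) ℝ} {v : ℝ}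
    (hv : 0 < v) (hT : IsAdmissible T v) (hdet : T.det ≠ 0) {f : 𝓢'(Eu d, ℂ)} {g : Eu d → ℂ}
    (h : IsContinuousRepresentative f g) (hg0 : ∀ x ∉ bigCube d 1, g x = 0) :
    Filter.Tendsto (fun N => ∑ m ∈ Fintype.piFinset fun _ : Fin d => Finset.range (N + 1),
      ∫ y, R.aliasKernel T m y * Ψ.conv m f y) Filter.atTop
      (nhds (|T.det| * ∑' l, g (latPt T l) - ∫ x, g x)) := by
  have hc : HasCompactSupport g := HasCompactSupport.intro (isCompact_bigCube 1) hg0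
  obtain ⟨M, hM⟩ := hc.exists_bound_of_continuous h.1
  have hgi : Integrable g := h.1.integrable_of_hasCompactSupport hc
  obtain ⟨ρ, -, hρ⟩ := Ψ.exists_tensor_support d
  have hconv : ∀ m, Integrable (Ψ.conv m f) := fun m =>
    (Ψ.continuous_conv m f).integrable_of_hasCompactSupport
      (HasCompactSupport.intro (isCompact_bigCube (1 + ρ)) fun x hx => Ψ.conv_eq_zero h hg0 hρ m hx)
  set P : Eu d → ℂ := fun u => |T.det| * ∑' l, g (latPt T l - u) with hP
  have hPc : Continuous P := continuous_const.mul (continuous_tsum_lattice hd hv hT h.1 hg0 hM)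
  have hPb : ∀ u, ‖P u‖ ≤ |T.det| * (ENNReal.ofReal M *
      ENNReal.ofReal ((2 * 1) ^ d / v + 2)).toReal := fun u => by
    rw [hP, norm_mul, Complex.norm_real, Real.norm_eq_abs, abs_abs]
    refine mul_le_mul_of_nonneg_left ?_ (abs_nonneg _)
    rw [← toReal_enorm]
    exact ENNReal.toReal_mono (ENNReal.mul_ne_top ENNReal.ofReal_ne_top ENNReal.ofReal_ne_top)
      (enorm_tsum_le_tsum_enorm.trans (tsum_enorm_lattice_le hd hv hT hg0 hM u))
  have hlim := (R.tendsto_integral_cutoff_mul hPc hPb).sub_const (∫ x, g x)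
  have hP0 : P 0 = |T.det| * ∑' l, g (latPt T l) := by simp [hP]
  rw [hP0] at hlim
  refine hlim.congr fun N => ?_
  have hgb : ∀ b, ‖𝓕 g b‖ ≤ ∫ x, ‖g x‖ := fun b => by
    rw [Real.fourier_eq]
    refine (norm_integral_le_integral_norm _).trans (le_of_eq ?_)
    simp [Circle.norm_smul]
  have hs : ∀ φ : 𝓢(Eu d, ℂ), ∀ G : Eu d → ℂ, (∃ C, ∀ b, ‖G b‖ ≤ C) → Summable fun k =>
      φ (latPt T⁻¹.transpose k) * G (latPt T⁻¹.transpose k) := fun φ G ⟨C, hC⟩ => by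
    refine Summable.of_norm_bounded
      ((summable_norm_lattice φ (det_inv_transpose_ne_zero hdet) 0).mul_right C) fun k => ?_
    rw [norm_mul, add_zero]
    exact mul_le_mul_of_nonneg_left (hC _) (norm_nonneg _)
  have hgb' : ∀ m, ∃ C, ∀ b, ‖𝓕 (Ψ.conv m f) b‖ ≤ C := fun m => by
    refine ⟨∫ x, ‖Ψ.conv m f x‖, fun b => ?_⟩
    rw [Real.fourier_eq]
    refine (norm_integral_le_integral_norm _).trans (le_of_eq ?_)
    simp [Circle.norm_smul]
  have hg00 : 𝓕 g 0 = ∫ x, g x := by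
    rw [Real.fourier_eq]
    simp
  have h1 := integral_mul_tsum_lattice hd hv hT hdet h.1 hg0 hM (R.cutoff d N)
  rw [Summable.tsum_eq_add_tsum_ite (hs _ _ ⟨_, hgb⟩) 0, latPt_zero, cutoff_zero, one_mul, hg00] at h1
  simp_rw [R.integral_conv_mul_aliasKernel hdet _ (hconv _)]
  rw [h1, add_sub_cancel_left, ← Summable.tsum_finsetSum]
  · refine tsum_congr fun k => ?_
    split_ifs with hk
    · simp
    · rw [← R.sum_symbol_mul, Finset.sum_mul]
      refine Finset.sum_congr rfl fun m _ => ?_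
      rw [Ψ.fourier_conv h hgi, mul_assoc]
  · intro m _
    refine Summable.of_norm_bounded (hs (R.symbol m) _ (hgb' m)).norm fun k => ?_
    split_ifs
    · rw [norm_zero]
      exact norm_nonneg _
    · exact le_rfl

theorem enorm_lattice_error_le (hd : 1 ≤ d) {T : Matrix (Fin d) (Fin d) ℝ} {v : ℝ}
    (hv : 0 < v) (hT : IsAdmissible T v) (hdet : T.det ≠ 0) {f : 𝓢'(Eu d, ℂ)} {g : Eu d → ℂ}
    (h : IsContinuousRepresentative f g) (hg0 : ∀ x ∉ bigCube d 1, g x = 0) {ρ : ℝ}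
    (hρ : ∀ (m : Fin d → ℕ) (x : Eu d), Ψ.tensor m x ≠ 0 → x ∈ bigCube d ρ) :
    ‖|T.det| * ∑' l, g (latPt T l) - ∫ x, g x‖ₑ ≤
      ∑' m, ∫⁻ y in bigCube d (1 + ρ), ‖R.aliasKernel T m y‖ₑ * ‖Ψ.conv m f y‖ₑ := by
  refine le_of_tendsto' ((R.tendsto_sum_integral_aliasKernel hd hv hT hdet h hg0).enorm) fun N => ?_
  refine (enorm_sum_le _ _).trans (le_trans (Finset.sum_le_sum fun m _ => ?_) (ENNReal.sum_le_tsum _))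
  have hrestr : ∫ y, R.aliasKernel T m y * Ψ.conv m f y =
      ∫ y in bigCube d (1 + ρ), R.aliasKernel T m y * Ψ.conv m f y := by
    refine (setIntegral_eq_integral_of_forall_compl_eq_zero fun y hy => ?_).symm
    rw [Ψ.conv_eq_zero h hg0 hρ m hy, mul_zero]
  rw [hrestr]
  refine (enorm_integral_le_lintegral_enorm _).trans (le_of_eq ?_)
  simp_rw [enorm_mul]

/-- At frequency 0 and N = 0 the resolution of the identity consists of the single index m = 0. This
controls the error of the zero rule. -/
theorem enorm_integral_le {f : 𝓢'(Eu d, ℂ)} {g : Eu d → ℂ}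
    (h : IsContinuousRepresentative f g) (hg0 : ∀ x ∉ bigCube d 1, g x = 0) {ρ : ℝ}
    (hρ : ∀ (m : Fin d → ℕ) (x : Eu d), Ψ.tensor m x ≠ 0 → x ∈ bigCube d ρ) :
    ‖∫ x, g x‖ₑ ≤ ‖R.symbol (d := d) 0 0‖ₑ * ∫⁻ y in bigCube d (1 + ρ), ‖Ψ.conv 0 f y‖ₑ := by
  have hgi : Integrable g := h.1.integrable_of_hasCompactSupport
    (HasCompactSupport.intro (isCompact_bigCube 1) hg0)
  have hF0 : ∀ G : Eu d → ℂ, 𝓕 G 0 = ∫ x, G x := fun G => by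
    rw [Real.fourier_eq]
    simp
  have h1 := R.sum_symbol_mul 0 (0 : Eu d)
  have hbox : (Fintype.piFinset fun _ : Fin d => Finset.range (0 + 1)) = {0} := by
    ext m
    simp [funext_iff]
  rw [hbox, Finset.sum_singleton, cutoff_zero] at h1
  have h2 : ∫ x, g x = R.symbol (d := d) 0 0 * ∫ y, Ψ.conv 0 f y := by
    rw [← hF0, ← hF0, Ψ.fourier_conv h hgi, ← mul_assoc, h1, one_mul]
  have hrestr : ∫ y, Ψ.conv 0 f y = ∫ y in bigCube d (1 + ρ), Ψ.conv 0 f y :=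
    (setIntegral_eq_integral_of_forall_compl_eq_zero fun y hy => Ψ.conv_eq_zero h hg0 hρ 0 hy).symm
  rw [h2, hrestr, enorm_mul]
  exact mul_le_mul_right (enorm_integral_le_lintegral_enorm _) _

end BandResolution

/-! ### Sums over dyadic levels -/

section Levels

variable {d : ℕ}

/-- The first coordinate is determined by the sum and the other d - 1 coordinates, each of which is
at most t. -/
theorem card_filter_sum_eq_le (hd : 1 ≤ d) (J : Finset (Fin d → ℕ)) (t : ℕ) :
    (J.filter fun m => ∑ i, m i = t).card ≤ (t + 1) ^ (d - 1) := by
  obtain ⟨e, rfl⟩ : ∃ e, d = e + 1 := ⟨d - 1, by omega⟩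
  rw [Nat.add_sub_cancel]
  have hcard : (Fintype.piFinset fun _ : Fin e => Finset.range (t + 1)).card = (t + 1) ^ e := by
    simp
  rw [← hcard]
  refine Finset.card_le_card_of_injOn (fun m i => m i.succ) (fun m hm => ?_) fun m hm l hl h => ?_
  · have hm' := (Finset.mem_filter.mp (Finset.mem_coe.mp hm)).2
    refine Finset.mem_coe.mpr (Fintype.mem_piFinset.mpr fun i => Finset.mem_range.mpr ?_)
    rw [← hm', Nat.lt_succ_iff]
    exact Finset.single_le_sum (f := m) (fun _ _ => Nat.zero_le _) (Finset.mem_univ i.succ)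
  · have hm' := (Finset.mem_filter.mp (Finset.mem_coe.mp hm)).2
    have hl' := (Finset.mem_filter.mp (Finset.mem_coe.mp hl)).2
    rw [Fin.sum_univ_succ] at hm' hl'
    have hsucc : ∀ i : Fin e, m i.succ = l i.succ := fun i => congrFun h i
    simp_rw [hsucc] at hm'
    ext i
    refine Fin.cases ?_ (fun i => hsucc i) i
    omega

theorem sum_level_le (hd : 1 ≤ d) (J : Finset (Fin d → ℕ)) {I : Finset ℕ}
    (hJ : ∀ m ∈ J, ∑ i, m i ∈ I) {h : ℕ → ℝ} (h0 : ∀ t, 0 ≤ h t) :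
    ∑ m ∈ J, h (∑ i, m i) ≤ ∑ t ∈ I, ((t : ℝ) + 1) ^ (d - 1) * h t := by
  rw [← Finset.sum_fiberwise_of_maps_to hJ]
  refine Finset.sum_le_sum fun t _ => ?_
  rw [Finset.sum_congr rfl fun m hm => by rw [(Finset.mem_filter.mp hm).2], Finset.sum_const,
    nsmul_eq_mul]
  refine mul_le_mul_of_nonneg_right ?_ (h0 t)
  exact_mod_cast card_filter_sum_eq_le hd J t

theorem sum_range_level_le (k : ℕ) {β : ℝ} (hβ : 0 < β) : ∃ c : ℝ, 0 < c ∧ ∀ N : ℕ,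
    ∑ t ∈ Finset.range N, ((t : ℝ) + 1) ^ k * (2 : ℝ) ^ (β * t) ≤
      c * (N : ℝ) ^ k * (2 : ℝ) ^ (β * N) := by
  set r : ℝ := (2 : ℝ) ^ β
  have hr : 1 < r := Real.one_lt_rpow (by norm_num) hβ
  have hpow : ∀ t : ℕ, (2 : ℝ) ^ (β * t) = r ^ t := fun t => by
    rw [Real.rpow_mul (by norm_num), Real.rpow_natCast]
  refine ⟨(r - 1)⁻¹, inv_pos.mpr (by linarith), fun N => ?_⟩
  simp_rw [hpow]
  calc _ ≤ ∑ t ∈ Finset.range N, (N : ℝ) ^ k * r ^ t := by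
        refine Finset.sum_le_sum fun t ht => mul_le_mul_of_nonneg_right ?_ (by positivity)
        exact pow_le_pow_left₀ (by positivity) (by exact_mod_cast Finset.mem_range.mp ht) _
    _ = (N : ℝ) ^ k * ((r ^ N - 1) / (r - 1)) := by rw [← Finset.mul_sum, geom_sum_eq hr.ne']
    _ ≤ (N : ℝ) ^ k * (r ^ N / (r - 1)) := by
        refine mul_le_mul_of_nonneg_left ?_ (by positivity)
        exact div_le_div_of_nonneg_right (by linarith) (by linarith)
    _ = _ := by
        rw [div_eq_mul_inv]
        ring

theorem sum_Ico_level_le (k t₀ N : ℕ) :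
    ∑ t ∈ Finset.Ico t₀ N, ((t : ℝ) + 1) ^ k ≤ (N : ℝ) ^ k * ((N - t₀ : ℕ) : ℝ) := by
  calc _ ≤ ∑ _t ∈ Finset.Ico t₀ N, (N : ℝ) ^ k := Finset.sum_le_sum fun t ht =>
        pow_le_pow_left₀ (by positivity) (by exact_mod_cast (Finset.mem_Ico.mp ht).2) _
    _ = _ := by rw [Finset.sum_const, Nat.card_Ico, nsmul_eq_mul, mul_comm]

/-- The inequality N + u + 1 ≤ (N + 1)(u + 1) separates the polynomial factor at the starting level
from a convergent series in u. -/
theorem sum_Ico_level_tail_le (k : ℕ) {β : ℝ} (hβ : β < 0) : ∃ c : ℝ, 0 < c ∧ ∀ N t₁ : ℕ,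
    ∑ t ∈ Finset.Ico N t₁, ((t : ℝ) + 1) ^ k * (2 : ℝ) ^ (β * t) ≤
      c * ((N : ℝ) + 1) ^ k * (2 : ℝ) ^ (β * N) := by
  set r : ℝ := (2 : ℝ) ^ β
  have hr0 : 0 < r := by positivity
  have hr1 : r < 1 := Real.rpow_lt_one_of_one_lt_of_neg (by norm_num) hβ
  have hpow : ∀ t : ℕ, (2 : ℝ) ^ (β * t) = r ^ t := fun t => by
    rw [Real.rpow_mul (by norm_num), Real.rpow_natCast]
  have hsum : Summable fun u : ℕ => ((u : ℝ) + 1) ^ k * r ^ u := by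
    have h := summable_pow_mul_geometric_of_norm_lt_one (R := ℝ) k
      (by rwa [Real.norm_of_nonneg hr0.le] : ‖r‖ < 1)
    refine (((summable_nat_add_iff 1).mpr h).mul_right r⁻¹).congr fun u => ?_
    push_cast
    rw [pow_succ, mul_assoc, mul_assoc, mul_inv_cancel₀ hr0.ne', mul_one]
  have hnn : ∀ u : ℕ, 0 ≤ ((u : ℝ) + 1) ^ k * r ^ u := fun u => by positivity
  refine ⟨∑' u : ℕ, ((u : ℝ) + 1) ^ k * r ^ u + 1,
    add_pos_of_nonneg_of_pos (tsum_nonneg hnn) one_pos, fun N t₁ => ?_⟩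
  simp_rw [hpow]
  rw [Finset.sum_Ico_eq_sum_range]
  calc _ ≤ ∑ u ∈ Finset.range (t₁ - N), ((N : ℝ) + 1) ^ k * r ^ N * (((u : ℝ) + 1) ^ k * r ^ u) := by
        refine Finset.sum_le_sum fun u _ => ?_
        rw [pow_add]
        calc _ ≤ (((N : ℝ) + 1) * ((u : ℝ) + 1)) ^ k * (r ^ N * r ^ u) := by
              refine mul_le_mul_of_nonneg_right (pow_le_pow_left₀ (by positivity) ?_ _)
                (by positivity)
              push_cast
              nlinarith [mul_nonneg (Nat.cast_nonneg (α := ℝ) N) (Nat.cast_nonneg (α := ℝ) u)]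
          _ = _ := by
              rw [mul_pow]
              ring
    _ = ((N : ℝ) + 1) ^ k * r ^ N * ∑ u ∈ Finset.range (t₁ - N), ((u : ℝ) + 1) ^ k * r ^ u := by
        rw [Finset.mul_sum]
    _ ≤ ((N : ℝ) + 1) ^ k * r ^ N * (∑' u : ℕ, ((u : ℝ) + 1) ^ k * r ^ u + 1) := by
        refine mul_le_mul_of_nonneg_left ?_ (by positivity)
        linarith [hsum.sum_le_tsum (Finset.range (t₁ - N)) fun u _ => hnn u]
    _ = _ := by ring

/-! ### Weighted Hölder inequality on a block of levels -/

/-- Hölder over m with weights 2^((1/q - s)|m|): `A` bounds the total weight of the block and `D`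
the largest single weight. -/
theorem sum_block_le {q s C W A D n : ℝ} (hq : 1 ≤ q) (hC : 0 ≤ C) (hW : 0 ≤ W) (hn : 0 < n)
    (J : Finset (Fin d → ℕ)) {S G : (Fin d → ℕ) → ℝ≥0∞}
    (hS : ∀ m ∈ J, S m ≤ ENNReal.ofReal C * (ENNReal.ofReal (2 ^ (∑ i, m i) / n) * G m) ^ q⁻¹)
    (hG : ∑' m, ENNReal.ofReal ((2 : ℝ) ^ (s * (∑ i, (m i : ℝ)) * q)) * G m ≤ ENNReal.ofReal W)
    (hA : ∑ m ∈ J, (2 : ℝ) ^ ((q⁻¹ - s) * ((∑ i, m i : ℕ) : ℝ)) ≤ A)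
    (hD0 : 0 ≤ D) (hD : ∀ m ∈ J, (2 : ℝ) ^ ((q⁻¹ - s) * ((∑ i, m i : ℕ) : ℝ)) ≤ D) :
    ∑ m ∈ J, S m ≤ ENNReal.ofReal (C * W ^ q⁻¹ * (n ^ (-q⁻¹) * A ^ (1 - q⁻¹) * D ^ q⁻¹)) := by
  have hq0 : 0 < q := by linarith
  have hqi : 0 ≤ q⁻¹ := by positivity
  have hq1 : 0 ≤ 1 - q⁻¹ := sub_nonneg.mpr (inv_le_one_of_one_le₀ hq)
  have hA0 : 0 ≤ A := (Finset.sum_nonneg fun m _ => by positivity).trans hA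
  set w : (Fin d → ℕ) → ℝ≥0∞ := fun m => ENNReal.ofReal ((2 : ℝ) ^ ((q⁻¹ - s) * ((∑ i, m i : ℕ) : ℝ)))
  set x : (Fin d → ℕ) → ℝ≥0∞ := fun m =>
    (ENNReal.ofReal ((2 : ℝ) ^ (s * (∑ i, (m i : ℝ)) * q)) * G m) ^ q⁻¹
  have hwx : ∀ m, (ENNReal.ofReal (2 ^ (∑ i, m i) / n) * G m) ^ q⁻¹ =
      ENNReal.ofReal (n ^ (-q⁻¹)) * (w m * x m) := fun m => by
    have e : (2 : ℝ) ^ (∑ i, m i) / n =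
        (n ^ (-q⁻¹) * (2 : ℝ) ^ ((q⁻¹ - s) * ((∑ i, m i : ℕ) : ℝ))) ^ q *
          (2 : ℝ) ^ (s * (∑ i, (m i : ℝ)) * q) := by
      rw [Real.mul_rpow (by positivity) (by positivity), ← Real.rpow_mul hn.le,
        ← Real.rpow_mul (by norm_num), neg_mul, inv_mul_cancel₀ hq0.ne', Real.rpow_neg_one, mul_assoc,
        ← Real.rpow_add (by norm_num), div_eq_inv_mul, ← Real.rpow_natCast 2]
      congr 2
      push_cast
      field_simp
      ring
    rw [e, ENNReal.ofReal_mul (by positivity), mul_assoc, ENNReal.mul_rpow_of_nonneg _ _ hqi,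
      ← ENNReal.ofReal_rpow_of_pos (by positivity), ← ENNReal.rpow_mul, mul_inv_cancel₀ hq0.ne',
      ENNReal.rpow_one, ENNReal.ofReal_mul (by positivity), mul_assoc]
  have hx : ∀ m, x m ^ q = ENNReal.ofReal ((2 : ℝ) ^ (s * (∑ i, (m i : ℝ)) * q)) * G m := fun m => by
    rw [← ENNReal.rpow_mul, inv_mul_cancel₀ hq0.ne', ENNReal.rpow_one]
  have h1 : ∑ m ∈ J, w m * x m ≤ ENNReal.ofReal A ^ (1 - q⁻¹) *
      (ENNReal.ofReal D * ENNReal.ofReal W) ^ q⁻¹ := by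
    refine (ENNReal.inner_le_weight_mul_Lp_of_nonneg J hq w x).trans
      (mul_le_mul' (ENNReal.rpow_le_rpow ?_ hq1) (ENNReal.rpow_le_rpow ?_ hqi))
    · rw [← ENNReal.ofReal_sum_of_nonneg fun m _ => by positivity]
      exact ENNReal.ofReal_le_ofReal hA
    · calc ∑ m ∈ J, w m * x m ^ q ≤ ∑ m ∈ J, ENNReal.ofReal D * x m ^ q :=
            Finset.sum_le_sum fun m hm => mul_le_mul_left (ENNReal.ofReal_le_ofReal (hD m hm)) _
        _ = ENNReal.ofReal D * ∑ m ∈ J, x m ^ q := by rw [Finset.mul_sum]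
        _ ≤ ENNReal.ofReal D * ENNReal.ofReal W := by
            refine mul_le_mul_right (le_trans ?_ hG) _
            simp_rw [hx]
            exact ENNReal.sum_le_tsum _
  calc ∑ m ∈ J, S m ≤ ∑ m ∈ J, ENNReal.ofReal C * (ENNReal.ofReal (n ^ (-q⁻¹)) * (w m * x m)) :=
        Finset.sum_le_sum fun m hm => (hS m hm).trans (le_of_eq (by rw [hwx]))
    _ = ENNReal.ofReal C * (ENNReal.ofReal (n ^ (-q⁻¹)) * ∑ m ∈ J, w m * x m) := by
        simp_rw [Finset.mul_sum]
    _ ≤ ENNReal.ofReal C * (ENNReal.ofReal (n ^ (-q⁻¹)) * (ENNReal.ofReal A ^ (1 - q⁻¹) *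
          (ENNReal.ofReal D * ENNReal.ofReal W) ^ q⁻¹)) :=
        mul_le_mul_right (mul_le_mul_right h1 _) _
    _ = _ := by
        rw [ENNReal.mul_rpow_of_nonneg _ _ hqi, ENNReal.ofReal_rpow_of_nonneg hA0 hq1,
          ENNReal.ofReal_rpow_of_nonneg hD0 hqi, ENNReal.ofReal_rpow_of_nonneg hW hqi,
          ← ENNReal.ofReal_mul (by positivity), ← ENNReal.ofReal_mul (by positivity),
          ← ENNReal.ofReal_mul (by positivity), ← ENNReal.ofReal_mul hC]
        congr 1
        ring

/-- With weights of size E ≈ (nV)^(τ-s) and about V indices per level, τ = 1/q cancels from the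
powers of n and V. Hence q = θ and q = p produce the same rate when the blocks meet at 2^|m| ≈ nV.
-/
theorem rpow_block_le {τ s n V Z A D E c₁ c₂ : ℝ} (hτ0 : 0 ≤ τ) (hτ1 : τ ≤ 1) (hn : 0 < n)
    (hV : 0 < V) (hZ : 0 ≤ Z) (hc₁ : 0 ≤ c₁) (hE0 : 0 < E) (hA0 : 0 ≤ A)
    (hD0 : 0 ≤ D) (hA : A ≤ c₁ * V * E * Z) (hD : D ≤ E) (hE : E ≤ c₂ * (n * V) ^ (τ - s)) :
    n ^ (-τ) * A ^ (1 - τ) * D ^ τ ≤ c₁ ^ (1 - τ) * c₂ * (n ^ (-s) * V ^ (1 - s) * Z ^ (1 - τ)) := by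
  have h1 : A ^ (1 - τ) ≤ c₁ ^ (1 - τ) * V ^ (1 - τ) * E ^ (1 - τ) * Z ^ (1 - τ) := by
    refine (Real.rpow_le_rpow hA0 hA (by linarith)).trans (le_of_eq ?_)
    rw [Real.mul_rpow (by positivity) hZ, Real.mul_rpow (by positivity) hE0.le,
      Real.mul_rpow hc₁ hV.le]
  have h2 : D ^ τ ≤ E ^ τ := Real.rpow_le_rpow hD0 hD hτ0
  have h3 : E ^ (1 - τ) * E ^ τ = E := by
    rw [← Real.rpow_add hE0, sub_add_cancel, Real.rpow_one]
  have h4 : n ^ (-τ) * n ^ (τ - s) = n ^ (-s) := by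
    rw [← Real.rpow_add hn]
    congr 1
    ring
  have h5 : V ^ (1 - τ) * V ^ (τ - s) = V ^ (1 - s) := by
    rw [← Real.rpow_add hV]
    congr 1
    ring
  calc n ^ (-τ) * A ^ (1 - τ) * D ^ τ
      ≤ n ^ (-τ) * (c₁ ^ (1 - τ) * V ^ (1 - τ) * E ^ (1 - τ) * Z ^ (1 - τ)) * E ^ τ := by gcongr
    _ = c₁ ^ (1 - τ) * V ^ (1 - τ) * Z ^ (1 - τ) * n ^ (-τ) * (E ^ (1 - τ) * E ^ τ) := by ring
    _ ≤ c₁ ^ (1 - τ) * V ^ (1 - τ) * Z ^ (1 - τ) * n ^ (-τ) * (c₂ * (n * V) ^ (τ - s)) := by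
        rw [h3]
        gcongr
    _ = c₁ ^ (1 - τ) * c₂ * ((n ^ (-τ) * n ^ (τ - s)) * (V ^ (1 - τ) * V ^ (τ - s)) *
          Z ^ (1 - τ)) := by
        rw [Real.mul_rpow hn.le hV.le]
        ring
    _ = _ := by rw [h4, h5]

end Levels

/-! ### Summation of the contributions of all levels -/

section Summation

variable {d : ℕ}

/-- The factor `(1 + log₂ n)^(d-1)`, the logarithm being rounded down. -/
def logFactor (d n : ℕ) : ℝ := ((Nat.log 2 n : ℝ) + 1) ^ (d - 1)

/-- The level at which the two regimes of the error estimate are separated. -/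
def splitLevel (d n : ℕ) : ℕ := Nat.log 2 n + (d - 1) * Nat.log 2 (Nat.log 2 n + 1)

theorem logFactor_pos (d n : ℕ) : 0 < logFactor d n := by
  unfold logFactor
  positivity

/-- Together with `le_two_pow_splitLevel` this says that 2^splitLevel is comparable to n ·
logFactor. The low block, with nonnegative exponent, uses the upper bound; the high block, with
negative exponent, uses the lower bound. -/
theorem two_pow_splitLevel_le {n : ℕ} (hn : 1 ≤ n) :
    (2 : ℝ) ^ splitLevel d n ≤ n * logFactor d n := by
  have h1 : (2 : ℝ) ^ Nat.log 2 n ≤ n := by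
    exact_mod_cast Nat.pow_log_le_self 2 (by omega)
  have h2 : (2 : ℝ) ^ Nat.log 2 (Nat.log 2 n + 1) ≤ (Nat.log 2 n : ℝ) + 1 := by
    exact_mod_cast Nat.pow_log_le_self 2 (by omega)
  rw [splitLevel, logFactor, pow_add, mul_comm (d - 1), pow_mul]
  exact mul_le_mul h1 (pow_le_pow_left₀ (by positivity) h2 _) (by positivity) (by positivity)

theorem le_two_pow_splitLevel (hd : 1 ≤ d) (n : ℕ) :
    (n : ℝ) * logFactor d n ≤ 2 ^ d * 2 ^ splitLevel d n := by
  have h1 : (n : ℝ) ≤ 2 ^ (Nat.log 2 n + 1) := by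
    exact_mod_cast (Nat.lt_pow_succ_log_self one_lt_two n).le
  have h2 : (Nat.log 2 n : ℝ) + 1 ≤ 2 ^ (Nat.log 2 (Nat.log 2 n + 1) + 1) := by
    exact_mod_cast (Nat.lt_pow_succ_log_self one_lt_two (Nat.log 2 n + 1)).le
  calc (n : ℝ) * logFactor d n ≤ 2 ^ (Nat.log 2 n + 1) *
        (2 ^ (Nat.log 2 (Nat.log 2 n + 1) + 1)) ^ (d - 1) :=
        mul_le_mul h1 (pow_le_pow_left₀ (by positivity) h2 _) (logFactor_pos d n).le
          (by positivity)
    _ = _ := by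
        rw [← pow_mul, ← pow_add, ← pow_add, splitLevel]
        congr 1
        obtain ⟨e, rfl⟩ : ∃ e, d = e + 1 := ⟨d - 1, by omega⟩
        rw [Nat.add_sub_cancel]
        ring

theorem splitLevel_add_one_pow_le (hd : 1 ≤ d) (n : ℕ) :
    ((splitLevel d n : ℝ) + 1) ^ (d - 1) ≤ (d : ℝ) ^ (d - 1) * logFactor d n := by
  rw [logFactor, ← mul_pow]
  refine pow_le_pow_left₀ (by positivity) ?_ _
  have hb : Nat.log 2 (Nat.log 2 n + 1) ≤ Nat.log 2 n + 1 := Nat.log_le_self _ _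
  have h : splitLevel d n + 1 ≤ d * (Nat.log 2 n + 1) := by
    obtain ⟨e, rfl⟩ : ∃ e, d = e + 1 := ⟨d - 1, by omega⟩
    rw [splitLevel, Nat.add_sub_cancel]
    nlinarith [Nat.mul_le_mul_left e hb]
  exact_mod_cast h

theorem two_rpow_mul_splitLevel (β : ℝ) (n : ℕ) :
    (2 : ℝ) ^ (β * (splitLevel d n : ℝ)) = ((2 : ℝ) ^ splitLevel d n) ^ β := by
  rw [mul_comm, Real.rpow_mul (by norm_num), Real.rpow_natCast]

/-- The levels below the splitting level. -/
theorem exists_sum_low_le (hd : 1 ≤ d) {C W q s : ℝ} (hC : 0 ≤ C) (hW : 0 ≤ W) (hq : 1 ≤ q)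
    (hs : s ≤ q⁻¹) (κ : ℕ) : ∃ K : ℝ, 0 < K ∧ ∀ n : ℕ, 1 ≤ n → ∀ Z : ℝ, 1 ≤ Z →
      (s < q⁻¹ ∨ (Nat.log 2 (Nat.log 2 n + 1) : ℝ) + 1 ≤ Z) → ∀ (J : Finset (Fin d → ℕ)),
      (∀ m ∈ J, ∑ i, m i ∈ Finset.Ico (Nat.log 2 n - κ) (splitLevel d n)) →
      ∀ S G : (Fin d → ℕ) → ℝ≥0∞,
      (∀ m, S m ≤ ENNReal.ofReal C * (ENNReal.ofReal (2 ^ (∑ i, m i) / n) * G m) ^ q⁻¹) →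
      ∑' m, ENNReal.ofReal ((2 : ℝ) ^ (s * (∑ i, (m i : ℝ)) * q)) * G m ≤ ENNReal.ofReal W →
      ∑ m ∈ J, S m ≤ ENNReal.ofReal
        (K * ((n : ℝ) ^ (-s) * logFactor d n ^ (1 - s) * Z ^ (1 - q⁻¹))) := by
  have hβ : 0 ≤ q⁻¹ - s := sub_nonneg.mpr hs
  have hqi : 0 ≤ q⁻¹ := by positivity
  have hqi1 : q⁻¹ ≤ 1 := inv_le_one_of_one_le₀ hq
  have hd0 : (0 : ℝ) < d := by exact_mod_cast hd
  obtain ⟨c, hc, hsum⟩ : ∃ c : ℝ, 0 < c ∧ ∀ (n : ℕ) (Z : ℝ), 1 ≤ Z →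
      (s < q⁻¹ ∨ (Nat.log 2 (Nat.log 2 n + 1) : ℝ) + 1 ≤ Z) →
      ∑ t ∈ Finset.Ico (Nat.log 2 n - κ) (splitLevel d n),
        ((t : ℝ) + 1) ^ (d - 1) * (2 : ℝ) ^ ((q⁻¹ - s) * t) ≤
      c * (splitLevel d n : ℝ) ^ (d - 1) * (2 : ℝ) ^ ((q⁻¹ - s) * (splitLevel d n : ℝ)) * Z := by
    -- For s < 1/q the weights grow geometrically and the top level dominates. For s = 1/q all
    -- levels weigh the same, and their number, at most (d - 1) log₂ log₂ n + κ up to rounding, is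
    -- absorbed into `Z`.
    rcases hs.lt_or_eq with hlt | heq
    · obtain ⟨c, hc, h⟩ := sum_range_level_le (d - 1) (sub_pos.mpr hlt)
      refine ⟨c, hc, fun n Z hZ _ => ?_⟩
      refine (Finset.sum_le_sum_of_subset_of_nonneg (t := Finset.range (splitLevel d n))
        (fun t ht => Finset.mem_range.mpr (Finset.mem_Ico.mp ht).2)
        fun _ _ _ => by positivity).trans ((h _).trans ?_)
      exact le_mul_of_one_le_right (by positivity) hZ
    · refine ⟨d + κ, by positivity, fun n Z hZ hZ' => ?_⟩
      have hb := hZ'.resolve_left (by rw [heq]; exact lt_irrefl _)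
      simp only [heq, sub_self, zero_mul, Real.rpow_zero, mul_one]
      refine (sum_Ico_level_le _ _ _).trans ?_
      have h1 : splitLevel d n - (Nat.log 2 n - κ) ≤
          (d + κ) * (Nat.log 2 (Nat.log 2 n + 1) + 1) := by
        have h2 : splitLevel d n - (Nat.log 2 n - κ) ≤
          (d - 1) * Nat.log 2 (Nat.log 2 n + 1) + κ := by
          rw [splitLevel]
          omega
        have h3 : (d - 1) * Nat.log 2 (Nat.log 2 n + 1) ≤ d * Nat.log 2 (Nat.log 2 n + 1) :=
          Nat.mul_le_mul_right _ (Nat.sub_le _ _)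
        nlinarith [Nat.zero_le (κ * Nat.log 2 (Nat.log 2 n + 1))]
      have h4 : ((splitLevel d n - (Nat.log 2 n - κ) : ℕ) : ℝ) ≤ (d + κ) * Z := by
        refine le_trans ?_ (mul_le_mul_of_nonneg_left hb (by positivity))
        exact_mod_cast h1
      calc _ ≤ (splitLevel d n : ℝ) ^ (d - 1) * ((d + κ) * Z) :=
            mul_le_mul_of_nonneg_left h4 (by positivity)
        _ = _ := by ring
  -- The summand 1 only keeps the constant positive when C or W is zero.
  refine ⟨C * W ^ q⁻¹ * ((c * d ^ (d - 1)) ^ (1 - q⁻¹) * 1) + 1, by positivity,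
    fun n hn Z hZ hZ' J hJ S G hS hG => ?_⟩
  have hn0 : (0 : ℝ) < n := by exact_mod_cast hn
  have hV := logFactor_pos d n
  set E := (2 : ℝ) ^ ((q⁻¹ - s) * (splitLevel d n : ℝ))
  have hA : ∑ m ∈ J, (2 : ℝ) ^ ((q⁻¹ - s) * ((∑ i, m i : ℕ) : ℝ)) ≤
      c * d ^ (d - 1) * logFactor d n * E * Z := by
    refine (sum_level_le hd J hJ (h := fun t => (2 : ℝ) ^ ((q⁻¹ - s) * (t : ℝ)))
      fun t => by positivity).trans ((hsum n Z hZ hZ').trans ?_)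
    refine mul_le_mul_of_nonneg_right (mul_le_mul_of_nonneg_right ?_ (by positivity)) (by linarith)
    rw [mul_assoc]
    refine mul_le_mul_of_nonneg_left (le_trans ?_ (splitLevel_add_one_pow_le hd n)) hc.le
    exact pow_le_pow_left₀ (by positivity) (by linarith) _
  have hD : ∀ m ∈ J, (2 : ℝ) ^ ((q⁻¹ - s) * ((∑ i, m i : ℕ) : ℝ)) ≤ E := fun m hm => by
    refine Real.rpow_le_rpow_of_exponent_le one_le_two (mul_le_mul_of_nonneg_left ?_ hβ)
    exact_mod_cast (Finset.mem_Ico.mp (hJ m hm)).2.le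
  have hE : E ≤ 1 * ((n : ℝ) * logFactor d n) ^ (q⁻¹ - s) := by
    rw [one_mul, show E = _ from two_rpow_mul_splitLevel _ n]
    exact Real.rpow_le_rpow (by positivity) (two_pow_splitLevel_le hn) hβ
  have hZ0 : 0 ≤ Z := by linarith
  refine (sum_block_le hq hC hW hn0 J (fun m _ => hS m) hG hA (by positivity) hD).trans
    (ENNReal.ofReal_le_ofReal ?_)
  refine (mul_le_mul_of_nonneg_left (rpow_block_le (s := s) hqi hqi1 hn0 hV hZ0
    (c₁ := c * d ^ (d - 1)) (by positivity) (by positivity) (by positivity) (by positivity)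
    le_rfl le_rfl hE) (by positivity)).trans ?_
  rw [← mul_assoc]
  refine mul_le_mul_of_nonneg_right (by linarith) (by positivity)

/-- The levels above the splitting level. -/
theorem exists_sum_high_le (hd : 1 ≤ d) {C W q s : ℝ} (hC : 0 ≤ C) (hW : 0 ≤ W) (hq : 1 ≤ q)
    (hs : q⁻¹ < s) : ∃ K : ℝ, 0 < K ∧ ∀ n : ℕ, 1 ≤ n → ∀ (J : Finset (Fin d → ℕ)),
      (∀ m ∈ J, splitLevel d n ≤ ∑ i, m i) →
      ∀ S G : (Fin d → ℕ) → ℝ≥0∞,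
      (∀ m, S m ≤ ENNReal.ofReal C * (ENNReal.ofReal (2 ^ (∑ i, m i) / n) * G m) ^ q⁻¹) →
      ∑' m, ENNReal.ofReal ((2 : ℝ) ^ (s * (∑ i, (m i : ℝ)) * q)) * G m ≤ ENNReal.ofReal W →
      ∑ m ∈ J, S m ≤ ENNReal.ofReal (K * ((n : ℝ) ^ (-s) * logFactor d n ^ (1 - s))) := by
  have hβ : q⁻¹ - s < 0 := sub_neg.mpr hs
  have hqi : 0 ≤ q⁻¹ := by positivity
  have hqi1 : q⁻¹ ≤ 1 := inv_le_one_of_one_le₀ hq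
  have hd0 : (0 : ℝ) < d := by exact_mod_cast hd
  obtain ⟨c, hc, hsum⟩ := sum_Ico_level_tail_le (d - 1) hβ
  set c₂ : ℝ := (((2 : ℝ) ^ d)⁻¹) ^ (q⁻¹ - s)
  refine ⟨C * W ^ q⁻¹ * ((c * d ^ (d - 1)) ^ (1 - q⁻¹) * c₂) + 1, by positivity,
    fun n hn J hJ S G hS hG => ?_⟩
  have hn0 : (0 : ℝ) < n := by exact_mod_cast hn
  have hV := logFactor_pos d n
  set E := (2 : ℝ) ^ ((q⁻¹ - s) * (splitLevel d n : ℝ))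
  have hA : ∑ m ∈ J, (2 : ℝ) ^ ((q⁻¹ - s) * ((∑ i, m i : ℕ) : ℝ)) ≤
      c * d ^ (d - 1) * logFactor d n * E * 1 := by
    -- The finite set J supplies some upper end for the levels; the tail bound does not depend on
    -- it.
    refine (sum_level_le hd J (I := Finset.Ico (splitLevel d n) (J.sup (fun m => ∑ i, m i) + 1))
      (fun m hm => Finset.mem_Ico.mpr ⟨hJ m hm, Nat.lt_succ_of_le
        (Finset.le_sup (f := fun m : Fin d → ℕ => ∑ i, m i) hm)⟩)
      (h := fun t => (2 : ℝ) ^ ((q⁻¹ - s) * (t : ℝ)))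
      fun t => by positivity).trans ((hsum _ _).trans ?_)
    rw [mul_one]
    refine mul_le_mul_of_nonneg_right ?_ (by positivity)
    rw [mul_assoc]
    exact mul_le_mul_of_nonneg_left (splitLevel_add_one_pow_le hd n) hc.le
  have hD : ∀ m ∈ J, (2 : ℝ) ^ ((q⁻¹ - s) * ((∑ i, m i : ℕ) : ℝ)) ≤ E := fun m hm => by
    refine Real.rpow_le_rpow_of_exponent_le one_le_two (mul_le_mul_of_nonpos_left ?_ hβ.le)
    exact_mod_cast hJ m hm
  have hE : E ≤ c₂ * ((n : ℝ) * logFactor d n) ^ (q⁻¹ - s) := by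
    rw [show E = _ from two_rpow_mul_splitLevel _ n, ← Real.mul_rpow (by positivity) (by positivity)]
    refine Real.rpow_le_rpow_of_nonpos (by positivity) ?_ hβ.le
    rw [inv_mul_le_iff₀ (by positivity)]
    exact le_two_pow_splitLevel hd n
  refine (sum_block_le hq hC hW hn0 J (fun m _ => hS m) hG hA (by positivity) hD).trans
    (ENNReal.ofReal_le_ofReal ?_)
  refine (mul_le_mul_of_nonneg_left (rpow_block_le (s := s) hqi hqi1 hn0 hV zero_le_one
    (c₁ := c * d ^ (d - 1)) (by positivity) (by positivity) (by positivity) (by positivity)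
    le_rfl le_rfl hE) (by positivity)).trans ?_
  rw [← mul_assoc, Real.one_rpow, mul_one]
  refine mul_le_mul_of_nonneg_right (by linarith) (by positivity)

/-- Summation of all levels. -/
theorem exists_tsum_levels_le (hd : 1 ≤ d) {C W p θ s : ℝ} (hC : 1 ≤ C) (hW : 0 ≤ W) (hθ : 1 ≤ θ)
    (hθp : θ < p) (hsp : p⁻¹ < s) (hsθ : s ≤ θ⁻¹) : ∃ K : ℝ, 0 < K ∧ ∀ n : ℕ, 1 ≤ n → ∀ Z : ℝ, 1 ≤ Z →
      (s < θ⁻¹ ∨ (Nat.log 2 (Nat.log 2 n + 1) : ℝ) + 1 ≤ Z) →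
      ∀ S G H : (Fin d → ℕ) → ℝ≥0∞, (∀ m, C * 2 ^ (∑ i, m i) < n → S m = 0) →
      (∀ m, S m ≤ ENNReal.ofReal C * (ENNReal.ofReal (2 ^ (∑ i, m i) / n) * G m) ^ θ⁻¹) →
      (∀ m, S m ≤ ENNReal.ofReal C * (ENNReal.ofReal (2 ^ (∑ i, m i) / n) * H m) ^ p⁻¹) →
      ∑' m, ENNReal.ofReal ((2 : ℝ) ^ (s * (∑ i, (m i : ℝ)) * θ)) * G m ≤ ENNReal.ofReal W →
      ∑' m, ENNReal.ofReal ((2 : ℝ) ^ (s * (∑ i, (m i : ℝ)) * p)) * H m ≤ ENNReal.ofReal W →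
      ∑' m, S m ≤ ENNReal.ofReal
        (K * ((n : ℝ) ^ (-s) * logFactor d n ^ (1 - s) * Z ^ (1 - θ⁻¹))) := by
  -- Levels below log₂ n - κ satisfy C 2^|m| < n, so their terms vanish and the low block starts
  -- there.
  obtain ⟨κ, hκ⟩ := pow_unbounded_of_one_lt C one_lt_two
  have hC0 : 0 ≤ C := by linarith
  have hθ1 : θ⁻¹ ≤ 1 := inv_le_one_of_one_le₀ hθ
  obtain ⟨K₁, hK₁, h₁⟩ := exists_sum_low_le hd hC0 hW hθ hsθ κ
  obtain ⟨K₂, hK₂, h₂⟩ := exists_sum_high_le hd hC0 hW (hθ.trans hθp.le) hsp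
  refine ⟨K₁ + K₂, by positivity, fun n hn Z hZ hZ' S G H hS hSG hSH hG hH => ?_⟩
  rw [ENNReal.tsum_eq_iSup_sum]
  refine iSup_le fun u => ?_
  have hV := logFactor_pos d n
  set X := (n : ℝ) ^ (-s) * logFactor d n ^ (1 - s)
  have hX : 0 ≤ X := by positivity
  have hsplit : ∑ m ∈ u, S m = ∑ m ∈ u.filter (fun m => ∑ i, m i ∈
      Finset.Ico (Nat.log 2 n - κ) (splitLevel d n)), S m +
      ∑ m ∈ u.filter (fun m => splitLevel d n ≤ ∑ i, m i), S m := by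
    rw [← Finset.sum_filter_add_sum_filter_not u (fun m => splitLevel d n ≤ ∑ i, m i), add_comm]
    congr 1
    refine (Finset.sum_subset (fun m hm => ?_) fun m hm hm' => ?_).symm
    · rw [Finset.mem_filter, Finset.mem_Ico] at hm
      rw [Finset.mem_filter]
      exact ⟨hm.1, not_le.mpr hm.2.2⟩
    · rw [Finset.mem_filter] at hm
      rw [Finset.mem_filter, Finset.mem_Ico] at hm'
      have hlt : ∑ i, m i < Nat.log 2 n - κ := by
        by_contra hge
        exact hm' ⟨hm.1, not_lt.mp hge, not_le.mp hm.2⟩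
      refine hS m ?_
      calc C * 2 ^ (∑ i, m i) ≤ 2 ^ κ * 2 ^ (∑ i, m i) :=
            mul_le_mul_of_nonneg_right hκ.le (by positivity)
        _ = 2 ^ (κ + ∑ i, m i) := (pow_add _ _ _).symm
        _ < 2 ^ Nat.log 2 n := pow_lt_pow_right₀ one_lt_two (by omega)
        _ ≤ n := by exact_mod_cast Nat.pow_log_le_self 2 (by omega)
  rw [hsplit]
  have e₁ := h₁ n hn Z hZ hZ' (u.filter fun m => ∑ i, m i ∈
    Finset.Ico (Nat.log 2 n - κ) (splitLevel d n)) (fun m hm => (Finset.mem_filter.mp hm).2) S G hSG hG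
  have e₂ := h₂ n hn (u.filter fun m => splitLevel d n ≤ ∑ i, m i)
    (fun m hm => (Finset.mem_filter.mp hm).2) S H hSH hH
  have hZ1 : 1 ≤ Z ^ (1 - θ⁻¹) := Real.one_le_rpow hZ (by linarith)
  refine (add_le_add e₁ e₂).trans ?_
  rw [← ENNReal.ofReal_add (by positivity) (by positivity)]
  refine ENNReal.ofReal_le_ofReal ?_
  have : K₂ * X ≤ K₂ * (X * Z ^ (1 - θ⁻¹)) :=
    mul_le_mul_of_nonneg_left (le_mul_of_one_le_right hX hZ1) hK₂.le
  linarith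

end Summation

/-! ### Comparison with natural logarithms -/

theorem natLog_two_le {x : ℝ} {k : ℕ} (hk : (k : ℝ) ≤ x) (h1 : 1 ≤ k) :
    (Nat.log 2 k : ℝ) ≤ Real.log x / Real.log 2 := by
  have hlog2 : 0 < Real.log 2 := Real.log_pos one_lt_two
  rw [le_div_iff₀ hlog2, ← Real.log_pow]
  refine Real.log_le_log (by positivity) (le_trans ?_ hk)
  exact_mod_cast Nat.pow_log_le_self 2 (by omega)

theorem exists_natLog_add_one_le : ∃ c : ℝ, 1 ≤ c ∧ ∀ n : ℕ, 2 ≤ n →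
    (Nat.log 2 n : ℝ) + 1 ≤ c * Real.log n := by
  have hlog2 : 0 < Real.log 2 := Real.log_pos one_lt_two
  refine ⟨2 / Real.log 2, (one_le_div hlog2).mpr (by linarith [Real.log_two_lt_d9]), fun n hn => ?_⟩
  have h1 := natLog_two_le (le_refl (n : ℝ)) (by omega : 1 ≤ n)
  have h2 : Real.log 2 ≤ Real.log n := Real.log_le_log two_pos (by exact_mod_cast hn)
  have h3 : 1 ≤ Real.log n / Real.log 2 := (one_le_div hlog2).mpr h2
  calc (Nat.log 2 n : ℝ) + 1 ≤ Real.log n / Real.log 2 + Real.log n / Real.log 2 := add_le_add h1 h3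
    _ = _ := by ring

theorem one_lt_log_of_three_le {n : ℕ} (hn : 3 ≤ n) : 1 < Real.log n := by
  rw [Real.lt_log_iff_exp_lt (by positivity)]
  have : (3 : ℝ) ≤ n := by exact_mod_cast hn
  linarith [Real.exp_one_lt_d9]

/-- From n = 3 on, log log n is bounded below by the positive number log log 3, which absorbs the
additive constants; at n = 2 it is negative. -/
theorem exists_natLog_natLog_add_one_le : ∃ c : ℝ, 1 ≤ c ∧ ∀ n : ℕ, 3 ≤ n →
    (Nat.log 2 (Nat.log 2 n + 1) : ℝ) + 1 ≤ c * Real.log (Real.log n) := by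
  obtain ⟨c, hc, h⟩ := exists_natLog_add_one_le
  have hlog2 : 0 < Real.log 2 := Real.log_pos one_lt_two
  have hl3 : 0 < Real.log (Real.log (3 : ℕ)) := Real.log_pos (one_lt_log_of_three_le le_rfl)
  have hlc : 0 ≤ Real.log c := Real.log_nonneg hc
  set q := Real.log c / Real.log 2 + 1
  have hq : 1 ≤ q := by
    have : 0 ≤ Real.log c / Real.log 2 := by positivity
    linarith
  refine ⟨q / Real.log (Real.log (3 : ℕ)) + 1 / Real.log 2, ?_, fun n hn => ?_⟩
  · have h1 : 1 ≤ 1 / Real.log 2 := (one_le_div hlog2).mpr (by linarith [Real.log_two_lt_d9])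
    have h2 : 0 ≤ q / Real.log (Real.log (3 : ℕ)) := by positivity
    linarith
  · have hn1 := one_lt_log_of_three_le hn
    have h3 : Real.log (Real.log (3 : ℕ)) ≤ Real.log (Real.log n) := by
      refine Real.log_le_log (by linarith [one_lt_log_of_three_le (le_refl 3)]) ?_
      exact Real.log_le_log (by norm_num) (by exact_mod_cast hn)
    have h4 := natLog_two_le (k := Nat.log 2 n + 1) (x := c * Real.log n)
      (by exact_mod_cast h n (by omega)) (by omega)
    rw [Real.log_mul (by positivity) (by linarith)] at h4
    have h5 : q ≤ q / Real.log (Real.log (3 : ℕ)) * Real.log (Real.log n) := by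
      rw [div_mul_eq_mul_div, le_div_iff₀ hl3]
      exact mul_le_mul_of_nonneg_left h3 (by linarith)
    calc _ ≤ (Real.log c + Real.log (Real.log n)) / Real.log 2 + 1 := by linarith
      _ = q + 1 / Real.log 2 * Real.log (Real.log n) := by ring
      _ ≤ _ := by linarith

/-! ### Frolov's rule as a lattice sum -/

section Rule

variable {d : ℕ}

/-- The point is a limit of points outside the cube. Hence the rule over the half-open cube
coincides with the sum over the whole lattice. -/
theorem eq_zero_of_apply_eq_one {g : Eu d → ℂ} (hg : Continuous g) (hg0 : ∀ x ∉ unitCube d, g x = 0)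
    {x : Eu d} {i : Fin d} (hx : x i = 1) : g x = 0 := by
  have hlim : Filter.Tendsto (fun j : ℕ => x + (1 / ((j : ℝ) + 1)) • (PiLp.single 2 i (1 : ℝ) : Eu d))
      Filter.atTop (nhds x) := by
    have h := (tendsto_one_div_add_atTop_nhds_zero_nat (𝕜 := ℝ)).smul_const
      (PiLp.single 2 i (1 : ℝ) : Eu d)
    simpa using h.const_add x
  refine tendsto_nhds_unique ((hg.tendsto x).comp hlim) ?_
  refine tendsto_const_nhds.congr fun j => (hg0 _ fun hmem => ?_).symm
  have h := (hmem i).2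
  have hpos : (0 : ℝ) < 1 / ((j : ℝ) + 1) := by positivity
  simp only [PiLp.add_apply, PiLp.smul_apply, PiLp.single_apply, if_true, hx,
    smul_eq_mul, mul_one] at h
  linarith

theorem eq_zero_of_notMem_Ico {g : Eu d → ℂ} (hg : Continuous g) (hg0 : ∀ x ∉ unitCube d, g x = 0)
    {x : Eu d} (hx : ¬ ∀ i, x i ∈ Set.Ico (0 : ℝ) 1) : g x = 0 := by
  by_cases hc : x ∈ unitCube d
  · push Not at hx
    obtain ⟨i, hi⟩ := hx
    refine eq_zero_of_apply_eq_one hg hg0 (i := i) ?_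
    by_contra hne
    exact hi ⟨(hc i).1, lt_of_le_of_ne (hc i).2 hne⟩
  · exact hg0 x hc

theorem frolovRule_eq (hd : 1 ≤ d) {ξ : Fin d → ℝ} (hξ : IsFrolovRoots ξ) {n : ℕ} (hn : 1 ≤ n)
    {g : Eu d → ℂ} (hg : Continuous g) (hg0 : ∀ x ∉ unitCube d, g x = 0) :
    frolovRule ξ n g = |(frolovMatrix ξ n).det| * ∑' l, g (latPt (frolovMatrix ξ n) l) := by
  have hinj : Function.Injective (latPt (frolovMatrix ξ n)) := by
    refine (isAdmissible_frolovMatrix hd hξ hn).injective hd ?_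
    have := abs_pos.mpr (hξ.det_ne_zero hd)
    positivity
  obtain ⟨c, -, hfin⟩ := exists_ncard_frolovNodes_le hd hξ
  have hF := (hfin n hn).1
  rw [frolovRule, abs_det_frolovMatrix hd hξ hn, frolovNodes_eq, finsum_mem_image hinj.injOn]
  rw [frolovNodes_eq] at hF
  have hF' := hF.of_finite_image hinj.injOn
  push_cast
  congr 1
  rw [finsum_mem_eq_finite_toFinset_sum _ hF', tsum_eq_sum fun k hk => ?_]
  rw [Set.Finite.mem_toFinset] at hk
  exact eq_zero_of_notMem_Ico hg hg0 hk

/-! ### From Frolov's rule to arbitrary rules -/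

theorem zero_mem_unitCube (d : ℕ) : (0 : Eu d) ∈ unitCube d := fun i => by simp

/-- Surplus nodes are placed at the origin with weight 0. -/
theorem minimalError_le_worstCaseError (K : Set (Eu d → ℂ)) (ξ : Fin d → ℝ) {n N : ℕ}
    (hfin : (frolovNodes ξ N).Finite) (hcard : (frolovNodes ξ N).ncard ≤ n) :
    minimalError K n ≤ worstCaseError K (frolovRule ξ N) := by
  have := hfin.fintype
  have hc : Fintype.card (frolovNodes ξ N) ≤ Fintype.card (Fin n) := by
    rw [Fintype.card_fin, ← Nat.card_eq_fintype_card]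
    exact hcard
  obtain ⟨e⟩ := Function.Embedding.nonempty_of_card_le hc
  have hsub : ∀ y : frolovNodes ξ N, (y : Eu d) ∈ unitCube d := fun y i =>
    ⟨(y.2.2 i).1, (y.2.2 i).2.le⟩
  let x : Fin n → unitCube d :=
    Function.extend e (fun y => ⟨y, hsub y⟩) fun _ => ⟨0, zero_mem_unitCube d⟩
  let w : Fin n → ℝ := Function.extend e (fun _ => (N : ℝ)⁻¹) fun _ => 0
  refine (iInf₂_le x w).trans (le_of_eq ?_)
  congr 1
  ext g
  have h1 : ∑ y : frolovNodes ξ N, ((N : ℝ)⁻¹ : ℂ) * g y = ∑ i, (w i : ℂ) * g (x i) := by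
    refine Fintype.sum_of_injective e e.injective _ _ (fun i hi => ?_) fun y => ?_
    · have : w i = 0 := Function.extend_apply' _ _ _ hi
      rw [this, Complex.ofReal_zero, zero_mul]
    · simp only [w, x, e.injective.extend_apply]
      push_cast
      rfl
  rw [← h1, ← Finset.mul_sum, frolovRule]
  push_cast
  congr 1
  rw [← finsum_set_coe_eq_finsum_mem, finsum_eq_sum_of_fintype]

end Rule

/-! ### Error bounds -/

section ErrorBounds

variable {d L : ℕ} {Ψ : LocalMeansKernel L} {s p θ : ℝ}

theorem eq_zero_of_mem_tlCubeSpace {f : 𝓢'(Eu d, ℂ)} {g : Eu d → ℂ}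
    (hf : f ∈ tlCubeSpace Ψ d s p θ) (h : IsContinuousRepresentative f g) :
    ∀ x ∉ unitCube d, g x = 0 :=
  fun _ hx => h.eq_zero fun hmem => hx (hf.2 hmem)

theorem setIntegral_unitCube_eq {g : Eu d → ℂ} (hg0 : ∀ x ∉ unitCube d, g x = 0) :
    ∫ x in unitCube d, g x = ∫ x, g x :=
  setIntegral_eq_integral_of_forall_compl_eq_zero hg0

/-- The cube `Q` contains the supports of all Ψ_m ∗ f. The same local integrals are bounded with q =
θ and with q = p, and `exists_tsum_levels_le` chooses between the two level by level. -/
theorem exists_worstCaseError_frolovRule_le (hd : 1 ≤ d) (hθ : 1 ≤ θ) (hθp : θ < p)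
    (hsp : p⁻¹ < s) (hsθ : s ≤ θ⁻¹) (Ψ : LocalMeansKernel L) {ξ : Fin d → ℝ}
    (hξ : IsFrolovRoots ξ) : ∃ K : ℝ, 0 < K ∧ ∀ n : ℕ, 1 ≤ n → ∀ Z : ℝ, 1 ≤ Z →
      (s < θ⁻¹ ∨ (Nat.log 2 (Nat.log 2 n + 1) : ℝ) + 1 ≤ Z) →
      worstCaseError (tlCubeBall Ψ d s p θ) (frolovRule ξ n) ≤
        ENNReal.ofReal (K * ((n : ℝ) ^ (-s) * logFactor d n ^ (1 - s) * Z ^ (1 - θ⁻¹))) := by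
  obtain ⟨R⟩ := nonempty_bandResolution Ψ
  obtain ⟨ρ, hρ1, hρ⟩ := Ψ.exists_tensor_support d
  have hr : 0 ≤ 1 + ρ := by linarith
  obtain ⟨C, hC, hK⟩ := R.exists_frolov_aliasKernel_bounds hd hξ hr
  have hp0 : 0 < p := by linarith
  have hvol := volume_bigCube (d := d) hr
  set Q := bigCube d (1 + ρ)
  set W : ℝ := max 1 (((2 * (1 + ρ)) ^ d) ^ (1 - θ / p))
  have hθp1 : 0 ≤ 1 - θ / p := sub_nonneg.mpr ((div_le_one hp0).mpr hθp.le)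
  obtain ⟨K, hK0, hmain⟩ := exists_tsum_levels_le hd hC (zero_le_one.trans (le_max_left 1 _) : 0 ≤ W)
    hθ hθp hsp hsθ
  refine ⟨K, hK0, fun n hn Z hZ hZ' => ?_⟩
  refine iSup₂_le fun g hg => ?_
  obtain ⟨f, hf, hf1, h⟩ := hg
  have hg0 := eq_zero_of_mem_tlCubeSpace hf h
  have hg0' : ∀ x ∉ bigCube d 1, g x = 0 := fun x hx =>
    hg0 x fun hmem => hx (unitCube_subset_bigCube hmem)
  have hn0 : (0 : ℝ) < n := by exact_mod_cast hn
  have hdet : (frolovMatrix ξ n).det ≠ 0 := by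
    rw [← abs_pos, abs_det_frolovMatrix hd hξ hn]
    positivity
  have hvand := abs_pos.mpr (hξ.det_ne_zero hd)
  have herr := R.enorm_lattice_error_le hd (by positivity) (isAdmissible_frolovMatrix hd hξ hn) hdet
    h hg0' hρ
  rw [setIntegral_unitCube_eq hg0, frolovRule_eq hd hξ hn h.1 hg0, enorm_sub_rev]
  refine herr.trans ?_
  have hbound : ∀ q : ℝ, 1 ≤ q → ∀ m : Fin d → ℕ,
      ∫⁻ y in Q, ‖R.aliasKernel (frolovMatrix ξ n) m y‖ₑ * ‖Ψ.conv m f y‖ₑ ≤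
        ENNReal.ofReal C * (ENNReal.ofReal (2 ^ (∑ i, m i) / n) *
          ∫⁻ y in Q, ‖Ψ.conv m f y‖ₑ ^ q) ^ q⁻¹ := fun q hq m => by
    refine lintegral_mul_le_of_bounds
      (R.continuous_aliasKernel hdet m).measurable.enorm.aemeasurable
      (Ψ.continuous_conv m f).measurable.enorm.aemeasurable hq (hK n hn m).2.2 fun y => ?_
    rw [← ENNReal.ofReal_mul (by linarith), ← ofReal_norm]
    exact ENNReal.ofReal_le_ofReal ((hK n hn m).1 y)
  refine hmain n hn Z hZ hZ' _ (fun m => ∫⁻ y in Q, ‖Ψ.conv m f y‖ₑ ^ θ)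
    (fun m => ∫⁻ y in Q, ‖Ψ.conv m f y‖ₑ ^ p) (fun m hm => ?_) (hbound θ hθ)
    (hbound p (by linarith)) ?_ ?_
  · simp [(hK n hn m).2.1 hm]
  · refine (Ψ.tsum_setLIntegral_rpow_le (by linarith) hθp f Q).trans ?_
    rw [hvol, ENNReal.ofReal_rpow_of_nonneg (by positivity) hθp1]
    refine (mul_le_of_le_one_right' (ENNReal.rpow_le_one hf1 (by linarith))).trans ?_
    exact ENNReal.ofReal_le_ofReal (le_max_right _ _)
  · refine (ENNReal.tsum_le_tsum fun m => mul_le_mul_right (setLIntegral_le_lintegral _ _) _).trans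
      ((Ψ.tsum_lintegral_rpow_le (by linarith) hθp.le f).trans ?_)
    refine (ENNReal.rpow_le_one hf1 hp0.le).trans ?_
    rw [← ENNReal.ofReal_one]
    exact ENNReal.ofReal_le_ofReal (le_max_left _ _)

theorem exists_minimalError_le_const (hθ : 1 ≤ θ) (hθp : θ < p) (Ψ : LocalMeansKernel L) :
    ∃ K : ℝ, 0 < K ∧ ∀ n : ℕ, minimalError (tlCubeBall Ψ d s p θ) n ≤ ENNReal.ofReal K := by
  obtain ⟨R⟩ := nonempty_bandResolution Ψ
  obtain ⟨ρ, hρ1, hρ⟩ := Ψ.exists_tensor_support d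
  obtain ⟨C, hC, hsym⟩ := R.exists_symbol_bound d
  have hr : 0 ≤ 1 + ρ := by linarith
  have hp0 : 0 < p := by linarith
  set Q := bigCube d (1 + ρ)
  set V : ℝ := max 1 ((2 * (1 + ρ)) ^ d)
  have hV : 1 ≤ V := le_max_left _ _
  refine ⟨C * V, by positivity, fun n => ?_⟩
  refine (iInf₂_le (fun _ => ⟨0, zero_mem_unitCube d⟩) fun _ => 0).trans (iSup₂_le fun g hg => ?_)
  obtain ⟨f, hf, hf1, h⟩ := hg
  have hg0 := eq_zero_of_mem_tlCubeSpace hf h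
  simp only [Complex.ofReal_zero, zero_mul, Finset.sum_const_zero, sub_zero]
  rw [setIntegral_unitCube_eq hg0]
  refine (R.enorm_integral_le h (fun x hx => hg0 x fun hmem => hx (unitCube_subset_bigCube hmem))
    hρ).trans ?_
  rw [ENNReal.ofReal_mul (by linarith), ← ofReal_norm]
  refine mul_le_mul' (ENNReal.ofReal_le_ofReal (hsym 0 0)) ?_
  have h1 := lintegral_mul_le_of_bounds (μ := volume.restrict Q) (a := fun _ => (1 : ℝ≥0∞))
    (g := fun y => ‖Ψ.conv 0 f y‖ₑ) (C := ENNReal.ofReal V) (M := 1) (q := p) aemeasurable_const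
    (Ψ.continuous_conv 0 f).measurable.enorm.aemeasurable (by linarith) (by
      rw [lintegral_const, Measure.restrict_apply MeasurableSet.univ, Set.univ_inter,
        volume_bigCube hr, one_mul]
      exact ENNReal.ofReal_le_ofReal (le_max_right _ _)) fun _ => by
      rw [mul_one, ← ENNReal.ofReal_one]
      exact ENNReal.ofReal_le_ofReal hV
  simp only [one_mul] at h1
  refine h1.trans (mul_le_of_le_one_right' (ENNReal.rpow_le_one ?_ (by positivity)))
  have h2 := (ENNReal.le_tsum (0 : Fin d → ℕ)).trans
    (Ψ.tsum_lintegral_rpow_le (s := s) (by linarith) hθp.le f)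
  simp only [Pi.zero_apply, CharP.cast_eq_zero, Finset.sum_const_zero, mul_zero, zero_mul,
    Real.rpow_zero, ENNReal.ofReal_one, one_mul] at h2
  exact (setLIntegral_le_lintegral _ _).trans (h2.trans (ENNReal.rpow_le_one hf1 hp0.le))

/-- Frolov's rule with parameter N may have up to κN nodes, so N = ⌊n/κ⌋ is used; the rate changes
only by a constant factor. For n < κ this N is 0, and the bounded error of the zero rule suffices.
-/
theorem exists_minimalError_le (hd : 1 ≤ d) (hθ : 1 ≤ θ) (hθp : θ < p)
    (hsp : p⁻¹ < s) (hsθ : s ≤ θ⁻¹) (Ψ : LocalMeansKernel L) :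
    ∃ K : ℝ, 0 < K ∧ ∀ n : ℕ, 1 ≤ n → ∀ Z : ℝ, 1 ≤ Z →
      (s < θ⁻¹ ∨ (Nat.log 2 (Nat.log 2 n + 1) : ℝ) + 1 ≤ Z) →
      minimalError (tlCubeBall Ψ d s p θ) n ≤
        ENNReal.ofReal (K * ((n : ℝ) ^ (-s) * logFactor d n ^ (1 - s) * Z ^ (1 - θ⁻¹))) := by
  obtain ⟨ξ, hξ⟩ := exists_isFrolovRoots hd
  obtain ⟨K₁, hK₁, h₁⟩ := exists_worstCaseError_frolovRule_le hd hθ hθp hsp hsθ Ψ hξ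
  obtain ⟨K₀, hK₀, h₀⟩ := exists_minimalError_le_const (d := d) (s := s) hθ hθp Ψ
  obtain ⟨c, hc, hnode⟩ := exists_ncard_frolovNodes_le hd hξ
  have hθ1 : θ⁻¹ ≤ 1 := inv_le_one_of_one_le₀ hθ
  have hs1 : 0 ≤ 1 - s := by linarith
  have hs0 : 0 < s := (inv_pos.mpr (by linarith : 0 < p)).trans hsp
  obtain ⟨κ, hκ⟩ := exists_nat_ge (max c 1)
  have hκ1 : 1 ≤ κ := by exact_mod_cast (le_max_right c 1).trans hκ
  have hκ0 : (0 : ℝ) < κ := by exact_mod_cast hκ1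
  have hmono : ∀ k n : ℕ, k ≤ n → logFactor d k ≤ logFactor d n := by
    intro k n hkn
    refine pow_le_pow_left₀ (by positivity) ?_ _
    have : Nat.log 2 k ≤ Nat.log 2 n := Nat.log_mono_right hkn
    exact_mod_cast Nat.succ_le_succ this
  refine ⟨K₁ * (2 * κ) ^ s + K₀ * (κ : ℝ) ^ s, by positivity, fun n hn Z hZ hZ' => ?_⟩
  have hn0 : (0 : ℝ) < n := by exact_mod_cast hn
  have hV := logFactor_pos d n
  have hX : 0 ≤ (n : ℝ) ^ (-s) * logFactor d n ^ (1 - s) * Z ^ (1 - θ⁻¹) := by positivity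
  rcases lt_or_ge n κ with hlt | hge
  · refine (h₀ n).trans (ENNReal.ofReal_le_ofReal ?_)
    have e1 : 1 ≤ (κ : ℝ) ^ s * (n : ℝ) ^ (-s) := by
      rw [Real.rpow_neg hn0.le, ← div_eq_mul_inv, one_le_div (by positivity)]
      exact Real.rpow_le_rpow hn0.le (by exact_mod_cast hlt.le) hs0.le
    have e2 : 1 ≤ logFactor d n ^ (1 - s) := by
      refine Real.one_le_rpow (one_le_pow₀ ?_) hs1
      linarith [Nat.cast_nonneg (α := ℝ) (Nat.log 2 n)]
    have e3 : 1 ≤ Z ^ (1 - θ⁻¹) := Real.one_le_rpow hZ (by linarith)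
    calc K₀ ≤ K₀ * ((κ : ℝ) ^ s * (n : ℝ) ^ (-s) * logFactor d n ^ (1 - s) * Z ^ (1 - θ⁻¹)) :=
          le_mul_of_one_le_right hK₀.le
            (one_le_mul_of_one_le_of_one_le (one_le_mul_of_one_le_of_one_le e1 e2) e3)
      _ = K₀ * (κ : ℝ) ^ s * ((n : ℝ) ^ (-s) * logFactor d n ^ (1 - s) * Z ^ (1 - θ⁻¹)) := by ring
      _ ≤ _ := mul_le_mul_of_nonneg_right (le_add_of_nonneg_left (by positivity)) hX
  · set N := n / κ
    have hN : 1 ≤ N := Nat.div_pos hge (by omega)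
    have hNn : N ≤ n := Nat.div_le_self _ _
    have hN0 : (0 : ℝ) < N := by exact_mod_cast hN
    have hcard : (frolovNodes ξ N).ncard ≤ n := by
      have h1 : ((frolovNodes ξ N).ncard : ℝ) ≤ κ * N := (hnode N hN).2.trans
        (mul_le_mul_of_nonneg_right ((le_max_left _ _).trans hκ) hN0.le)
      have h2 : (frolovNodes ξ N).ncard ≤ κ * N := by exact_mod_cast h1
      exact h2.trans (Nat.mul_div_le n κ)
    refine (minimalError_le_worstCaseError _ ξ (hnode N hN).1 hcard).trans
      ((h₁ N hN Z hZ (hZ'.imp_right fun hb => le_trans ?_ hb)).trans (ENNReal.ofReal_le_ofReal ?_))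
    · have : Nat.log 2 (Nat.log 2 N + 1) ≤ Nat.log 2 (Nat.log 2 n + 1) :=
        Nat.log_mono_right (Nat.succ_le_succ (Nat.log_mono_right hNn))
      exact_mod_cast Nat.succ_le_succ this
    · have e1 : (N : ℝ) ^ (-s) ≤ (2 * κ) ^ s * (n : ℝ) ^ (-s) := by
        rw [Real.rpow_neg hN0.le, Real.rpow_neg hn0.le, ← div_eq_mul_inv,
          inv_le_comm₀ (by positivity) (by positivity), inv_div,
          ← Real.div_rpow hn0.le (by positivity)]
        refine Real.rpow_le_rpow (by positivity) ?_ hs0.le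
        rw [div_le_iff₀ (by positivity)]
        -- Since N ≥ 1, this gives n ≤ 2κN, the source of the factor (2κ)^s.
        have h1 : n < κ * (N + 1) := Nat.lt_mul_div_succ n (by omega)
        have h2 : n ≤ N * (2 * κ) := by nlinarith
        exact_mod_cast h2
      calc K₁ * ((N : ℝ) ^ (-s) * logFactor d N ^ (1 - s) * Z ^ (1 - θ⁻¹))
          ≤ K₁ * (((2 * κ) ^ s * (n : ℝ) ^ (-s)) * logFactor d n ^ (1 - s) * Z ^ (1 - θ⁻¹)) := by
            have := logFactor_pos d N
            gcongr
            exact hmono N n hNn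
        _ = K₁ * (2 * κ) ^ s * ((n : ℝ) ^ (-s) * logFactor d n ^ (1 - s) * Z ^ (1 - θ⁻¹)) := by ring
        _ ≤ _ := mul_le_mul_of_nonneg_right (le_add_of_nonneg_right (by positivity)) hX

end ErrorBounds

/-! ### Natural logarithms -/

theorem exists_logFactor_rpow_le {d : ℕ} (hd : 1 ≤ d) {s : ℝ} (hs : s ≤ 1) : ∃ c : ℝ, 0 < c ∧
    ∀ n : ℕ, 2 ≤ n → logFactor d n ^ (1 - s) ≤ c * Real.log n ^ (((d : ℝ) - 1) * (1 - s)) := by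
  obtain ⟨c, hc, h⟩ := exists_natLog_add_one_le
  have he : 0 ≤ ((d : ℝ) - 1) * (1 - s) :=
    mul_nonneg (sub_nonneg.mpr (by exact_mod_cast hd)) (by linarith)
  refine ⟨c ^ (((d : ℝ) - 1) * (1 - s)), by positivity, fun n hn => ?_⟩
  have hlog : 0 ≤ Real.log n := Real.log_natCast_nonneg n
  rw [logFactor, ← Real.rpow_natCast, ← Real.rpow_mul (by positivity), Nat.cast_sub hd, Nat.cast_one,
    ← Real.mul_rpow (by linarith) hlog]
  exact Real.rpow_le_rpow (by positivity) (h n hn) he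

theorem exists_bound_of_lt {d : ℕ} (hd : 1 ≤ d) {s θ : ℝ} (hs : s ≤ 1) (hsθ : s < θ⁻¹) {e : ℕ → ℝ≥0∞}
    (he : ∃ K : ℝ, 0 < K ∧ ∀ n : ℕ, 1 ≤ n → ∀ Z : ℝ, 1 ≤ Z →
      (s < θ⁻¹ ∨ (Nat.log 2 (Nat.log 2 n + 1) : ℝ) + 1 ≤ Z) →
      e n ≤ ENNReal.ofReal (K * ((n : ℝ) ^ (-s) * logFactor d n ^ (1 - s) * Z ^ (1 - θ⁻¹)))) :
    ∃ c : ℝ, 0 < c ∧ ∀ n : ℕ, 2 ≤ n →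
      e n ≤ ENNReal.ofReal (c * ((n : ℝ) ^ (-s) * Real.log n ^ (((d : ℝ) - 1) * (1 - s)))) := by
  obtain ⟨K, hK, h⟩ := he
  obtain ⟨c, hc, hV⟩ := exists_logFactor_rpow_le hd hs
  refine ⟨K * c, by positivity, fun n hn => (h n (by omega) 1 le_rfl (Or.inl hsθ)).trans
    (ENNReal.ofReal_le_ofReal ?_)⟩
  rw [Real.one_rpow, mul_one, mul_assoc K]
  refine mul_le_mul_of_nonneg_left ?_ hK.le
  refine (mul_le_mul_of_nonneg_left (hV n hn) (by positivity)).trans (le_of_eq ?_)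
  ring

theorem exists_bound_of_eq {d : ℕ} (hd : 1 ≤ d) {s θ : ℝ} (hs : s ≤ 1) (hsθ : s = θ⁻¹) {e : ℕ → ℝ≥0∞}
    (he : ∃ K : ℝ, 0 < K ∧ ∀ n : ℕ, 1 ≤ n → ∀ Z : ℝ, 1 ≤ Z →
      (s < θ⁻¹ ∨ (Nat.log 2 (Nat.log 2 n + 1) : ℝ) + 1 ≤ Z) →
      e n ≤ ENNReal.ofReal (K * ((n : ℝ) ^ (-s) * logFactor d n ^ (1 - s) * Z ^ (1 - θ⁻¹)))) :
    ∃ c : ℝ, 0 < c ∧ ∀ n : ℕ, 3 ≤ n →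
      e n ≤ ENNReal.ofReal (c * ((n : ℝ) ^ (-s) * Real.log n ^ (((d : ℝ) - 1) * (1 - s)) *
        Real.log (Real.log n) ^ (1 - s))) := by
  obtain ⟨K, hK, h⟩ := he
  obtain ⟨c, hc, hV⟩ := exists_logFactor_rpow_le hd hs
  obtain ⟨c', hc', hZ⟩ := exists_natLog_natLog_add_one_le
  refine ⟨K * (c * c' ^ (1 - s)), by positivity, fun n hn => (h n (by omega)
    ((Nat.log 2 (Nat.log 2 n + 1) : ℝ) + 1) (le_add_of_nonneg_left (Nat.cast_nonneg _)) (Or.inr le_rfl)).trans (ENNReal.ofReal_le_ofReal ?_)⟩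
  rw [← hsθ, mul_assoc K]
  refine mul_le_mul_of_nonneg_left ?_ hK.le
  have hlog := one_lt_log_of_three_le hn
  have hll : 0 ≤ Real.log (Real.log n) := Real.log_nonneg hlog.le
  have e1 : ((Nat.log 2 (Nat.log 2 n + 1) : ℝ) + 1) ^ (1 - s) ≤
      c' ^ (1 - s) * Real.log (Real.log n) ^ (1 - s) := by
    rw [← Real.mul_rpow (by linarith) hll]
    exact Real.rpow_le_rpow (by positivity) (hZ n hn) (by linarith)
  have hl0 : 0 < Real.log n := by linarith
  calc _ ≤ (n : ℝ) ^ (-s) * (c * Real.log n ^ (((d : ℝ) - 1) * (1 - s))) *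
        (c' ^ (1 - s) * Real.log (Real.log n) ^ (1 - s)) :=
        mul_le_mul (mul_le_mul_of_nonneg_left (hV n (by omega)) (by positivity)) e1
          (by positivity) (by positivity)
    _ = _ := by ring

end

/-! ### The main theorem -/

theorem theorem1p2 (d : ℕ) (hd : 1 ≤ d) (p θ s : ℝ) (hθ : 1 ≤ θ) (hθp : θ < p) (hs : 1 / p < s)
    (L : ℕ) (hL : s < (L : ℝ) + 1) (Ψ : LocalMeansKernel L) :
    -- every element of the space is a continuous function
    (∀ f ∈ tlCubeSpace Ψ d s p θ,
      ∃ g : EuclideanSpace ℝ (Fin d) → ℂ, IsContinuousRepresentative f g) ∧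
    -- Frolov's rule exists, and it has at most a constant times `n` nodes
    (∃ ξ : Fin d → ℝ, IsFrolovRoots ξ) ∧
    (∀ ξ : Fin d → ℝ, IsFrolovRoots ξ → ∃ c : ℝ, 0 < c ∧ ∀ n : ℕ, 2 ≤ n →
      (frolovNodes ξ n).Finite ∧ ((frolovNodes ξ n).ncard : ℝ) ≤ c * n) ∧
    -- the case `s < 1 / θ`
    (s < 1 / θ →
      (∃ c : ℝ, 0 < c ∧ ∀ n : ℕ, 2 ≤ n →
        minimalError (tlCubeBall Ψ d s p θ) n ≤
          ENNReal.ofReal (c * ((n : ℝ) ^ (-s) *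
            Real.log n ^ (((d : ℝ) - 1) * (1 - s))))) ∧
      ∀ ξ : Fin d → ℝ, IsFrolovRoots ξ → ∃ c : ℝ, 0 < c ∧ ∀ n : ℕ, 2 ≤ n →
        worstCaseError (tlCubeBall Ψ d s p θ) (frolovRule ξ n) ≤
          ENNReal.ofReal (c * ((n : ℝ) ^ (-s) *
            Real.log n ^ (((d : ℝ) - 1) * (1 - s))))) ∧
    -- the case `s = 1 / θ`
    (s = 1 / θ →
      (∃ c : ℝ, 0 < c ∧ ∀ n : ℕ, 3 ≤ n →
        minimalError (tlCubeBall Ψ d s p θ) n ≤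
          ENNReal.ofReal (c * ((n : ℝ) ^ (-s) *
            Real.log n ^ (((d : ℝ) - 1) * (1 - s)) * Real.log (Real.log n) ^ (1 - s)))) ∧
      ∀ ξ : Fin d → ℝ, IsFrolovRoots ξ → ∃ c : ℝ, 0 < c ∧ ∀ n : ℕ, 3 ≤ n →
        worstCaseError (tlCubeBall Ψ d s p θ) (frolovRule ξ n) ≤
          ENNReal.ofReal (c * ((n : ℝ) ^ (-s) *
            Real.log n ^ (((d : ℝ) - 1) * (1 - s)) * Real.log (Real.log n) ^ (1 - s)))) := by
  have hp : 0 < p := by linarith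
  have hsp : p⁻¹ < s := by rwa [← one_div]
  have hs1 : s ≤ θ⁻¹ → s ≤ 1 := fun h => h.trans (inv_le_one_of_one_le₀ hθ)
  refine ⟨fun f hf => Ψ.exists_isContinuousRepresentative hθ hθp hs f hf.1,
    exists_isFrolovRoots hd, fun ξ hξ => ?_, fun hlt => ?_, fun heq => ?_⟩
  · obtain ⟨c, hc, h⟩ := exists_ncard_frolovNodes_le hd hξ
    exact ⟨c, hc, fun n hn => h n (by omega)⟩
  · rw [one_div] at hlt
    exact ⟨exists_bound_of_lt hd (hs1 hlt.le) hlt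
        (exists_minimalError_le hd hθ hθp hsp hlt.le Ψ),
      fun ξ hξ => exists_bound_of_lt hd (hs1 hlt.le) hlt
        (exists_worstCaseError_frolovRule_le hd hθ hθp hsp hlt.le Ψ hξ)⟩
  · rw [one_div] at heq
    exact ⟨exists_bound_of_eq hd (hs1 heq.le) heq
        (exists_minimalError_le hd hθ hθp hsp heq.le Ψ),
      fun ξ hξ => exists_bound_of_eq hd (hs1 heq.le) heq
        (exists_worstCaseError_frolovRule_le hd hθ hθp hsp heq.le Ψ hξ)⟩
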